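/- Setting. Let $\Omega\subset\mathbb R^2$ be a bounded convex polygonal domain, $\mathcal A:\overline\Omega\to\mathbb R^{2\times2}$ a Lipschitz continuous, symmetric matrix function with $\xi^T\mathcal A(x)\xi\ge\beta_0\,\xi^T\xi$ for all $x\in\overline\Omega$, $\xi\in\mathbb R^2$ and some $\beta_0>0$, and $q:\overline\Omega\to[0,\infty)$ Lipschitz continuous. Write $(\cdot,\cdot)$, $\|\cdot\|$ for the inner product and norm of $L^2(\Omega)$ and $\|\cdot\|_1$ for the full norm of $H^1(\Omega)$. Meshes. Fix $\rho>0$. We consider all conforming triangulations $\mathcal T_h$ of $\overline\Omega$, $h=\max_K\operatorname{diam}K$, that are quasi-uniform with constant $\rho$: every triangle contains a disc of diameter $\rho h$. Let $Z_h^0$ be the set of interior vertices and $V_h$ the space of continuous functions on $\overline\Omega$ that are affine on each triangle and vanish on $\partial\Omega$. The control volume $K_z^*$ of $z\in Z_h^0$ is bounded by the segments that join, in each triangle with vertex $z$, the barycenter to the midpoints of the two edges at $z$. Put $I_h^*v=\sum_{z\in Z_h^0}v(z)\chi_{K_z^*}$ and $$a(v,I_h^*w)=-\sum_{z\in Z_h^0}w(z)\int_{\partial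 K_z^*}\mathcal A\nabla v\cdot n\,ds,\qquad v,w\in V_h,$$ with $n$ the outer unit normal. Scheme. Let $0<\alpha<1$, $T>0$, $N\ge1$, $\tau=T/N$, $t_n=n\tau$, and let $f:[0,T]\to L^2(\Omega)$ be bounded. With $b_k=(k+1)^{1-\alpha}-k^{1-\alpha}$, $\tilde b^n_n=1$, $\tilde b^n_0=(n-1)^{1-\alpha}-n^{1-\alpha}$, $\tilde b^n_k=b_{n-k}-b_{n-k-1}$ $(0<k<n)$ and $$D_\tau^\alpha\varphi^n=\frac{\tau^{-\alpha}}{\Gamma(2-\alpha)}\sum_{k=0}^n\tilde b_k^n\varphi^k,$$ a solution of the scheme is a sequence $u_h^0,\dots,u_h^N\in V_h$ such that for $n=1,\dots,N$ $$(D_\tau^\alpha u_h^n,I_h^*v_h)+a(u_h^n,I_h^*v_h)+(qu_h^n,I_h^*v_h)=(f(t_n),I_h^*v_h)\qquad\forall v_h\in V_h.$$ Theorem. There is $h_0>0$, depending only on $\Omega,\mathcal A,q,\rho$, with the following properties. (0) There are constants $\mu_5,\mu_6>0$ such that on all these meshes, for all $v,w\in V_h$, $$|a(v,I_h^*w)-a(w,I_h^*v)|\le\mu_5\,h\,\|v\|_1\|w\|_1,\qquad\text{and,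 if }h\le h_0,\qquad a(v,I_h^*v)\ge\mu_6\|v\|_1^2.\tag{$*$}$$ Let $0<\alpha<1$ and $T>0$. (1) There is a constant $C>0$, independent of $h$, $\tau$, $f$ and $u_h^0$, such that for all these meshes with $h\le h_0$, all $N\ge1$ (no condition relates $\tau$ and $h$) and all solutions of the scheme, $$\|u_h^n\|\le C\Big(\|u_h^0\|+\sup_{t\in[0,T]}\|f(t)\|\Big),\qquad 1\le n\le N.$$ (2) Let $\mu_5,\mu_6>0$ be any constants with $(*)$ and put $h_1=\min\{\mu_6/\mu_5,1\}$. There is a constant $C>0$, independent of $h$, $\tau$, $f$, $u_h^0$ and $c_0$, such that for every $c_0>0$ there is $\tau_0\in(0,1)$, independent of $h$, $\tau$, $f$ and $u_h^0$, such that, whenever $h\le c_0\tau\le c_0\tau_0$, $h\le h_1$ and $h\le h_0$, all solutions of the scheme satisfy $$\|u_h^n\|_1\le C\,e^{\frac{c_0T\mu_5}{2\mu_6}}\Big(\|u_h^0\|_1+\sup_{t\in[0,T]}\|f(t)\|\Big),\qquad 1\le n\le N.$$ -/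

import Mathlib

open MeasureTheory Set
open scoped Matrix

noncomputable section

namespace FVE

/-- The Euclidean plane. -/
abbrev Plane : Type := EuclideanSpace ℝ (Fin 2)

/-! ### The data of the problem -/

/-- A bounded convex polygonal domain: the nonempty interior of the convex hull of finitely many
points of the plane. -/
def IsConvexPolygonalDomain (Ω : Set Plane) : Prop :=
  Ω.Nonempty ∧ ∃ S : Finset Plane, Ω = interior (convexHull ℝ (S : Set Plane))

/-- The diffusion coefficient: a symmetric, uniformly positive definite matrix function with
Lipschitz continuous entries on the closure of `Ω`. -/
structure IsDiffusionCoeff (Ω : Set Plane) (A : Plane → Matrix (Fin 2) (Fin 2) ℝ) : Prop where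
  lipschitz : ∀ i j, ∃ L : NNReal, LipschitzOnWith L (fun x => A x i j) (closure Ω)
  symm : ∀ x ∈ closure Ω, (A x).IsSymm
  posDef : ∃ β₀ : ℝ, 0 < β₀ ∧ ∀ x ∈ closure Ω, ∀ ξ : Fin 2 → ℝ,
    β₀ * (ξ ⬝ᵥ ξ) ≤ ξ ⬝ᵥ (A x *ᵥ ξ)

/-- The reaction coefficient: nonnegative and Lipschitz continuous on the closure of `Ω`. -/
structure IsReactionCoeff (Ω : Set Plane) (q : Plane → ℝ) : Prop where
  lipschitz : ∃ L : NNReal, LipschitzOnWith L q (closure Ω)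
  nonneg : ∀ x ∈ closure Ω, 0 ≤ q x

/-- The `L²(Ω)` inner product. -/
def l2Inner (Ω : Set Plane) (v w : Plane → ℝ) : ℝ := ∫ x in Ω, v x * w x

/-- The `L²(Ω)` norm. -/
def l2Norm (Ω : Set Plane) (v : Plane → ℝ) : ℝ := Real.sqrt (∫ x in Ω, v x ^ 2)

/-- The full `H¹(Ω)` norm. It is used for continuous piecewise linear functions only; these are
differentiable off a null set, and their classical gradient there is the weak gradient. -/
def h1Norm (Ω : Set Plane) (v : Plane → ℝ) : ℝ :=
  Real.sqrt ((∫ x in Ω, v x ^ 2) + ∫ x in Ω, ‖gradient v x‖ ^ 2)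

/-- The source term `f t = f(·, t)`: a bounded function of `t ∈ [0, T]` with values in `L²(Ω)`. -/
structure IsSource (Ω : Set Plane) (T : ℝ) (f : ℝ → Plane → ℝ) : Prop where
  memLp : ∀ t ∈ Icc (0 : ℝ) T, MemLp (f t) 2 (volume.restrict Ω)
  bdd : BddAbove (range fun t : Icc (0 : ℝ) T => l2Norm Ω (f t))

/-- `sup_{t ∈ [0,T]} ‖f(t)‖`. -/
def supNorm (Ω : Set Plane) (T : ℝ) (f : ℝ → Plane → ℝ) : ℝ :=
  ⨆ t : Icc (0 : ℝ) T, l2Norm Ω (f t)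

/-! ### Primal and dual meshes -/

/-- A conforming triangulation of the closure of `Ω`. A triangle is given by its three vertices;
two triangles meet in the convex hull of their common vertices (a common edge, a common vertex or
nothing, unless they coincide). -/
structure TriMesh (Ω : Set Plane) where
  triangles : Finset (Finset Plane)
  card_eq_three : ∀ K ∈ triangles, K.card = 3
  affineIndependent : ∀ K ∈ triangles, AffineIndependent ℝ ((↑) : K → Plane)
  cover : (⋃ K ∈ triangles, convexHull ℝ (K : Set Plane)) = closure Ω
  conforming : ∀ K ∈ triangles, ∀ L ∈ triangles,
    convexHull ℝ (K : Set Plane) ∩ convexHull ℝ (L : Set Plane) ⊆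
      convexHull ℝ ((K : Set Plane) ∩ (L : Set Plane))

/-- The barycenter of a triangle. -/
def barycenter (K : Finset Plane) : Plane := (1 / 3 : ℝ) • ∑ z ∈ K, z

/-- The part of the control volume of the vertex `z` that lies in the triangle `K`: the
quadrilateral spanned by `z`, the midpoints of the two edges of `K` at `z`, and the barycenter of
`K` (note that `midpoint ℝ z z = z`). -/
def dualCell (K : Finset Plane) (z : Plane) : Set Plane :=
  convexHull ℝ (insert (barycenter K) ((fun y => midpoint ℝ z y) '' (K : Set Plane)))

/-- A normal vector to the segment from `p` to `r`, with the length of that segment, that points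
away from `z`. -/
def outwardNormal (z p r : Plane) : Plane :=
  Real.sign (inner ℝ (!₂[r 1 - p 1, p 0 - r 0] : Plane) (p - z)) •
    (!₂[r 1 - p 1, p 0 - r 0] : Plane)

/-- The flux `∫ A ∇u · n ds` through the segment from `p` to `r`, with `n` the unit normal that
points away from `z`. In the parametrization by `[0, 1]`, `n ds` is `outwardNormal z p r dt`. -/
def segmentFlux (A : Plane → Matrix (Fin 2) (Fin 2) ℝ) (u : Plane → ℝ) (z p r : Plane) : ℝ :=
  ∫ t in (0 : ℝ)..1,
    (outwardNormal z p r).ofLp ⬝ᵥ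
      (A (AffineMap.lineMap p r t) *ᵥ (gradient u (AffineMap.lineMap p r t)).ofLp)

namespace TriMesh

variable {Ω : Set Plane}

/-- The mesh size: the largest diameter of a triangle. -/
def meshSize (𝒯 : TriMesh Ω) : ℝ :=
  sSup ((fun K : Finset Plane => Metric.diam (convexHull ℝ (K : Set Plane))) ''
    (𝒯.triangles : Set (Finset Plane)))

/-- Quasi-uniformity with constant `ρ`: every triangle contains a disc of diameter `ρ h`. -/
def IsQuasiUniform (𝒯 : TriMesh Ω) (ρ : ℝ) : Prop :=
  ∀ K ∈ 𝒯.triangles, ∃ c : Plane,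
    Metric.ball c (ρ * 𝒯.meshSize / 2) ⊆ convexHull ℝ (K : Set Plane)

open Classical in
/-- The interior vertices of the mesh. -/
def interiorVertices (𝒯 : TriMesh Ω) : Finset Plane :=
  (𝒯.triangles.biUnion id).filter (fun z => z ∈ Ω)

/-- The control volume of the vertex `z`. -/
def controlVolume (𝒯 : TriMesh Ω) (z : Plane) : Set Plane :=
  ⋃ K ∈ 𝒯.triangles, ⋃ (_ : z ∈ K), dualCell K z

/-- The trial space: continuous functions on the closure of `Ω` that are affine on each triangle
and vanish on the boundary (values outside the closure are irrelevant). -/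
def trialSpace (𝒯 : TriMesh Ω) : Set (Plane → ℝ) :=
  {v | ContinuousOn v (closure Ω) ∧ (∀ x ∈ frontier Ω, v x = 0) ∧
    ∀ K ∈ 𝒯.triangles, ∃ g : Plane →ᵃ[ℝ] ℝ, EqOn v g (convexHull ℝ (K : Set Plane))}

/-- The piecewise constant interpolation on the dual mesh:
the sum of `v(z) Ψ_z` over the interior vertices `z`, with `Ψ_z` the characteristic function of
the control volume of `z`. -/
def interpStar (𝒯 : TriMesh Ω) (v : Plane → ℝ) : Plane → ℝ := fun x =>
  ∑ z ∈ 𝒯.interiorVertices, v z * (𝒯.controlVolume z).indicator (fun _ => (1 : ℝ)) x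

open Classical in
/-- The flux `∫_{∂K*_z} A ∇u · n ds` through the boundary of the control volume of an interior
vertex `z`. This boundary consists, in each triangle `K` at `z`, of the segments from the midpoints
of the two edges of `K` at `z` to the barycenter of `K`. -/
def boundaryFlux (𝒯 : TriMesh Ω) (A : Plane → Matrix (Fin 2) (Fin 2) ℝ) (u : Plane → ℝ)
    (z : Plane) : ℝ :=
  ∑ K ∈ 𝒯.triangles.filter (fun K => z ∈ K), ∑ y ∈ K.erase z,
    segmentFlux A u z (midpoint ℝ z y) (barycenter K)

/-- The bilinear form `a(u, w) = -∑_z w(z) ∫_{∂K*_z} A ∇u · n ds` for `u` in the trial space and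
`w` in the test space. Functions of the test space vanish on the boundary, so that only interior
vertices contribute. -/
def form (𝒯 : TriMesh Ω) (A : Plane → Matrix (Fin 2) (Fin 2) ℝ) (u w : Plane → ℝ) : ℝ :=
  -∑ z ∈ 𝒯.interiorVertices, w z * 𝒯.boundaryFlux A u z

end TriMesh

/-! ### The fully discrete scheme -/

/-- `b_k = (k+1)^{1-α} - k^{1-α}`. -/
def l1b (α : ℝ) (k : ℕ) : ℝ := ((k : ℝ) + 1) ^ (1 - α) - (k : ℝ) ^ (1 - α)

/-- The coefficients of the L1 formula, for `0 ≤ k ≤ n` and `1 ≤ n`. -/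
def l1Coeff (α : ℝ) (n k : ℕ) : ℝ :=
  if k = n then 1
  else if k = 0 then ((n : ℝ) - 1) ^ (1 - α) - (n : ℝ) ^ (1 - α)
  else l1b α (n - k) - l1b α (n - k - 1)

/-- The L1 approximation of the Caputo derivative of order `α` at the time level `n`, with time
step `τ`. -/
def l1Deriv (α τ : ℝ) (φ : ℕ → Plane → ℝ) (n : ℕ) : Plane → ℝ := fun x =>
  τ ^ (-α) / Real.Gamma (2 - α) * ∑ k ∈ Finset.range (n + 1), l1Coeff α n k * φ k x

/-- `u 0, …, u N` solves the fully discrete finite volume element scheme with time step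
`τ = T / N`; the initial value `u 0` is any element of the trial space. -/
structure IsFVESolution {Ω : Set Plane} (𝒯 : TriMesh Ω) (A : Plane → Matrix (Fin 2) (Fin 2) ℝ)
    (q : Plane → ℝ) (α T : ℝ) (N : ℕ) (f : ℝ → Plane → ℝ) (u : ℕ → Plane → ℝ) : Prop where
  mem : ∀ n ≤ N, u n ∈ 𝒯.trialSpace
  scheme : ∀ n, 1 ≤ n → n ≤ N → ∀ v ∈ 𝒯.trialSpace,
    l2Inner Ω (l1Deriv α (T / N) u n) (𝒯.interpStar v) + 𝒯.form A (u n) (𝒯.interpStar v) +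
        l2Inner Ω (fun x => q x * u n x) (𝒯.interpStar v) =
      l2Inner Ω (f (n * (T / N))) (𝒯.interpStar v)

/-! ### The constants in the statement -/

/-- `|a(v, I*w) - a(w, I*v)| ≤ μ₅ h ‖v‖₁ ‖w‖₁` on the trial spaces of all quasi-uniform meshes. -/
def AsymmetryBound (Ω : Set Plane) (A : Plane → Matrix (Fin 2) (Fin 2) ℝ) (ρ μ₅ : ℝ) : Prop :=
  ∀ 𝒯 : TriMesh Ω, 𝒯.IsQuasiUniform ρ → ∀ v ∈ 𝒯.trialSpace, ∀ w ∈ 𝒯.trialSpace,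
    |𝒯.form A v (𝒯.interpStar w) - 𝒯.form A w (𝒯.interpStar v)| ≤
      μ₅ * 𝒯.meshSize * h1Norm Ω v * h1Norm Ω w

/-- `a(v, I*v) ≥ μ₆ ‖v‖₁²` on the trial spaces of all quasi-uniform meshes with `h ≤ h₀`. -/
def CoercivityBound (Ω : Set Plane) (A : Plane → Matrix (Fin 2) (Fin 2) ℝ) (ρ h₀ μ₆ : ℝ) : Prop :=
  ∀ 𝒯 : TriMesh Ω, 𝒯.IsQuasiUniform ρ → 𝒯.meshSize ≤ h₀ → ∀ v ∈ 𝒯.trialSpace,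
    μ₆ * h1Norm Ω v ^ 2 ≤ 𝒯.form A v (𝒯.interpStar v)

end FVE

end

noncomputable section

namespace FVE

/-! ### Triangles as affine images of a reference triangle -/

/-! Space. On each triangle the form `(v, I*w)` is, up to the area, a positive multiple of `∑ v(z)
w(z)` plus a nonnegative multiple of `(∑ v(z)) (∑ w(z))` (`mass_eq`). It is therefore symmetric, and
`(v, I*v)` is equivalent to the squared `L²` norm. If the coefficient is frozen at the barycenter,
the flux form on a triangle is exactly a finite element form (`edgeNormal_identity`); since `A` is
Lipschitz, freezing costs a relative error of order `h` (`abs_form_sub_frozenForm_le`). The frozen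
form is symmetric and coercive on gradients. This gives the asymmetry bound and, with the Poincaré
inequality and small `h`, the coercivity. Freezing `q` in the same way makes the reaction form
nonnegative up to order `h`, and coercivity absorbs this.

Time. The weights `-l1Coeff α n k`, `k < n`, are nonnegative with sum one. For a symmetric
nonnegative form `S` this bounds `2 S(u n, D)`, with `D` the L1 combination, below by `S(u n, u n)`
minus a convex combination of the earlier values (`l1_energy`). A quantity `E n` that satisfies `(1
+ σ) E n ≤ convex combination + σ B` never exceeds `max (E 0) B` (`le_max_of_l1_inequality`). No
Gronwall argument is needed, and the constants do not depend on the step size.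

The two bounds. Testing with `u n` yields the `L²` bound for `E = M(u, u)`, where `M` is the mass
form. For the `H¹` bound the scheme is also tested with the discrete derivative `w`. The form `a` is
not symmetric, but its asymmetry is at most of order `h ‖u n‖₁ ‖w‖₁`, and the inverse inequality
turns `h ‖w‖₁` into `M(w, w)^(1/2)`, which the term `M(w, w)` of the scheme absorbs. What remains is
a multiple of `‖u n‖₁²`; it is absorbed by adding `Λ` times the first energy inequality, and the
maximum principle applies to `E = Λ M + a` (`energy_stability`). The resulting bound has no
exponential; the factor in the statement is at least one and is inserted at the end. -/

/-- The determinant of two vectors of the plane. -/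
def planeDet (u v : Plane) : ℝ := u 0 * v 1 - u 1 * v 0

/-- Twice the signed area of the triangle with vertices `a`, `b`, `c`. -/
def triDet (a b c : Plane) : ℝ := planeDet (b - a) (c - a)

/-- The linear map that sends the standard basis to `u`, `v`. -/
def linPair (u v : Plane) : Plane →L[ℝ] Plane :=
  (EuclideanSpace.proj (0 : Fin 2)).smulRight u + (EuclideanSpace.proj (1 : Fin 2)).smulRight v

theorem linPair_apply (u v x : Plane) : linPair u v x = x 0 • u + x 1 • v := by
  simp [linPair]

theorem det_linPair (u v : Plane) : (linPair u v).det = planeDet u v := by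
  rw [ContinuousLinearMap.det,
    ← LinearMap.det_toMatrix (EuclideanSpace.basisFun (Fin 2) ℝ).toBasis, Matrix.det_fin_two]
  simp [LinearMap.toMatrix_apply, linPair_apply, planeDet]
  ring

theorem linPair_injective {u v : Plane} (h : planeDet u v ≠ 0) :
    Function.Injective (linPair u v) := by
  refine (injective_iff_map_eq_zero _).2 fun x hx => ?_
  rw [linPair_apply] at hx
  have h0 := congrArg (fun y : Plane => y 0) hx
  have h1 := congrArg (fun y : Plane => y 1) hx
  simp only [PiLp.add_apply, PiLp.smul_apply, smul_eq_mul, PiLp.zero_apply] at h0 h1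
  have e0 : x 0 * planeDet u v = 0 := by unfold planeDet; linear_combination v 1 * h0 - v 0 * h1
  have e1 : x 1 * planeDet u v = 0 := by unfold planeDet; linear_combination u 0 * h1 - u 1 * h0
  ext i
  fin_cases i
  · simpa [h] using e0
  · simpa [h] using e1

/-- The affine map that sends `0` and the two unit vectors to `a`, `b`, `c`. -/
def triMap (a b c : Plane) : Plane →ᵃ[ℝ] Plane :=
  (linPair (b - a) (c - a)).toLinearMap.toAffineMap + AffineMap.const ℝ Plane a

theorem triMap_apply (a b c x : Plane) :
    triMap a b c x = x 0 • (b - a) + x 1 • (c - a) + a := by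
  simp [triMap, linPair_apply]

theorem triMap_injective {a b c : Plane} (h : triDet a b c ≠ 0) :
    Function.Injective (triMap a b c) := by
  intro x y hxy
  apply linPair_injective h
  simpa [triMap] using hxy

theorem hasFDerivAt_triMap (a b c x : Plane) :
    HasFDerivAt (triMap a b c) (linPair (b - a) (c - a)) x := by
  have : (triMap a b c : Plane → Plane) = fun x => linPair (b - a) (c - a) x + a := by
    funext y; simp [triMap]
  rw [this]
  exact (linPair (b - a) (c - a)).hasFDerivAt.add_const a

theorem continuous_triMap (a b c : Plane) : Continuous (triMap a b c) :=
  continuous_iff_continuousAt.2 fun x => (hasFDerivAt_triMap a b c x).continuousAt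

theorem isOpenMap_triMap {a b c : Plane} (h : triDet a b c ≠ 0) : IsOpenMap (triMap a b c) := by
  have hb : Function.Surjective (linPair (b - a) (c - a)) :=
    LinearMap.surjective_of_injective (f := (linPair (b - a) (c - a)).toLinearMap)
      (linPair_injective h)
  have : (triMap a b c : Plane → Plane) = (fun x => x + a) ∘ linPair (b - a) (c - a) := by
    funext y; simp [triMap]
  rw [this]
  exact (Homeomorph.addRight a).isOpenMap.comp (ContinuousLinearMap.isOpenMap _ hb)

theorem setIntegral_image_triMap {a b c : Plane} (h : triDet a b c ≠ 0) {s : Set Plane}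
    (hs : MeasurableSet s) (F : Plane → ℝ) :
    ∫ x in triMap a b c '' s, F x = |triDet a b c| * ∫ x in s, F (triMap a b c x) := by
  rw [integral_image_eq_integral_abs_det_fderiv_smul volume hs
    (fun x _ => (hasFDerivAt_triMap a b c x).hasFDerivWithinAt) (triMap_injective h).injOn,
    det_linPair]
  simp only [smul_eq_mul]
  rw [integral_const_mul]
  rfl

/-- The triangle with vertices `0` and the two unit vectors. -/
def refTriangle : Set Plane := convexHull ℝ {0, !₂[1, 0], !₂[0, 1]}

/-- The dual cell of the vertex `0` in the reference triangle. -/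
def refCell : Set Plane := convexHull ℝ {!₂[1 / 3, 1 / 3], 0, !₂[1 / 2, 0], !₂[0, 1 / 2]}

theorem isCompact_refCell : IsCompact refCell :=
  ((((finite_singleton _).insert _).insert _).insert _).isCompact_convexHull ℝ

theorem isCompact_refTriangle : IsCompact refTriangle :=
  (((finite_singleton _).insert _).insert _).isCompact_convexHull ℝ

/-- The interior of the reference triangle. -/
def openRef : Set Plane := {x | 0 < x 0 ∧ 0 < x 1 ∧ x 0 + x 1 < 1}

theorem isOpen_openRef : IsOpen openRef := by
  refine IsOpen.and ?_ (IsOpen.and ?_ ?_)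
  · exact isOpen_lt continuous_const (by fun_prop)
  · exact isOpen_lt continuous_const (by fun_prop)
  · exact isOpen_lt (by fun_prop) continuous_const

theorem _root_.Convex.smul_add_smul_add_smul_mem {s : Set Plane} (hs : Convex ℝ s) {x y z : Plane}
    (hx : x ∈ s) (hy : y ∈ s) (hz : z ∈ s) {p q r : ℝ} (hp : 0 ≤ p) (hq : 0 ≤ q) (hr : 0 ≤ r)
    (h : p + q + r = 1) : p • x + q • y + r • z ∈ s := by
  have := hs.sum_mem (t := Finset.univ) (w := ![p, q, r]) (z := ![x, y, z])
    (by intro i _; fin_cases i <;> simpa) (by simpa [Fin.sum_univ_three] using h)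
    (by intro i _; fin_cases i <;> simpa)
  simpa [Fin.sum_univ_three] using this

theorem openRef_subset : openRef ⊆ refTriangle := by
  rintro x ⟨h0, h1, h2⟩
  have : x = (1 - x 0 - x 1) • (0 : Plane) + x 0 • (!₂[1, 0] : Plane) + x 1 • !₂[0, 1] := by
    ext i; fin_cases i <;> simp
  rw [this]
  exact (convex_convexHull ℝ _).smul_add_smul_add_smul_mem (subset_convexHull ℝ _ (by simp))
    (subset_convexHull ℝ _ (by simp)) (subset_convexHull ℝ _ (by simp)) (by linarith) h0.le h1.le
    (by ring)

theorem measurableSet_refCell : MeasurableSet refCell := isCompact_refCell.measurableSet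

theorem refCell_induction {P : Plane → Prop} (hP : Convex ℝ {x | P x})
    (h1 : P !₂[1 / 3, 1 / 3]) (h2 : P 0) (h3 : P !₂[1 / 2, 0]) (h4 : P !₂[0, 1 / 2]) :
    ∀ x ∈ refCell, P x := by
  intro x hx
  refine convexHull_min ?_ hP hx
  rintro y (rfl | rfl | rfl | rfl) <;> assumption

theorem convex_affine_le (p q r : ℝ) : Convex ℝ {x : Plane | 0 ≤ p + q * x 0 + r * x 1} := by
  intro x hx y hy s t hs ht hst
  simp only [mem_ofPred_eq, PiLp.add_apply, PiLp.smul_apply, smul_eq_mul] at *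
  have := add_nonneg (mul_nonneg hs hx) (mul_nonneg ht hy)
  have e : p = s * p + t * p := by rw [← add_mul, hst, one_mul]
  nlinarith

/-- An affine inequality on a convex hull need only be checked at the generating points, here the
four corners of the cell. -/
theorem refCell_affine_nonneg (p q r : ℝ) (h1 : 0 ≤ p + q / 3 + r / 3) (h2 : 0 ≤ p)
    (h3 : 0 ≤ p + q / 2) (h4 : 0 ≤ p + r / 2) : ∀ x ∈ refCell, 0 ≤ p + q * x 0 + r * x 1 := by
  refine refCell_induction (convex_affine_le p q r) ?_ ?_ ?_ ?_ <;> simp <;> linarith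

/-- The integral over `refCell` of the barycentric coordinate of the vertex `0`. -/
def refMass₀ : ℝ := ∫ x in refCell, (1 - x 0 - x 1)

/-- The integral over `refCell` of the barycentric coordinate of another vertex. -/
def refMass₁ : ℝ := ∫ x in refCell, x 0

/-- The area of the reference triangle. -/
def refArea : ℝ := volume.real refTriangle

theorem refArea_pos : 0 < refArea := by
  have h : 0 < volume refTriangle := by
    refine (isOpen_openRef.measure_pos volume ⟨!₂[1 / 4, 1 / 4], ?_⟩).trans_le
      (measure_mono openRef_subset)
    simp [openRef]; norm_num
  exact ENNReal.toReal_pos h.ne' isCompact_refTriangle.measure_lt_top.ne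

/-- By reflection, both coordinates have the same integral over `refCell`. -/
theorem refMass₁_eq : ∫ x in refCell, x 1 = refMass₁ := by
  have hdet : triDet 0 !₂[0, 1] !₂[1, 0] = -1 := by simp [triDet, planeDet]
  have himg : triMap 0 !₂[0, 1] !₂[1, 0] '' refCell = refCell := by
    have h0 : triMap 0 !₂[0, 1] !₂[1, 0] !₂[1 / 3, 1 / 3] = !₂[1 / 3, 1 / 3] := by
      ext i; fin_cases i <;> simp [triMap_apply]
    have h1 : triMap 0 !₂[0, 1] !₂[1, 0] 0 = 0 := by
      ext i; fin_cases i <;> simp [triMap_apply]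
    have h2 : triMap 0 !₂[0, 1] !₂[1, 0] !₂[1 / 2, 0] = !₂[0, 1 / 2] := by
      ext i; fin_cases i <;> simp [triMap_apply]
    have h3 : triMap 0 !₂[0, 1] !₂[1, 0] !₂[0, 1 / 2] = !₂[1 / 2, 0] := by
      ext i; fin_cases i <;> simp [triMap_apply]
    rw [refCell, AffineMap.image_convexHull]
    simp only [image_insert_eq, image_singleton, h0, h1, h2, h3]
    rw [pair_comm (!₂[0, 1 / 2] : Plane)]
  have := setIntegral_image_triMap (a := 0) (b := !₂[0, 1]) (c := !₂[1, 0]) (by rw [hdet]; norm_num)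
    measurableSet_refCell (fun x => x 1)
  rw [himg, hdet] at this
  rw [this, refMass₁]
  simp [triMap_apply]

theorem integrableOn_refCell {F : Plane → ℝ} (hF : Continuous F) : IntegrableOn F refCell :=
  hF.continuousOn.integrableOn_compact isCompact_refCell

theorem refMass₁_nonneg : 0 ≤ refMass₁ := by
  refine setIntegral_nonneg measurableSet_refCell fun x hx => ?_
  have := refCell_affine_nonneg 0 1 0 (by norm_num) (by norm_num) (by norm_num) (by norm_num) x hx
  simpa using this

/-- On the cell of the vertex `0` the coordinate of that vertex dominates the others, strictly on an
open part. The elementwise mass matrix is a multiple of the identity plus a nonnegative rank-one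
matrix, and the difference of the two masses is the factor of the identity: strictness makes the
mass form definite. -/
theorem refMass₁_lt : refMass₁ < refMass₀ := by
  have h : 0 < ∫ x in refCell, (1 - 2 * x 0 - x 1) := by
    rw [setIntegral_pos_iff_support_of_nonneg_ae]
    · set B : Set Plane := {x | 0 < x 0 ∧ 0 < x 1 ∧ x 0 + x 1 < 1 / 4}
      have hB : IsOpen B := by
        refine IsOpen.and ?_ (IsOpen.and ?_ ?_)
        · exact isOpen_lt continuous_const (by fun_prop)
        · exact isOpen_lt continuous_const (by fun_prop)
        · exact isOpen_lt (by fun_prop) continuous_const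
      refine (hB.measure_pos volume ⟨!₂[1 / 10, 1 / 10], ?_⟩).trans_le (measure_mono ?_)
      · simp [B]; norm_num
      · rintro x ⟨h0, h1, h2⟩
        refine ⟨?_, ?_⟩
        · simp only [Function.mem_support]; linarith
        · have : x = (1 - 2 * x 0 - 2 * x 1) • (0 : Plane) + (2 * x 0) • (!₂[1 / 2, 0] : Plane) +
              (2 * x 1) • !₂[0, 1 / 2] := by
            ext i; fin_cases i <;> simp <;> ring
          rw [this]
          exact (convex_convexHull ℝ _).smul_add_smul_add_smul_mem
            (subset_convexHull ℝ _ (by simp)) (subset_convexHull ℝ _ (by simp))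
            (subset_convexHull ℝ _ (by simp)) (by linarith) (by linarith) (by linarith) (by ring)
    · filter_upwards [ae_restrict_mem measurableSet_refCell] with x hx
      have := refCell_affine_nonneg 1 (-2) (-1) (by norm_num) (by norm_num) (by norm_num)
        (by norm_num) x hx
      simp only [Pi.zero_apply]; linarith
    · exact integrableOn_refCell (by fun_prop)
  have e : refMass₀ - refMass₁ = ∫ x in refCell, (1 - 2 * x 0 - x 1) := by
    rw [refMass₀, refMass₁, ← integral_sub (integrableOn_refCell (by fun_prop))
      (integrableOn_refCell (by fun_prop))]
    congr 1; funext x; ring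
  linarith

/-! ### Nondegenerate triangles and their dual cells -/

/-- `K` is a nondegenerate triangle with vertices `a`, `b`, `c`. -/
structure IsTriangle (K : Finset Plane) (a b c : Plane) : Prop where
  ab : a ≠ b
  ac : a ≠ c
  bc : b ≠ c
  eq : K = {a, b, c}
  det : triDet a b c ≠ 0

namespace IsTriangle

variable {K : Finset Plane} {a b c : Plane}

theorem coe_eq (h : IsTriangle K a b c) : (K : Set Plane) = {a, b, c} := by
  rw [h.eq]; simp

theorem rotate (h : IsTriangle K a b c) : IsTriangle K b c a := by
  refine ⟨h.bc, h.ab.symm, h.ac.symm, ?_, ?_⟩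
  · rw [h.eq]; ext x; simp; tauto
  · have := h.det
    have e : triDet b c a = triDet a b c := by simp [triDet, planeDet]; ring
    rwa [e]

theorem swap (h : IsTriangle K a b c) : IsTriangle K a c b := by
  refine ⟨h.ac, h.ab, h.bc.symm, ?_, ?_⟩
  · rw [h.eq]; ext x; simp; tauto
  · have := h.det
    have e : triDet a c b = - triDet a b c := by simp [triDet, planeDet]; ring
    rw [e]; simpa using this

theorem sum_eq {M : Type*} [AddCommMonoid M] (h : IsTriangle K a b c) (F : Plane → M) :
    ∑ z ∈ K, F z = F a + (F b + F c) := by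
  rw [h.eq, Finset.sum_insert, Finset.sum_pair h.bc]
  simp [h.ab, h.ac]

theorem mem_iff (h : IsTriangle K a b c) {z : Plane} : z ∈ K ↔ z = a ∨ z = b ∨ z = c := by
  rw [h.eq]; simp

theorem erase_sum_eq {M : Type*} [AddCommMonoid M] [DecidableEq Plane] (h : IsTriangle K a b c)
    (F : Plane → M) : ∑ z ∈ K.erase a, F z = F b + F c := by
  have : K.erase a = {b, c} := by
    rw [h.eq]; ext x; simp
    constructor
    · rintro ⟨h1, h2⟩; tauto
    · rintro (rfl | rfl)
      · exact ⟨h.ab.symm, by simp⟩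
      · exact ⟨h.ac.symm, by simp⟩
  rw [this, Finset.sum_pair h.bc]

theorem convexHull_eq (h : IsTriangle K a b c) :
    convexHull ℝ (K : Set Plane) = triMap a b c '' refTriangle := by
  rw [refTriangle, AffineMap.image_convexHull, h.coe_eq]
  congr 1
  simp [image_insert_eq, triMap_apply]

theorem barycenter_eq (h : IsTriangle K a b c) :
    barycenter K = triMap a b c !₂[1 / 3, 1 / 3] := by
  rw [barycenter, h.sum_eq, triMap_apply]
  simp
  module

theorem dualCell_eq (h : IsTriangle K a b c) : dualCell K a = triMap a b c '' refCell := by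
  rw [refCell, AffineMap.image_convexHull, dualCell, h.coe_eq, h.barycenter_eq]
  congr 1
  have hab : midpoint ℝ a b = triMap a b c !₂[1 / 2, 0] := by
    rw [triMap_apply, midpoint_eq_smul_add]; simp; module
  have hac : midpoint ℝ a c = triMap a b c !₂[0, 1 / 2] := by
    rw [triMap_apply, midpoint_eq_smul_add]; simp; module
  have haa : triMap a b c 0 = a := by simp [triMap_apply]
  simp only [image_insert_eq, image_singleton, midpoint_self, hab, hac, haa]

theorem volume_real (h : IsTriangle K a b c) :
    volume.real (convexHull ℝ (K : Set Plane)) = |triDet a b c| * refArea := by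
  have := setIntegral_image_triMap h.det isCompact_refTriangle.measurableSet (fun _ => (1 : ℝ))
  rw [← h.convexHull_eq] at this
  simpa [refArea] using this

theorem image_openRef_subset (h : IsTriangle K a b c) :
    triMap a b c '' openRef ⊆ interior (convexHull ℝ (K : Set Plane)) := by
  refine interior_maximal ?_ (isOpenMap_triMap h.det _ isOpen_openRef)
  rw [h.convexHull_eq]
  exact image_mono openRef_subset

theorem barycenter_mem_interior (h : IsTriangle K a b c) :
    barycenter K ∈ interior (convexHull ℝ (K : Set Plane)) := by
  rw [h.barycenter_eq]
  refine h.image_openRef_subset ⟨_, ?_, rfl⟩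
  simp [openRef]; norm_num

/-- Only the starting point of a dual segment, the midpoint of an edge, lies on the boundary of the
triangle. Elsewhere on the segment a piecewise affine function has the elementwise gradient. -/
theorem lineMap_mem_interior (h : IsTriangle K a b c) {t : ℝ} (ht : 0 < t) (ht1 : t ≤ 1) :
    AffineMap.lineMap (midpoint ℝ a b) (barycenter K) t ∈
      interior (convexHull ℝ (K : Set Plane)) := by
  refine h.image_openRef_subset ⟨!₂[(1 - t) / 2 + t / 3, t / 3], ?_, ?_⟩
  · simp [openRef]; refine ⟨by linarith, ht, by linarith⟩
  · rw [h.barycenter_eq, triMap_apply, triMap_apply, midpoint_eq_smul_add,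
      AffineMap.lineMap_apply_module]
    simp
    module

theorem dualCell_subset (h : IsTriangle K a b c) :
    dualCell K a ⊆ convexHull ℝ (K : Set Plane) := by
  refine convexHull_min ?_ (convex_convexHull ℝ _)
  rintro x (rfl | ⟨y, hy, rfl⟩)
  · exact interior_subset h.barycenter_mem_interior
  · refine (convex_convexHull ℝ (K : Set Plane)).midpoint_mem (subset_convexHull ℝ _ ?_)
      (subset_convexHull ℝ _ hy)
    rw [h.coe_eq]; simp

theorem measurableSet_dualCell (h : IsTriangle K a b c) : MeasurableSet (dualCell K a) := by
  rw [h.dualCell_eq]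
  exact (isCompact_refCell.image (continuous_triMap a b c)).measurableSet

theorem affine_triMap (g : Plane →ᵃ[ℝ] ℝ) (x : Plane) :
    g (triMap a b c x) = (1 - x 0 - x 1) * g a + x 0 * g b + x 1 * g c := by
  have : triMap a b c x = (x 0 • (b - a) + x 1 • (c - a)) +ᵥ a := by
    rw [triMap_apply, vadd_eq_add]
  rw [this, AffineMap.map_vadd, map_add, map_smul, map_smul, ← vsub_eq_sub b a, ← vsub_eq_sub c a,
    AffineMap.linearMap_vsub, AffineMap.linearMap_vsub]
  simp; ring

/-- The integral of an affine function over a dual cell. -/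
theorem setIntegral_dualCell (h : IsTriangle K a b c) {v : Plane → ℝ} {g : Plane →ᵃ[ℝ] ℝ}
    (hv : EqOn v g (convexHull ℝ (K : Set Plane))) :
    ∫ x in dualCell K a, v x =
      |triDet a b c| * (refMass₀ * v a + refMass₁ * v b + refMass₁ * v c) := by
  have hmem : ∀ z ∈ K, v z = g z := fun z hz => hv (subset_convexHull ℝ _ hz)
  rw [setIntegral_congr_fun h.measurableSet_dualCell (hv.mono h.dualCell_subset), h.dualCell_eq,
    setIntegral_image_triMap h.det measurableSet_refCell, hmem a (h.mem_iff.2 (by simp)),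
    hmem b (h.mem_iff.2 (by simp)), hmem c (h.mem_iff.2 (by simp))]
  simp only [affine_triMap]
  rw [integral_add, integral_add, integral_mul_const, integral_mul_const, integral_mul_const,
    refMass₁_eq, ← refMass₀, ← refMass₁]
  all_goals exact integrableOn_refCell (by fun_prop)

/-- A vertex lies in no dual cell of another vertex of the same triangle. -/
theorem notMem_dualCell (h : IsTriangle K a b c) : b ∉ dualCell K a := by
  rw [h.dualCell_eq]
  rintro ⟨x, hx, hxb⟩
  have e : triMap a b c !₂[1, 0] = b := by simp [triMap_apply]
  have := triMap_injective h.det (hxb.trans e.symm)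
  -- Each coordinate is at most `1 / 2` on the reference cell, whereas `b` has first coordinate one.
  have h2 := refCell_affine_nonneg 1 (-2) 0 (by norm_num) (by norm_num) (by norm_num)
    (by norm_num) x hx
  rw [this] at h2
  norm_num at h2

end IsTriangle

theorem triDet_ne_zero {a b c : Plane} (h : AffineIndependent ℝ ![a, b, c]) :
    triDet a b c ≠ 0 := by
  intro hD
  rw [affineIndependent_iff_linearIndependent_vsub ℝ _ (0 : Fin 3)] at h
  have h2 : LinearIndependent ℝ ![b - a, c - a] := by
    have := h.comp (fun i : Fin 2 => (⟨i.succ, Fin.succ_ne_zero i⟩ : {x : Fin 3 // x ≠ 0}))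
      (by intro i j hij; simpa using hij)
    have e : ![b - a, c - a] = (fun i : {x : Fin 3 // x ≠ 0} => ![a, b, c] i -ᵥ ![a, b, c] 0) ∘
        (fun i : Fin 2 => (⟨i.succ, Fin.succ_ne_zero i⟩ : {x : Fin 3 // x ≠ 0})) := by
      funext i; fin_cases i <;> simp
    rw [e]
    exact this
  rw [LinearIndependent.pair_iff] at h2
  set u := b - a
  set v := c - a
  have hD' : u 0 * v 1 - u 1 * v 0 = 0 := hD
  -- When the determinant vanishes, `v 1 • u - u 1 • v` and `v 0 • u - u 0 • v` are both zero, so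
  -- independence forces all coordinates of `u` and `v` to vanish.
  obtain ⟨hv1, hu1⟩ := h2 (v 1) (-u 1) (by
    ext i; fin_cases i <;> simp <;> linarith)
  obtain ⟨hv0, hu0⟩ := h2 (v 0) (-u 0) (by
    ext i; fin_cases i <;> simp <;> linarith)
  have := (h2 1 0 (by
    ext i; fin_cases i
    · simpa using hu0
    · simpa using hu1)).1
  exact one_ne_zero this

/-- The vertices of a triangle can be enumerated starting with any two distinct ones. -/
theorem exists_isTriangle {K : Finset Plane} (h3 : K.card = 3)
    (hK : AffineIndependent ℝ ((↑) : K → Plane)) {a b : Plane} (ha : a ∈ K) (hb : b ∈ K)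
    (hab : a ≠ b) : ∃ c, IsTriangle K a b c := by
  classical
  have h1 : ((K.erase a).erase b).card = 1 := by
    rw [Finset.card_erase_of_mem (by simp [hab.symm, hb]), Finset.card_erase_of_mem ha, h3]
  obtain ⟨c, hc⟩ := Finset.card_eq_one.1 h1
  have hcm : c ∈ (K.erase a).erase b := by simp [hc]
  simp only [Finset.mem_erase] at hcm
  have hKe : K = {a, b, c} := by
    rw [← Finset.insert_erase ha, ← Finset.insert_erase (a := b) (s := K.erase a)
      (by simp [hab.symm, hb]), hc]
  refine ⟨c, hab, hcm.2.1.symm, hcm.1.symm, hKe, triDet_ne_zero ?_⟩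
  have := hK.comp_embedding (⟨![⟨a, ha⟩, ⟨b, hb⟩, ⟨c, hcm.2.2⟩], by
    intro i j hij
    have hij' := congrArg Subtype.val hij
    have hac := hcm.2.1.symm
    have hbc := hcm.1.symm
    fin_cases i <;> fin_cases j <;>
      simp [hab, hac, hbc, hab.symm, hac.symm, hbc.symm] at hij' ⊢⟩ : Fin 3 ↪ K)
  convert this using 1
  funext i; fin_cases i <;> rfl

theorem exists_isTriangle_of_mem {K : Finset Plane} (h3 : K.card = 3)
    (hK : AffineIndependent ℝ ((↑) : K → Plane)) {a : Plane} (ha : a ∈ K) :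
    ∃ b c, IsTriangle K a b c := by
  obtain ⟨b, hb, hba⟩ := Finset.exists_mem_ne (by omega : 1 < K.card) a
  obtain ⟨c, h⟩ := exists_isTriangle h3 hK ha hb hba.symm
  exact ⟨b, c, h⟩


/-! ### Decomposition of integrals over the mesh -/

theorem setIntegral_biUnion_finset_ae {ι : Type*} (t : Finset ι) {s : ι → Set Plane}
    {F : Plane → ℝ} (hm : ∀ i ∈ t, MeasurableSet (s i))
    (hd : ∀ i ∈ t, ∀ j ∈ t, i ≠ j → volume (s i ∩ s j) = 0)
    (hF : IntegrableOn F (⋃ i ∈ t, s i)) :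
    ∫ x in ⋃ i ∈ t, s i, F x = ∑ i ∈ t, ∫ x in s i, F x := by
  have e : (⋃ i ∈ t, s i) = ⋃ i : t, s i := by
    ext x; simp
  rw [e] at hF ⊢
  rw [integral_iUnion_ae (fun i : t => (hm i i.2).nullMeasurableSet) ?_ hF, tsum_fintype,
    Finset.sum_coe_sort t (fun i => ∫ x in s i, F x)]
  intro i j hij
  exact hd i i.2 j j.2 (fun h => hij (Subtype.ext h))

namespace IsConvexPolygonalDomain

variable {Ω : Set Plane}

theorem isOpen (h : IsConvexPolygonalDomain Ω) : IsOpen Ω := by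
  obtain ⟨-, S, rfl⟩ := h; exact isOpen_interior

theorem convex (h : IsConvexPolygonalDomain Ω) : Convex ℝ Ω := by
  obtain ⟨-, S, rfl⟩ := h; exact (convex_convexHull ℝ _).interior

theorem isCompact_closure (h : IsConvexPolygonalDomain Ω) : IsCompact (closure Ω) := by
  obtain ⟨-, S, rfl⟩ := h
  have hS : IsCompact (convexHull ℝ (S : Set Plane)) := S.finite_toSet.isCompact_convexHull ℝ
  exact hS.of_isClosed_subset isClosed_closure (closure_minimal interior_subset hS.isClosed)

theorem ae_eq_closure (h : IsConvexPolygonalDomain Ω) : Ω =ᵐ[volume] closure Ω := by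
  refine (LE.le.eventuallyLE subset_closure).antisymm ?_
  rw [ae_le_set]
  refine measure_mono_null ?_ (h.convex.addHaar_frontier volume)
  rw [h.isOpen.frontier_eq]

end IsConvexPolygonalDomain

namespace TriMesh

variable {Ω : Set Plane} {𝒯 : TriMesh Ω} {K L : Finset Plane} {z : Plane} {F v w : Plane → ℝ}

theorem exists_isTriangle (hK : K ∈ 𝒯.triangles) : ∃ a b c, IsTriangle K a b c := by
  obtain ⟨a, ha⟩ := Finset.card_pos.1 (by rw [𝒯.card_eq_three K hK]; norm_num : 0 < K.card)
  obtain ⟨b, c, h⟩ := exists_isTriangle_of_mem (𝒯.card_eq_three K hK) (𝒯.affineIndependent K hK) ha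
  exact ⟨a, b, c, h⟩

theorem exists_isTriangle_of_mem (hK : K ∈ 𝒯.triangles) (hz : z ∈ K) :
    ∃ b c, IsTriangle K z b c :=
  FVE.exists_isTriangle_of_mem (𝒯.card_eq_three K hK) (𝒯.affineIndependent K hK) hz

theorem isCompact_convexHull (K : Finset Plane) : IsCompact (convexHull ℝ (K : Set Plane)) :=
  K.finite_toSet.isCompact_convexHull ℝ

theorem convexHull_subset (hK : K ∈ 𝒯.triangles) :
    convexHull ℝ (K : Set Plane) ⊆ closure Ω := by
  rw [← 𝒯.cover]
  exact subset_biUnion_of_mem (u := fun K : Finset Plane => convexHull ℝ (K : Set Plane)) hK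

theorem mem_closure (hK : K ∈ 𝒯.triangles) (hz : z ∈ K) : z ∈ closure Ω :=
  convexHull_subset hK (subset_convexHull ℝ _ hz)

/-- Two different triangles share at most two vertices. By conformity their intersection lies in the
affine span of these, which is a proper subspace and hence null. -/
theorem volume_inter (hK : K ∈ 𝒯.triangles) (hL : L ∈ 𝒯.triangles) (h : K ≠ L) :
    volume (convexHull ℝ (K : Set Plane) ∩ convexHull ℝ (L : Set Plane)) = 0 := by
  classical
  have hc : (K ∩ L).card < 3 := by
    rw [← 𝒯.card_eq_three K hK]
    refine Finset.card_lt_card (Finset.ssubset_iff_subset_ne.2 ⟨Finset.inter_subset_left, ?_⟩)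
    intro e
    refine h (Finset.eq_of_subset_of_card_le (Finset.inter_eq_left.1 e) ?_)
    rw [𝒯.card_eq_three K hK, 𝒯.card_eq_three L hL]
  refine measure_mono_null ((𝒯.conforming K hK L hL).trans
    (convexHull_subset_affineSpan _)) (Measure.addHaar_affineSubspace volume _ ?_)
  intro htop
  rw [← Finset.coe_inter] at htop
  have hv : vectorSpan ℝ ((K ∩ L : Finset Plane) : Set Plane) = ⊤ := by
    rw [← direction_affineSpan, htop, AffineSubspace.direction_top]
  have hne : (K ∩ L).card ≠ 0 := by
    intro h0
    rw [Finset.card_eq_zero.1 h0] at htop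
    simp at htop
  have h1 := finrank_vectorSpan_image_finset_le ℝ (id : Plane → Plane) (K ∩ L)
    (n := (K ∩ L).card - 1) (by omega)
  rw [Finset.image_id, hv, finrank_top, finrank_euclideanSpace_fin] at h1
  omega

theorem setIntegral_eq_sum (hΩ : IsConvexPolygonalDomain Ω) (𝒯 : TriMesh Ω)
    (hF : IntegrableOn F Ω) :
    ∫ x in Ω, F x = ∑ K ∈ 𝒯.triangles, ∫ x in convexHull ℝ (K : Set Plane), F x := by
  rw [setIntegral_congr_set hΩ.ae_eq_closure, ← 𝒯.cover]
  refine setIntegral_biUnion_finset_ae _ (fun K _ => (isCompact_convexHull K).measurableSet)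
    (fun K hK L hL h => volume_inter hK hL h) ?_
  rw [𝒯.cover]
  exact hF.congr_set_ae hΩ.ae_eq_closure.symm

theorem dualCell_subset (hK : K ∈ 𝒯.triangles) (hz : z ∈ K) :
    dualCell K z ⊆ convexHull ℝ (K : Set Plane) := by
  obtain ⟨b, c, h⟩ := exists_isTriangle_of_mem hK hz
  exact h.dualCell_subset

theorem measurableSet_dualCell (hK : K ∈ 𝒯.triangles) (hz : z ∈ K) :
    MeasurableSet (dualCell K z) := by
  obtain ⟨b, c, h⟩ := exists_isTriangle_of_mem hK hz
  exact h.measurableSet_dualCell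

open Classical in
theorem controlVolume_eq (𝒯 : TriMesh Ω) (z : Plane) :
    𝒯.controlVolume z = ⋃ K ∈ 𝒯.triangles.filter (fun K => z ∈ K), dualCell K z := by
  ext x; simp [controlVolume]; tauto

theorem controlVolume_subset : 𝒯.controlVolume z ⊆ closure Ω := by
  refine iUnion₂_subset fun K hK => iUnion_subset fun hz => ?_
  exact (dualCell_subset hK hz).trans (convexHull_subset hK)

theorem measurableSet_controlVolume : MeasurableSet (𝒯.controlVolume z) := by
  classical
  rw [controlVolume_eq]
  refine Finset.measurableSet_biUnion _ fun K hK => ?_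
  rw [Finset.mem_filter] at hK
  exact measurableSet_dualCell hK.1 hK.2

open Classical in
theorem setIntegral_controlVolume (hF : IntegrableOn F (closure Ω)) :
    ∫ x in 𝒯.controlVolume z, F x =
      ∑ K ∈ 𝒯.triangles.filter (fun K => z ∈ K), ∫ x in dualCell K z, F x := by
  have hF' : IntegrableOn F (𝒯.controlVolume z) := hF.mono_set controlVolume_subset
  rw [controlVolume_eq] at hF' ⊢
  refine setIntegral_biUnion_finset_ae _ ?_ ?_ hF'
  · intro K hK
    rw [Finset.mem_filter] at hK
    exact measurableSet_dualCell hK.1 hK.2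
  · intro K hK L hL h
    rw [Finset.mem_filter] at hK hL
    exact measure_mono_null (inter_subset_inter (dualCell_subset hK.1 hK.2)
      (dualCell_subset hL.1 hL.2)) (volume_inter hK.1 hL.1 h)

theorem eq_zero_of_mem_trialSpace (hΩ : IsConvexPolygonalDomain Ω) (hw : w ∈ 𝒯.trialSpace)
    (hK : K ∈ 𝒯.triangles) (hz : z ∈ K) (hi : z ∉ 𝒯.interiorVertices) : w z = 0 := by
  apply hw.2.1
  rw [hΩ.isOpen.frontier_eq]
  refine ⟨mem_closure hK hz, fun h => hi ?_⟩
  simp only [interiorVertices, Finset.mem_filter, Finset.mem_biUnion, id]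
  exact ⟨⟨K, hK, hz⟩, h⟩

open Classical in
/-- A sum over the interior vertices and their triangles is a sum over all triangles and their
vertices. -/
theorem sum_interiorVertices (hΩ : IsConvexPolygonalDomain Ω) (hw : w ∈ 𝒯.trialSpace)
    (G : Finset Plane → Plane → ℝ) :
    ∑ z ∈ 𝒯.interiorVertices, w z * ∑ K ∈ 𝒯.triangles.filter (fun K => z ∈ K), G K z =
      ∑ K ∈ 𝒯.triangles, ∑ z ∈ K, w z * G K z := by
  simp only [Finset.mul_sum]
  rw [Finset.sum_comm' (t' := 𝒯.triangles)
    (s' := fun K => 𝒯.interiorVertices.filter (fun z => z ∈ K))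
    (by intro z K; simp; tauto)]
  refine Finset.sum_congr rfl fun K hK => ?_
  refine Finset.sum_subset (fun z hz => (Finset.mem_filter.1 hz).2) fun z hz hn => ?_
  rw [eq_zero_of_mem_trialSpace hΩ hw hK hz, zero_mul]
  intro hi
  exact hn (Finset.mem_filter.2 ⟨hi, hz⟩)

/-- Reduces products with `I*w` to integrals over single dual cells. The pieces of a control volume
in different triangles overlap in null sets, and boundary vertices may be added because `w` vanishes
there. -/
theorem integral_mul_interpStar (hΩ : IsConvexPolygonalDomain Ω) (hw : w ∈ 𝒯.trialSpace)
    (hF : IntegrableOn F Ω) :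
    l2Inner Ω F (𝒯.interpStar w) =
      ∑ K ∈ 𝒯.triangles, ∑ z ∈ K, w z * ∫ x in dualCell K z, F x := by
  classical
  have hF' : IntegrableOn F (closure Ω) := hF.congr_set_ae hΩ.ae_eq_closure.symm
  rw [l2Inner, setIntegral_congr_set hΩ.ae_eq_closure,
    ← sum_interiorVertices hΩ hw (fun K z => ∫ x in dualCell K z, F x)]
  have e : ∀ x, F x * 𝒯.interpStar w x =
      ∑ z ∈ 𝒯.interiorVertices, w z * (𝒯.controlVolume z).indicator F x := by
    intro x
    rw [interpStar, Finset.mul_sum]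
    refine Finset.sum_congr rfl fun z _ => ?_
    by_cases hx : x ∈ 𝒯.controlVolume z
    · simp [hx]; ring
    · simp [hx]
  simp only [e]
  rw [integral_finsetSum _ fun z _ => ?_]
  · refine Finset.sum_congr rfl fun z _ => ?_
    rw [integral_const_mul, setIntegral_indicator measurableSet_controlVolume,
      inter_eq_self_of_subset_right controlVolume_subset, setIntegral_controlVolume hF']
  · exact (hF'.integrable.indicator measurableSet_controlVolume).const_mul _

/-- If `z` is a vertex of `K`, barycentric coordinates exclude it. Otherwise conformity would put
`z` into the convex hull of the other vertices of a triangle `L` at `z`, against affine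
independence. -/
theorem notMem_dualCell {y : Plane} (hz : z ∈ 𝒯.interiorVertices) (hK : K ∈ 𝒯.triangles)
    (hy : y ∈ K) (hzy : z ≠ y) : z ∉ dualCell K y := by
  classical
  intro hmem
  by_cases hzK : z ∈ K
  · obtain ⟨c, h⟩ := FVE.exists_isTriangle (𝒯.card_eq_three K hK) (𝒯.affineIndependent K hK)
      hy hzK hzy.symm
    exact h.notMem_dualCell hmem
  · simp only [interiorVertices, Finset.mem_filter, Finset.mem_biUnion, id] at hz
    obtain ⟨⟨L, hL, hzL⟩, -⟩ := hz
    have h1 := 𝒯.conforming K hK L hL ⟨dualCell_subset hK hy hmem, subset_convexHull ℝ _ hzL⟩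
    have h2 : z ∈ affineSpan ℝ (((↑) : L → Plane) '' (univ \ {⟨z, hzL⟩})) := by
      refine convexHull_subset_affineSpan _ (convexHull_mono ?_ h1)
      rintro x ⟨hxK, hxL⟩
      refine ⟨⟨x, hxL⟩, ⟨mem_univ _, fun h => hzK ?_⟩, rfl⟩
      have : x = z := congrArg Subtype.val h
      exact this ▸ hxK
    exact (𝒯.affineIndependent L hL).notMem_affineSpan_sdiff ⟨z, hzL⟩ univ h2

/-- `form` reads its second argument at the vertices, so pointwise values of `I*w` matter even
though control volumes overlap along their boundaries. A vertex lies in no control volume but its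
own. -/
theorem interpStar_vertex (hz : z ∈ 𝒯.interiorVertices) (w : Plane → ℝ) :
    𝒯.interpStar w z = w z := by
  have hz' := hz
  simp only [interiorVertices, Finset.mem_filter, Finset.mem_biUnion, id] at hz'
  obtain ⟨⟨K, hK, hzK⟩, -⟩ := hz'
  rw [interpStar, Finset.sum_eq_single z]
  · have : z ∈ 𝒯.controlVolume z := by
      refine mem_iUnion₂.2 ⟨K, hK, mem_iUnion.2 ⟨hzK, subset_convexHull ℝ _ (mem_insert_of_mem _ ?_)⟩⟩
      exact ⟨z, hzK, midpoint_self ℝ z⟩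
    simp [this]
  · intro y _ hyz
    have : z ∉ 𝒯.controlVolume y := by
      intro h
      simp only [controlVolume, mem_iUnion] at h
      obtain ⟨L, hL, hyL, h⟩ := h
      exact notMem_dualCell hz hL hyL hyz.symm h
    simp [this]
  · exact fun h => absurd hz h

open Classical in
/-- The elementwise representation of the finite volume form. -/
theorem form_eq (hΩ : IsConvexPolygonalDomain Ω) (hw : w ∈ 𝒯.trialSpace)
    (A : Plane → Matrix (Fin 2) (Fin 2) ℝ) (v : Plane → ℝ) :
    𝒯.form A v (𝒯.interpStar w) = -∑ K ∈ 𝒯.triangles, ∑ z ∈ K, w z *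
      ∑ y ∈ K.erase z, segmentFlux A v z (midpoint ℝ z y) (barycenter K) := by
  rw [form, ← sum_interiorVertices hΩ hw]
  congr 1
  refine Finset.sum_congr rfl fun z hz => ?_
  rw [interpStar_vertex hz]
  rfl

end TriMesh


/-! ### Elementwise gradients -/

/-- `v` is affine on the triangle `K`. -/
def ElemAffine (K : Finset Plane) (v : Plane → ℝ) : Prop :=
  ∃ g : Plane →ᵃ[ℝ] ℝ, EqOn v g (convexHull ℝ (K : Set Plane))

/-- The constant gradient on the triangle `K` of a function that is affine there. -/
def elemGrad (K : Finset Plane) (v : Plane → ℝ) : Plane := gradient v (barycenter K)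

theorem hasGradientAt_affine (g : Plane →ᵃ[ℝ] ℝ) : ∃ G : Plane, (∀ x, HasGradientAt g G x) ∧
    ∀ x y, g x - g y = inner ℝ G (x - y) := by
  set l : Plane →L[ℝ] ℝ := g.linear.toContinuousLinearMap
  refine ⟨(InnerProductSpace.toDual ℝ Plane).symm l, fun x => ?_, fun x y => ?_⟩
  · rw [hasGradientAt_iff_hasFDerivAt, LinearIsometryEquiv.apply_symm_apply]
    have e : (g : Plane → ℝ) = fun x => l x + g 0 := by
      funext y; simpa [l] using congrFun g.decomp y
    rw [e]
    exact l.hasFDerivAt.add_const _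
  · rw [InnerProductSpace.toDual_symm_apply, ← vsub_eq_sub (g x), ← AffineMap.linearMap_vsub]
    rfl

namespace ElemAffine

variable {K : Finset Plane} {v w : Plane → ℝ} {a b c : Plane}

theorem hasGradientAt (hv : ElemAffine K v) (h : IsTriangle K a b c) {x : Plane}
    (hx : x ∈ interior (convexHull ℝ (K : Set Plane))) : HasGradientAt v (elemGrad K v) x := by
  obtain ⟨g, hg⟩ := hv
  obtain ⟨G, hG, -⟩ := hasGradientAt_affine g
  have key : ∀ y ∈ interior (convexHull ℝ (K : Set Plane)), HasGradientAt v G y := fun y hy =>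
    (hG y).congr_of_eventuallyEq (by
      filter_upwards [isOpen_interior.mem_nhds hy] with u hu using hg (interior_subset hu))
  have e : elemGrad K v = G := (key _ h.barycenter_mem_interior).gradient
  rw [e]; exact key x hx

theorem gradient_eq (hv : ElemAffine K v) (h : IsTriangle K a b c) {x : Plane}
    (hx : x ∈ interior (convexHull ℝ (K : Set Plane))) : gradient v x = elemGrad K v :=
  (hv.hasGradientAt h hx).gradient

theorem sub_eq (hv : ElemAffine K v) (h : IsTriangle K a b c) {x y : Plane}
    (hx : x ∈ convexHull ℝ (K : Set Plane)) (hy : y ∈ convexHull ℝ (K : Set Plane)) :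
    v x - v y = inner ℝ (elemGrad K v) (x - y) := by
  have h1 := hv.hasGradientAt h h.barycenter_mem_interior
  obtain ⟨g, hg⟩ := hv
  obtain ⟨G, hG, hG'⟩ := hasGradientAt_affine g
  have e : elemGrad K v = G := h1.unique ((hG _).congr_of_eventuallyEq (by
      filter_upwards [isOpen_interior.mem_nhds h.barycenter_mem_interior] with u hu
        using hg (interior_subset hu)))
  rw [e, hg hx, hg hy, hG']

theorem add (hv : ElemAffine K v) (hw : ElemAffine K w) : ElemAffine K (v + w) := by
  obtain ⟨g, hg⟩ := hv
  obtain ⟨k, hk⟩ := hw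
  exact ⟨g + k, fun x hx => by simp [hg hx, hk hx]⟩

theorem smul (hv : ElemAffine K v) (r : ℝ) : ElemAffine K (r • v) := by
  obtain ⟨g, hg⟩ := hv
  exact ⟨r • g, fun x hx => by simp [hg hx]⟩

theorem elemGrad_add (hv : ElemAffine K v) (hw : ElemAffine K w) (h : IsTriangle K a b c) :
    elemGrad K (v + w) = elemGrad K v + elemGrad K w := by
  have h1 := (hv.hasGradientAt h h.barycenter_mem_interior).hasFDerivAt
  have h2 := (hw.hasGradientAt h h.barycenter_mem_interior).hasFDerivAt
  have : HasGradientAt (v + w) (elemGrad K v + elemGrad K w) (barycenter K) := by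
    rw [hasGradientAt_iff_hasFDerivAt, map_add]
    exact h1.add h2
  exact this.gradient

theorem elemGrad_smul (hv : ElemAffine K v) (h : IsTriangle K a b c) (r : ℝ) :
    elemGrad K (r • v) = r • elemGrad K v := by
  have h1 := (hv.hasGradientAt h h.barycenter_mem_interior).hasFDerivAt
  have : HasGradientAt (r • v) (r • elemGrad K v) (barycenter K) := by
    rw [hasGradientAt_iff_hasFDerivAt]
    have e : InnerProductSpace.toDual ℝ Plane (r • elemGrad K v) =
        r • InnerProductSpace.toDual ℝ Plane (elemGrad K v) := by
      ext y; simp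
    rw [e]
    exact h1.const_smul r
  exact this.gradient

end ElemAffine

/-! ### Fluxes through the segments of the dual mesh -/

/-- The outward normal of the dual cell of `a`, on the segment from the midpoint of `a`, `b` to the
barycenter of the triangle. -/
def edgeNormal (a b c : Plane) : Plane :=
  (Real.sign (triDet a b c) / 6) • (!₂[2 * c 1 - a 1 - b 1, a 0 + b 0 - 2 * c 0] : Plane)

/-- The segment separates the dual cells of `a` and `b`, so the outward normal of one is the inward
normal of the other. -/
theorem edgeNormal_swap (a b c : Plane) : edgeNormal b a c = -edgeNormal a b c := by
  have e : triDet b a c = -triDet a b c := by simp [triDet, planeDet]; ring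
  have s : Real.sign (-triDet a b c) = -Real.sign (triDet a b c) := Real.sign_neg
  rw [edgeNormal, edgeNormal, e, s]
  ext i; fin_cases i <;> simp <;> ring

theorem sign_div_six (x : ℝ) : Real.sign (x / 6) = Real.sign x := by
  rcases lt_trichotomy x 0 with h | rfl | h
  · rw [Real.sign_of_neg h, Real.sign_of_neg (by linarith)]
  · simp
  · rw [Real.sign_of_pos h, Real.sign_of_pos (by linarith)]

theorem barycenter_apply {K : Finset Plane} {a b c : Plane} (h : IsTriangle K a b c) (i : Fin 2) :
    barycenter K i = (a i + b i + c i) / 3 := by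
  rw [barycenter, h.sum_eq]; simp; ring

theorem midpoint_apply_coord (a b : Plane) (i : Fin 2) : midpoint ℝ a b i = (a i + b i) / 2 := by
  rw [midpoint_eq_smul_add]; simp; ring

/-- The inner product that decides the direction of the normal is one sixth of `triDet a b c`, so
the sign is the orientation of the triangle. -/
theorem outwardNormal_eq {K : Finset Plane} {a b c : Plane} (h : IsTriangle K a b c) :
    outwardNormal a (midpoint ℝ a b) (barycenter K) = edgeNormal a b c := by
  rw [outwardNormal, edgeNormal]
  have e : inner ℝ (!₂[barycenter K 1 - midpoint ℝ a b 1, midpoint ℝ a b 0 - barycenter K 0] : Plane)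
      (midpoint ℝ a b - a) = triDet a b c / 12 * 2 := by
    rw [PiLp.inner_apply]
    simp only [Fin.sum_univ_two, barycenter_apply h, midpoint_apply_coord, PiLp.sub_apply]
    simp [triDet, planeDet]
    ring
  have e2 : triDet a b c / 12 * 2 = triDet a b c / 6 := by ring
  rw [e, e2, sign_div_six]
  ext i
  fin_cases i <;> simp [barycenter_apply h, midpoint_apply_coord] <;> ring

theorem norm_rot (x y : ℝ) : ‖(!₂[x, y] : Plane)‖ = ‖(!₂[-y, x] : Plane)‖ := by
  simp [EuclideanSpace.norm_eq, Fin.sum_univ_two, add_comm]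

/-- The normal is the segment from the midpoint to the barycenter, rotated by a right angle, up to
sign. -/
theorem norm_edgeNormal_le {K : Finset Plane} {a b c : Plane} (h : IsTriangle K a b c) :
    ‖edgeNormal a b c‖ ≤ Metric.diam (convexHull ℝ (K : Set Plane)) := by
  have hb : Bornology.IsBounded (convexHull ℝ (K : Set Plane)) :=
    (TriMesh.isCompact_convexHull K).isBounded
  have h1 : dist (barycenter K) (midpoint ℝ a b) ≤ Metric.diam (convexHull ℝ (K : Set Plane)) := by
    refine Metric.dist_le_diam_of_mem hb (interior_subset h.barycenter_mem_interior) ?_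
    exact (convex_convexHull ℝ (K : Set Plane)).midpoint_mem
      (subset_convexHull ℝ _ (h.mem_iff.2 (by simp))) (subset_convexHull ℝ _ (h.mem_iff.2 (by simp)))
  refine le_trans (le_of_eq ?_) h1
  rw [edgeNormal, norm_smul, dist_eq_norm]
  have e : (!₂[2 * c 1 - a 1 - b 1, a 0 + b 0 - 2 * c 0] : Plane) =
      (6 : ℝ) • !₂[(barycenter K - midpoint ℝ a b) 1, -(barycenter K - midpoint ℝ a b) 0] := by
    ext i
    fin_cases i <;> simp [barycenter_apply h, midpoint_apply_coord] <;> ring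
  have s : |Real.sign (triDet a b c)| = 1 := by
    rcases lt_or_gt_of_ne h.det with h | h
    · simp [Real.sign_of_neg h]
    · simp [Real.sign_of_pos h]
  rw [e, norm_smul, norm_rot]
  have e2 : (!₂[-(-(barycenter K - midpoint ℝ a b) 0), (barycenter K - midpoint ℝ a b) 1] : Plane) =
      barycenter K - midpoint ℝ a b := by
    ext i; fin_cases i <;> simp
  rw [e2, Real.norm_eq_abs, Real.norm_eq_abs, abs_div, s]
  norm_num
  ring

/-- The flux of the constant field `G` through the segment from `p` to `r` with normal `n`. -/
def constFlux (A : Plane → Matrix (Fin 2) (Fin 2) ℝ) (n p r G : Plane) : ℝ :=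
  ∫ t in (0 : ℝ)..1, n.ofLp ⬝ᵥ (A (AffineMap.lineMap p r t) *ᵥ G.ofLp)

theorem segmentFlux_eq {K : Finset Plane} {a b c : Plane} (h : IsTriangle K a b c)
    {v : Plane → ℝ} (hv : ElemAffine K v) (A : Plane → Matrix (Fin 2) (Fin 2) ℝ) :
    segmentFlux A v a (midpoint ℝ a b) (barycenter K) =
      constFlux A (edgeNormal a b c) (midpoint ℝ a b) (barycenter K) (elemGrad K v) := by
  rw [segmentFlux, constFlux, outwardNormal_eq h]
  refine intervalIntegral.integral_congr_ae (Filter.Eventually.of_forall fun t ht => ?_)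
  -- The half-open interval omits `t = 0`, the point on the edge of the triangle, where the gradient
  -- may fail to exist.
  rw [uIoc_of_le zero_le_one] at ht
  rw [hv.gradient_eq h (h.lineMap_mem_interior ht.1 ht.2)]

theorem segmentFlux_swap {K : Finset Plane} {a b c : Plane} (h : IsTriangle K a b c)
    {v : Plane → ℝ} (hv : ElemAffine K v) (A : Plane → Matrix (Fin 2) (Fin 2) ℝ) :
    segmentFlux A v b (midpoint ℝ b a) (barycenter K) =
      -segmentFlux A v a (midpoint ℝ a b) (barycenter K) := by
  rw [segmentFlux_eq h hv, segmentFlux_eq h.rotate.swap hv, edgeNormal_swap, midpoint_comm,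
    constFlux, constFlux, ← intervalIntegral.integral_neg]
  simp

theorem abs_dotProduct_mulVec_le {M : Matrix (Fin 2) (Fin 2) ℝ} {m : ℝ} (hM : ∀ i j, |M i j| ≤ m)
    (n g : Plane) : |n.ofLp ⬝ᵥ (M *ᵥ g.ofLp)| ≤ 4 * m * ‖n‖ * ‖g‖ := by
  have hn : ∀ i, |n i| ≤ ‖n‖ := fun i => PiLp.norm_apply_le n i
  have hg : ∀ i, |g i| ≤ ‖g‖ := fun i => PiLp.norm_apply_le g i
  have key : ∀ i j, |n i * (M i j * g j)| ≤ m * ‖n‖ * ‖g‖ := by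
    intro i j
    rw [abs_mul, abs_mul]
    have : |M i j| * |g j| ≤ m * ‖g‖ :=
      mul_le_mul (hM i j) (hg j) (abs_nonneg _) ((abs_nonneg _).trans (hM i j))
    calc _ ≤ ‖n‖ * (m * ‖g‖) := mul_le_mul (hn i) this (by positivity) (norm_nonneg _)
      _ = _ := by ring
  have e : n.ofLp ⬝ᵥ (M *ᵥ g.ofLp) = n 0 * (M 0 0 * g 0) + n 0 * (M 0 1 * g 1) +
      n 1 * (M 1 0 * g 0) + n 1 * (M 1 1 * g 1) := by
    simp [dotProduct, Matrix.mulVec, Fin.sum_univ_two]; ring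
  rw [e]
  have h1 := abs_le.1 (key 0 0)
  have h2 := abs_le.1 (key 0 1)
  have h3 := abs_le.1 (key 1 0)
  have h4 := abs_le.1 (key 1 1)
  rw [abs_le]; constructor <;> linarith [h1.1, h1.2, h2.1, h2.2, h3.1, h3.2, h4.1, h4.2]

open Classical in
/-- The contribution of the triangle `K` to the finite volume form. -/
def elemForm (A : Plane → Matrix (Fin 2) (Fin 2) ℝ) (K : Finset Plane) (v w : Plane → ℝ) : ℝ :=
  -∑ z ∈ K, w z * ∑ y ∈ K.erase z, segmentFlux A v z (midpoint ℝ z y) (barycenter K)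

/-- Summation by parts: each of the three dual segments occurs twice, with opposite fluxes, so only
differences of vertex values of `w` remain. -/
theorem elemForm_eq {K : Finset Plane} {a b c : Plane} (h : IsTriangle K a b c)
    {v : Plane → ℝ} (hv : ElemAffine K v) (A : Plane → Matrix (Fin 2) (Fin 2) ℝ)
    (w : Plane → ℝ) :
    elemForm A K v w =
      -((w a - w b) *
          constFlux A (edgeNormal a b c) (midpoint ℝ a b) (barycenter K) (elemGrad K v) +
        (w b - w c) *
          constFlux A (edgeNormal b c a) (midpoint ℝ b c) (barycenter K) (elemGrad K v) +
        (w c - w a) *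
          constFlux A (edgeNormal c a b) (midpoint ℝ c a) (barycenter K) (elemGrad K v)) := by
  rw [elemForm, h.sum_eq, h.erase_sum_eq, h.rotate.erase_sum_eq, h.rotate.rotate.erase_sum_eq,
    segmentFlux_swap h hv, segmentFlux_swap h.rotate hv, segmentFlux_swap h.rotate.rotate hv,
    segmentFlux_eq h hv, segmentFlux_eq h.rotate hv, segmentFlux_eq h.rotate.rotate hv]
  ring

/-- For a constant flux field the finite volume form is the finite element form. -/
theorem edgeNormal_identity (a b c g X : Plane) :
    -(inner ℝ g (a - b) * ((edgeNormal a b c).ofLp ⬝ᵥ X.ofLp) +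
        inner ℝ g (b - c) * ((edgeNormal b c a).ofLp ⬝ᵥ X.ofLp) +
        inner ℝ g (c - a) * ((edgeNormal c a b).ofLp ⬝ᵥ X.ofLp)) =
      |triDet a b c| / 2 * (g.ofLp ⬝ᵥ X.ofLp) := by
  have e1 : triDet b c a = triDet a b c := by simp [triDet, planeDet]; ring
  have e2 : triDet c a b = triDet a b c := by simp [triDet, planeDet]; ring
  have s : |triDet a b c| = Real.sign (triDet a b c) * triDet a b c := by
    rcases lt_trichotomy (triDet a b c) 0 with h | h | h
    · rw [Real.sign_of_neg h, abs_of_neg h]; ring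
    · simp [h]
    · rw [Real.sign_of_pos h, abs_of_pos h]; ring
  rw [edgeNormal, edgeNormal, edgeNormal, e1, e2, s]
  set σ := Real.sign (triDet a b c)
  simp only [PiLp.inner_apply, Fin.sum_univ_two, dotProduct, triDet, planeDet, PiLp.sub_apply,
    PiLp.smul_apply, smul_eq_mul, RCLike.inner_apply, conj_trivial]
  simp
  ring

/-- `A` has bounded Lipschitz continuous entries on `S`. -/
structure LipBound (S : Set Plane) (A : Plane → Matrix (Fin 2) (Fin 2) ℝ) (L B : ℝ) : Prop where
  lip : ∀ x ∈ S, ∀ y ∈ S, ∀ i j, |A x i j - A y i j| ≤ L * ‖x - y‖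
  bdd : ∀ x ∈ S, ∀ i j, |A x i j| ≤ B
  nonneg : 0 ≤ L
  bnonneg : 0 ≤ B

theorem LipBound.continuousOn {S : Set Plane} {A : Plane → Matrix (Fin 2) (Fin 2) ℝ} {L B : ℝ}
    (hA : LipBound S A L B) (i j : Fin 2) : ContinuousOn (fun x => A x i j) S := by
  refine (LipschitzOnWith.of_dist_le_mul (K := ⟨L, hA.nonneg⟩) fun x hx y hy => ?_).continuousOn
  rw [Real.dist_eq, dist_eq_norm]
  exact hA.lip x hx y hy i j

section Flux

variable {K : Finset Plane} {a b c : Plane} {A : Plane → Matrix (Fin 2) (Fin 2) ℝ} {L B : ℝ}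

theorem lineMap_mem (h : IsTriangle K a b c) {t : ℝ} (ht : t ∈ Icc (0 : ℝ) 1) :
    AffineMap.lineMap (midpoint ℝ a b) (barycenter K) t ∈ convexHull ℝ (K : Set Plane) := by
  refine (convex_convexHull ℝ (K : Set Plane)).lineMap_mem ?_
    (interior_subset h.barycenter_mem_interior) ht
  exact (convex_convexHull ℝ (K : Set Plane)).midpoint_mem
      (subset_convexHull ℝ _ (h.mem_iff.2 (by simp))) (subset_convexHull ℝ _ (h.mem_iff.2 (by simp)))

theorem intervalIntegrable_flux (h : IsTriangle K a b c)
    (hA : LipBound (convexHull ℝ (K : Set Plane)) A L B) (n G : Plane) :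
    IntervalIntegrable (fun t : ℝ => n.ofLp ⬝ᵥ
      (A (AffineMap.lineMap (midpoint ℝ a b) (barycenter K) t) *ᵥ G.ofLp)) volume 0 1 := by
  refine ContinuousOn.intervalIntegrable ?_
  rw [uIcc_of_le zero_le_one]
  have hc : ∀ i j, ContinuousOn (fun t : ℝ =>
      A (AffineMap.lineMap (midpoint ℝ a b) (barycenter K) t) i j) (Icc 0 1) := fun i j =>
    (hA.continuousOn i j).comp AffineMap.lineMap_continuous.continuousOn
      fun t ht => lineMap_mem h ht
  simp only [dotProduct, Matrix.mulVec, Fin.sum_univ_two]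
  have h1 := hc 0 0
  have h2 := hc 0 1
  have h3 := hc 1 0
  have h4 := hc 1 1
  exact (continuousOn_const.mul ((h1.mul continuousOn_const).add (h2.mul continuousOn_const))).add
    (continuousOn_const.mul ((h3.mul continuousOn_const).add (h4.mul continuousOn_const)))

/-- One factor `δ` is the length of the segment, the other comes from the Lipschitz bound on the
entries of `A`; the factor `4` counts the matrix entries. -/
theorem abs_constFlux_sub_le (h : IsTriangle K a b c)
    (hA : LipBound (convexHull ℝ (K : Set Plane)) A L B) (G : Plane) {δ : ℝ}
    (hδ : Metric.diam (convexHull ℝ (K : Set Plane)) ≤ δ) :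
    |constFlux A (edgeNormal a b c) (midpoint ℝ a b) (barycenter K) G -
      (edgeNormal a b c).ofLp ⬝ᵥ (A (barycenter K) *ᵥ G.ofLp)| ≤ 4 * L * δ ^ 2 * ‖G‖ := by
  have hδ0 : 0 ≤ δ := Metric.diam_nonneg.trans hδ
  have e : constFlux A (edgeNormal a b c) (midpoint ℝ a b) (barycenter K) G -
      (edgeNormal a b c).ofLp ⬝ᵥ (A (barycenter K) *ᵥ G.ofLp) =
      ∫ t in (0 : ℝ)..1, (edgeNormal a b c).ofLp ⬝ᵥ
        ((A (AffineMap.lineMap (midpoint ℝ a b) (barycenter K) t) - A (barycenter K)) *ᵥ G.ofLp) := by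
    simp only [Matrix.sub_mulVec, dotProduct_sub]
    rw [intervalIntegral.integral_sub (intervalIntegrable_flux h hA _ _)
      intervalIntegrable_const]
    simp [constFlux]
  have hB := interior_subset h.barycenter_mem_interior
  rw [e, ← Real.norm_eq_abs]
  have := intervalIntegral.norm_integral_le_of_norm_le_const (a := 0) (b := 1)
    (C := 4 * L * δ ^ 2 * ‖G‖) (f := fun t : ℝ => (edgeNormal a b c).ofLp ⬝ᵥ
        ((A (AffineMap.lineMap (midpoint ℝ a b) (barycenter K) t) - A (barycenter K)) *ᵥ G.ofLp))
    fun t ht => ?_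
  · simpa using this
  rw [uIoc_of_le zero_le_one] at ht
  have hm := lineMap_mem h ⟨ht.1.le, ht.2⟩
  have hL0 := hA.nonneg
  rw [Real.norm_eq_abs]
  refine (abs_dotProduct_mulVec_le (m := L * δ) ?_ _ _).trans ?_
  · intro i j
    refine (hA.lip _ hm _ hB i j).trans (mul_le_mul_of_nonneg_left ?_ hA.nonneg)
    rw [← dist_eq_norm]
    exact (Metric.dist_le_diam_of_mem (TriMesh.isCompact_convexHull K).isBounded hm hB).trans hδ
  · calc 4 * (L * δ) * ‖edgeNormal a b c‖ * ‖G‖ ≤ 4 * (L * δ) * δ * ‖G‖ := by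
          gcongr
          exact (norm_edgeNormal_le h).trans hδ
      _ = _ := by ring

/-- Comparison of the finite volume form and the finite element form on a triangle. -/
theorem abs_elemForm_sub_le (h : IsTriangle K a b c)
    (hA : LipBound (convexHull ℝ (K : Set Plane)) A L B) {v w : Plane → ℝ}
    (hv : ElemAffine K v) (hw : ElemAffine K w) {δ : ℝ}
    (hδ : Metric.diam (convexHull ℝ (K : Set Plane)) ≤ δ) :
    |elemForm A K v w - volume.real (convexHull ℝ (K : Set Plane)) / (2 * refArea) *
      ((elemGrad K w).ofLp ⬝ᵥ (A (barycenter K) *ᵥ (elemGrad K v).ofLp))| ≤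
      12 * L * δ ^ 3 * ‖elemGrad K v‖ * ‖elemGrad K w‖ := by
  -- `X` is the frozen flux field, for which the finite volume sum is exactly the finite element
  -- form.
  set X : Plane := WithLp.toLp 2 (A (barycenter K) *ᵥ (elemGrad K v).ofLp) with hX
  have hid := edgeNormal_identity a b c (elemGrad K w) X
  have hm : ∀ z ∈ K, z ∈ convexHull ℝ (K : Set Plane) := fun z hz => subset_convexHull ℝ _ hz
  have hma := hm a (h.mem_iff.2 (by simp))
  have hmb := hm b (h.mem_iff.2 (by simp))
  have hmc := hm c (h.mem_iff.2 (by simp))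
  rw [← hw.sub_eq h hma hmb, ← hw.sub_eq h hmb hmc, ← hw.sub_eq h hmc hma] at hid
  have hvol : volume.real (convexHull ℝ (K : Set Plane)) / (2 * refArea) = |triDet a b c| / 2 := by
    rw [h.volume_real]; have := refArea_pos.ne'; field_simp
  have hdiff : ∀ x ∈ convexHull ℝ (K : Set Plane), ∀ y ∈ convexHull ℝ (K : Set Plane),
      |w x - w y| ≤ ‖elemGrad K w‖ * δ := by
    intro x hx y hy
    rw [hw.sub_eq h hx hy]
    refine (abs_real_inner_le_norm _ _).trans (mul_le_mul_of_nonneg_left ?_ (norm_nonneg _))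
    rw [← dist_eq_norm]
    exact (Metric.dist_le_diam_of_mem (TriMesh.isCompact_convexHull K).isBounded hx hy).trans hδ
  have hδ0 : 0 ≤ δ := Metric.diam_nonneg.trans hδ
  -- The error on one segment: the difference of `w` contributes the third power of `δ`. Three
  -- segments give the constant `12`.
  have edge : ∀ {p q s : ℝ}, |p| ≤ ‖elemGrad K w‖ * δ →
      |q - s| ≤ 4 * L * δ ^ 2 * ‖elemGrad K v‖ →
      |p * q - p * s| ≤ 4 * L * δ ^ 3 * ‖elemGrad K v‖ * ‖elemGrad K w‖ := by
    intro p q s hp hq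
    rw [← mul_sub, abs_mul]
    refine (mul_le_mul hp hq (abs_nonneg _) (by positivity)).trans (le_of_eq (by ring))
  rw [elemForm_eq h hv, hvol, ← hid]
  have k1 := abs_le.1 (edge (hdiff a hma b hmb) (abs_constFlux_sub_le h hA (elemGrad K v) hδ))
  have k2 := abs_le.1 (edge (hdiff b hmb c hmc)
    (abs_constFlux_sub_le h.rotate hA (elemGrad K v) hδ))
  have k3 := abs_le.1 (edge (hdiff c hmc a hma)
    (abs_constFlux_sub_le h.rotate.rotate hA (elemGrad K v) hδ))
  rw [hX]
  rw [abs_le]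
  constructor <;> linarith [k1.1, k1.2, k2.1, k2.2, k3.1, k3.2]

theorem constFlux_add (h : IsTriangle K a b c)
    (hA : LipBound (convexHull ℝ (K : Set Plane)) A L B) (n G H : Plane) :
    constFlux A n (midpoint ℝ a b) (barycenter K) (G + H) =
      constFlux A n (midpoint ℝ a b) (barycenter K) G +
        constFlux A n (midpoint ℝ a b) (barycenter K) H := by
  rw [constFlux, constFlux, constFlux, ← intervalIntegral.integral_add
    (intervalIntegrable_flux h hA _ _) (intervalIntegrable_flux h hA _ _)]
  simp only [WithLp.ofLp_add, Matrix.mulVec_add, dotProduct_add]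

theorem constFlux_smul (n p r G : Plane) (k : ℝ) :
    constFlux A n p r (k • G) = k * constFlux A n p r G := by
  rw [constFlux, constFlux, ← intervalIntegral.integral_const_mul]
  simp only [WithLp.ofLp_smul, Matrix.mulVec_smul, dotProduct_smul, smul_eq_mul]

theorem elemForm_add_left (h : IsTriangle K a b c)
    (hA : LipBound (convexHull ℝ (K : Set Plane)) A L B) {v v' w : Plane → ℝ}
    (hv : ElemAffine K v) (hv' : ElemAffine K v') :
    elemForm A K (v + v') w = elemForm A K v w + elemForm A K v' w := by
  rw [elemForm_eq h (hv.add hv'), elemForm_eq h hv, elemForm_eq h hv', hv.elemGrad_add hv' h,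
    constFlux_add h hA, constFlux_add h.rotate hA, constFlux_add h.rotate.rotate hA]
  ring

theorem elemForm_smul_left (h : IsTriangle K a b c) {v w : Plane → ℝ}
    (hv : ElemAffine K v) (k : ℝ) : elemForm A K (k • v) w = k * elemForm A K v w := by
  rw [elemForm_eq h (hv.smul k), elemForm_eq h hv, hv.elemGrad_smul h,
    constFlux_smul, constFlux_smul, constFlux_smul]
  ring

theorem elemForm_add_right (v w w' : Plane → ℝ) :
    elemForm A K v (w + w') = elemForm A K v w + elemForm A K v w' := by
  simp only [elemForm, Pi.add_apply, add_mul, Finset.sum_add_distrib, neg_add]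

theorem elemForm_smul_right (v w : Plane → ℝ) (k : ℝ) :
    elemForm A K v (k • w) = k * elemForm A K v w := by
  simp only [elemForm, Pi.smul_apply, smul_eq_mul, mul_assoc, ← Finset.mul_sum, mul_neg]

end Flux


/-! ### Mass form, discrete norms and quasi-uniformity -/

/-- The area of a triangle. -/
def area (K : Finset Plane) : ℝ := volume.real (convexHull ℝ (K : Set Plane))

theorem area_nonneg (K : Finset Plane) : 0 ≤ area K := measureReal_nonneg

theorem volume_convexHull_ne_top (K : Finset Plane) : volume (convexHull ℝ (K : Set Plane)) ≠ ⊤ :=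
  (TriMesh.isCompact_convexHull K).measure_lt_top.ne

/-- A function that is affine on a triangle is bounded there by its values at the vertices. -/
theorem ElemAffine.sq_le {K : Finset Plane} {v : Plane → ℝ} (hv : ElemAffine K v) {x : Plane}
    (hx : x ∈ convexHull ℝ (K : Set Plane)) : v x ^ 2 ≤ ∑ z ∈ K, v z ^ 2 := by
  obtain ⟨g, hg⟩ := hv
  have hs : 0 ≤ ∑ z ∈ K, v z ^ 2 := Finset.sum_nonneg fun z _ => sq_nonneg _
  -- The preimage of a symmetric interval under an affine function is convex and contains the
  -- vertices.
  have key : convexHull ℝ (K : Set Plane) ⊆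
      g ⁻¹' Icc (-Real.sqrt (∑ z ∈ K, v z ^ 2)) (Real.sqrt (∑ z ∈ K, v z ^ 2)) := by
    refine convexHull_min (fun z hz => ?_) ((convex_Icc _ _).affine_preimage g)
    rw [mem_preimage, ← hg (subset_convexHull ℝ _ hz)]
    have : |v z| ≤ Real.sqrt (∑ z ∈ K, v z ^ 2) := by
      refine Real.abs_le_sqrt ?_
      exact Finset.single_le_sum (f := fun z => v z ^ 2) (fun z _ => sq_nonneg _) hz
    exact abs_le.1 this
  have h := key hx
  rw [mem_preimage, ← hg hx, mem_Icc, ← abs_le] at h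
  rw [← sq_abs, ← Real.sq_sqrt hs]
  gcongr

theorem setIntegral_dualCell_eq {K : Finset Plane} {a b c : Plane} (h : IsTriangle K a b c)
    {v : Plane → ℝ} (hv : ElemAffine K v) :
    ∫ x in dualCell K a, v x = area K *
      ((refMass₀ - refMass₁) / refArea * v a + refMass₁ / refArea * ∑ z ∈ K, v z) := by
  obtain ⟨g, hg⟩ := hv
  rw [h.setIntegral_dualCell hg, area, h.volume_real, h.sum_eq]
  have := refArea_pos.ne'
  field_simp
  ring

theorem measureReal_dualCell_le {K : Finset Plane} {a b c : Plane} (h : IsTriangle K a b c) :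
    volume.real (dualCell K a) ≤ area K :=
  measureReal_mono h.dualCell_subset (volume_convexHull_ne_top K)

/-- Young's inequality under the integral, with one weight `ε` for all cells, so that the estimates
can be summed over the mesh before `ε` is optimized. -/
theorem two_mul_abs_setIntegral_le {S T : Set Plane} (hST : S ⊆ T)
    (hT : volume T ≠ ⊤) {F : Plane → ℝ}
    (hF2 : IntegrableOn (fun x => F x ^ 2) T) {ε : ℝ} (hε : 0 < ε) (r : ℝ) :
    2 * |r * ∫ x in S, F x| ≤ ε * (∫ x in T, F x ^ 2) + r ^ 2 / ε * volume.real T := by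
  have hS : volume S ≠ ⊤ := measure_ne_top_of_subset hST hT
  have h1 : 2 * |r * ∫ x in S, F x| ≤ ∫ x in S, (ε * F x ^ 2 + r ^ 2 / ε) := by
    have hi : IntegrableOn (fun x => ε * F x ^ 2 + r ^ 2 / ε) S :=
      ((hF2.mono_set hST).const_mul ε).add (integrableOn_const hS)
    have e : 2 * |r * ∫ x in S, F x| = |∫ x in S, 2 * r * F x| := by
      rw [integral_const_mul, mul_assoc, abs_mul 2]; norm_num
    rw [e]
    refine abs_integral_le_integral_abs.trans
      (integral_mono_of_nonneg (Filter.Eventually.of_forall fun x => abs_nonneg _) hi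
        (Filter.Eventually.of_forall fun x => ?_))
    have h2 : 0 ≤ (ε * F x - r) ^ 2 / ε := by positivity
    have h3 : 0 ≤ (ε * F x + r) ^ 2 / ε := by positivity
    have e2 : (ε * F x - r) ^ 2 / ε = ε * F x ^ 2 + r ^ 2 / ε - 2 * r * F x := by
      field_simp; ring
    have e3 : (ε * F x + r) ^ 2 / ε = ε * F x ^ 2 + r ^ 2 / ε + 2 * r * F x := by
      field_simp; ring
    simp only [abs_le]
    constructor <;> linarith
  refine h1.trans ?_
  rw [integral_add ((hF2.mono_set hST).const_mul ε) (integrableOn_const hS), integral_const_mul,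
    setIntegral_const, smul_eq_mul, mul_comm (volume.real S)]
  have h4 : ∫ x in S, F x ^ 2 ≤ ∫ x in T, F x ^ 2 :=
    setIntegral_mono_set hF2 (Filter.Eventually.of_forall fun x => sq_nonneg _)
      (LE.le.eventuallyLE hST)
  have h5 : volume.real S ≤ volume.real T := measureReal_mono hST hT
  have : 0 ≤ r ^ 2 / ε := by positivity
  gcongr

/-- An inequality that holds with every weight `ε` in Young's form holds in product form. -/
theorem sq_le_mul_of_forall {X p q : ℝ} (hp : 0 ≤ p) (hq : 0 ≤ q)
    (h : ∀ ε : ℝ, 0 < ε → 2 * |X| ≤ ε * p + q / ε) : X ^ 2 ≤ p * q := by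
  have key : ∀ δ : ℝ, 0 < δ → |X| ≤ Real.sqrt ((p + δ) * (q + δ)) := by
    intro δ hδ
    have hp' : 0 < Real.sqrt (p + δ) := Real.sqrt_pos.2 (by linarith)
    have hq' : 0 < Real.sqrt (q + δ) := Real.sqrt_pos.2 (by linarith)
    have h1 := h (Real.sqrt (q + δ) / Real.sqrt (p + δ)) (by positivity)
    have e1 : Real.sqrt (p + δ) ^ 2 = p + δ := Real.sq_sqrt (by linarith)
    have e2 : Real.sqrt (q + δ) ^ 2 = q + δ := Real.sq_sqrt (by linarith)
    have h2 : Real.sqrt (q + δ) / Real.sqrt (p + δ) * p ≤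
        Real.sqrt (q + δ) * Real.sqrt (p + δ) := by
      rw [div_mul_eq_mul_div, div_le_iff₀ hp']; nlinarith
    have h3 : q / (Real.sqrt (q + δ) / Real.sqrt (p + δ)) ≤
        Real.sqrt (q + δ) * Real.sqrt (p + δ) := by
      rw [div_div_eq_mul_div, div_le_iff₀ hq']; nlinarith
    rw [Real.sqrt_mul (by linarith)]
    linarith
  have hlim : Filter.Tendsto (fun δ : ℝ => Real.sqrt ((p + δ) * (q + δ))) (nhdsWithin 0 (Ioi 0))
      (nhds (Real.sqrt ((p + 0) * (q + 0)))) := by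
    apply tendsto_nhdsWithin_of_tendsto_nhds
    exact (by fun_prop : Continuous fun δ : ℝ => Real.sqrt ((p + δ) * (q + δ))).tendsto 0
  have h1 : |X| ≤ Real.sqrt ((p + 0) * (q + 0)) :=
    ge_of_tendsto hlim (by filter_upwards [self_mem_nhdsWithin] with δ hδ using key δ hδ)
  rw [add_zero, add_zero] at h1
  have := Real.sqrt_nonneg (p * q)
  rw [← sq_abs, ← Real.sq_sqrt (mul_nonneg hp hq)]
  gcongr

namespace TriMesh

variable {Ω : Set Plane} {𝒯 : TriMesh Ω} {K : Finset Plane} {F v w : Plane → ℝ}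

/-- The discrete `L²` norm, squared. -/
def vertSq (𝒯 : TriMesh Ω) (v : Plane → ℝ) : ℝ := ∑ K ∈ 𝒯.triangles, area K * ∑ z ∈ K, v z ^ 2

/-- The `H¹` seminorm, squared. -/
def gradSq (𝒯 : TriMesh Ω) (v : Plane → ℝ) : ℝ := ∑ K ∈ 𝒯.triangles, area K * ‖elemGrad K v‖ ^ 2

theorem vertSq_nonneg (𝒯 : TriMesh Ω) (v : Plane → ℝ) : 0 ≤ 𝒯.vertSq v :=
  Finset.sum_nonneg fun K _ => mul_nonneg (area_nonneg K) (Finset.sum_nonneg fun _ _ => sq_nonneg _)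

theorem gradSq_nonneg (𝒯 : TriMesh Ω) (v : Plane → ℝ) : 0 ≤ 𝒯.gradSq v :=
  Finset.sum_nonneg fun K _ => mul_nonneg (area_nonneg K) (sq_nonneg _)

theorem elemAffine (hv : v ∈ 𝒯.trialSpace) (hK : K ∈ 𝒯.triangles) : ElemAffine K v :=
  hv.2.2 K hK

theorem integrableOn_of_continuousOn (hΩ : IsConvexPolygonalDomain Ω)
    (hF : ContinuousOn F (closure Ω)) : IntegrableOn F Ω :=
  (hF.integrableOn_compact hΩ.isCompact_closure).mono_set subset_closure

theorem integrableOn_convexHull (hΩ : IsConvexPolygonalDomain Ω) (hK : K ∈ 𝒯.triangles)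
    (hF : IntegrableOn F Ω) : IntegrableOn F (convexHull ℝ (K : Set Plane)) :=
  (hF.congr_set_ae hΩ.ae_eq_closure.symm).mono_set (convexHull_subset hK)

theorem ae_gradient_eq (hv : v ∈ 𝒯.trialSpace) (hK : K ∈ 𝒯.triangles) :
    ∀ᵐ x ∂volume.restrict (convexHull ℝ (K : Set Plane)), gradient v x = elemGrad K v := by
  obtain ⟨a, b, c, h⟩ := exists_isTriangle hK
  have h0 : volume (convexHull ℝ (K : Set Plane) \ interior (convexHull ℝ (K : Set Plane))) = 0 := by
    refine measure_mono_null ?_ ((convex_convexHull ℝ (K : Set Plane)).addHaar_frontier volume)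
    rw [frontier, (isCompact_convexHull K).isClosed.closure_eq]
  rw [ae_restrict_iff' (isCompact_convexHull K).measurableSet]
  filter_upwards [compl_mem_ae_iff.2 h0] with x hx hxK
  refine (elemAffine hv hK).gradient_eq h ?_
  by_contra hn
  exact hx ⟨hxK, hn⟩

theorem integrableOn_gradient_sq (hv : v ∈ 𝒯.trialSpace) :
    IntegrableOn (fun x => ‖gradient v x‖ ^ 2) (closure Ω) := by
  rw [← 𝒯.cover, integrableOn_finset_iUnion]
  intro K hK
  refine (integrableOn_const (C := ‖elemGrad K v‖ ^ 2) (volume_convexHull_ne_top K)).congr ?_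
  filter_upwards [ae_gradient_eq hv hK] with x hx
  rw [hx]

theorem integral_gradient_sq (hΩ : IsConvexPolygonalDomain Ω) (hv : v ∈ 𝒯.trialSpace) :
    ∫ x in Ω, ‖gradient v x‖ ^ 2 = 𝒯.gradSq v := by
  rw [setIntegral_eq_sum hΩ 𝒯 ((integrableOn_gradient_sq hv).mono_set subset_closure), gradSq]
  refine Finset.sum_congr rfl fun K hK => ?_
  rw [integral_congr_ae (g := fun _ => ‖elemGrad K v‖ ^ 2), setIntegral_const, smul_eq_mul, area]
  filter_upwards [ae_gradient_eq hv hK] with x hx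
  rw [hx]

theorem integral_sq_le (hΩ : IsConvexPolygonalDomain Ω) (hv : v ∈ 𝒯.trialSpace) :
    ∫ x in Ω, v x ^ 2 ≤ 𝒯.vertSq v := by
  have hi : IntegrableOn (fun x => v x ^ 2) Ω := integrableOn_of_continuousOn hΩ (hv.1.pow 2)
  rw [setIntegral_eq_sum hΩ 𝒯 hi, vertSq]
  refine Finset.sum_le_sum fun K hK => ?_
  calc ∫ x in convexHull ℝ (K : Set Plane), v x ^ 2
      ≤ ∫ _x in convexHull ℝ (K : Set Plane), ∑ z ∈ K, v z ^ 2 :=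
        setIntegral_mono_on (integrableOn_convexHull hΩ hK hi)
          (integrableOn_const (volume_convexHull_ne_top K))
          (isCompact_convexHull K).measurableSet fun x hx => (elemAffine hv hK).sq_le hx
    _ = _ := by rw [setIntegral_const, smul_eq_mul, area]

/-- By affine invariance all triangles share one mass matrix up to their area, with one diagonal and
one off-diagonal value. Symmetry and definiteness can be read off. -/
theorem mass_eq (hΩ : IsConvexPolygonalDomain Ω) (hv : v ∈ 𝒯.trialSpace) (hw : w ∈ 𝒯.trialSpace) :
    l2Inner Ω v (𝒯.interpStar w) = ∑ K ∈ 𝒯.triangles, area K *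
      ((refMass₀ - refMass₁) / refArea * ∑ z ∈ K, v z * w z +
        refMass₁ / refArea * ((∑ z ∈ K, v z) * ∑ z ∈ K, w z)) := by
  rw [integral_mul_interpStar hΩ hw (integrableOn_of_continuousOn hΩ hv.1)]
  refine Finset.sum_congr rfl fun K hK => ?_
  have : ∀ z ∈ K, w z * ∫ x in dualCell K z, v x = area K *
      ((refMass₀ - refMass₁) / refArea * (v z * w z) +
        refMass₁ / refArea * ((∑ z ∈ K, v z) * w z)) := by
    intro z hz
    obtain ⟨b, c, h⟩ := exists_isTriangle_of_mem hK hz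
    rw [setIntegral_dualCell_eq h (elemAffine hv hK)]
    ring
  rw [Finset.sum_congr rfl this, ← Finset.mul_sum, Finset.sum_add_distrib, ← Finset.mul_sum,
    ← Finset.mul_sum, ← Finset.mul_sum]

theorem mass_comm (hΩ : IsConvexPolygonalDomain Ω) (hv : v ∈ 𝒯.trialSpace)
    (hw : w ∈ 𝒯.trialSpace) :
    l2Inner Ω v (𝒯.interpStar w) = l2Inner Ω w (𝒯.interpStar v) := by
  rw [mass_eq hΩ hv hw, mass_eq hΩ hw hv]
  refine Finset.sum_congr rfl fun K _ => ?_
  rw [mul_comm (∑ z ∈ K, v z)]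
  simp only [mul_comm (v _)]

theorem massConst_pos : 0 < (refMass₀ - refMass₁) / refArea :=
  div_pos (sub_pos.2 refMass₁_lt) refArea_pos

/-- The rank-one part of the mass matrix is nonnegative and is dropped. -/
theorem le_mass (hΩ : IsConvexPolygonalDomain Ω) (hv : v ∈ 𝒯.trialSpace) :
    (refMass₀ - refMass₁) / refArea * 𝒯.vertSq v ≤ l2Inner Ω v (𝒯.interpStar v) := by
  rw [mass_eq hΩ hv hv, vertSq, Finset.mul_sum]
  refine Finset.sum_le_sum fun K _ => ?_
  have h1 : 0 ≤ refMass₁ / refArea := div_nonneg refMass₁_nonneg refArea_pos.le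
  have h2 : 0 ≤ area K * (refMass₁ / refArea * ((∑ z ∈ K, v z) * ∑ z ∈ K, v z)) :=
    mul_nonneg (area_nonneg K) (mul_nonneg h1 (mul_self_nonneg _))
  simp only [← pow_two] at h2 ⊢
  rw [mul_add, mul_left_comm]
  linarith

/-- The Cauchy–Schwarz inequality for the `L²` product with a test function. -/
theorem sq_l2Inner_interpStar_le (hΩ : IsConvexPolygonalDomain Ω) (hw : w ∈ 𝒯.trialSpace)
    (hF : IntegrableOn F Ω) (hF2 : IntegrableOn (fun x => F x ^ 2) Ω) :
    l2Inner Ω F (𝒯.interpStar w) ^ 2 ≤ 3 * (∫ x in Ω, F x ^ 2) * 𝒯.vertSq w := by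
  have h0 : 0 ≤ ∫ x in Ω, F x ^ 2 := integral_nonneg fun x => sq_nonneg _
  refine sq_le_mul_of_forall (by positivity) (𝒯.vertSq_nonneg w) fun ε hε => ?_
  rw [integral_mul_interpStar hΩ hw hF, setIntegral_eq_sum hΩ 𝒯 hF2, vertSq]
  calc 2 * |∑ K ∈ 𝒯.triangles, ∑ z ∈ K, w z * ∫ x in dualCell K z, F x|
      ≤ 2 * ∑ K ∈ 𝒯.triangles, ∑ z ∈ K, |w z * ∫ x in dualCell K z, F x| := by
        gcongr
        exact (Finset.abs_sum_le_sum_abs _ _).trans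
          (Finset.sum_le_sum fun K _ => Finset.abs_sum_le_sum_abs _ _)
    _ = ∑ K ∈ 𝒯.triangles, ∑ z ∈ K, 2 * |w z * ∫ x in dualCell K z, F x| := by
        simp only [Finset.mul_sum]
    _ ≤ ∑ K ∈ 𝒯.triangles, ∑ z ∈ K,
          (ε * (∫ x in convexHull ℝ (K : Set Plane), F x ^ 2) + w z ^ 2 / ε * area K) := by
        refine Finset.sum_le_sum fun K hK => Finset.sum_le_sum fun z hz => ?_
        exact two_mul_abs_setIntegral_le (dualCell_subset hK hz) (volume_convexHull_ne_top K)
          (integrableOn_convexHull hΩ hK hF2) hε (w z)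
    _ = _ := by
        rw [Finset.mul_sum, Finset.mul_sum, Finset.sum_div, ← Finset.sum_add_distrib]
        refine Finset.sum_congr rfl fun K hK => ?_
        -- Each triangle is counted once for each of its vertices; this is the factor `3`.
        rw [Finset.sum_add_distrib, Finset.sum_const, 𝒯.card_eq_three K hK, ← Finset.sum_mul,
          ← Finset.sum_div]
        simp only [nsmul_eq_mul]
        push_cast
        ring

/-- The lower bound `le_mass` is squared, compared with the Cauchy–Schwarz bound for `(v, I*v)`, and
one factor `vertSq` is cancelled. -/
theorem vertSq_le (hΩ : IsConvexPolygonalDomain Ω) (hv : v ∈ 𝒯.trialSpace) :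
    ((refMass₀ - refMass₁) / refArea) ^ 2 * 𝒯.vertSq v ≤ 3 * ∫ x in Ω, v x ^ 2 := by
  have h1 := sq_l2Inner_interpStar_le hΩ hv (integrableOn_of_continuousOn hΩ hv.1)
    (integrableOn_of_continuousOn hΩ (hv.1.pow 2))
  have h2 := le_mass hΩ hv
  have h3 := 𝒯.vertSq_nonneg v
  have h4 := massConst_pos
  rcases h3.eq_or_lt with h0 | h0
  · rw [← h0, mul_zero]
    exact mul_nonneg (by norm_num) (integral_nonneg fun x => sq_nonneg _)
  · have h5 : ((refMass₀ - refMass₁) / refArea * 𝒯.vertSq v) ^ 2 ≤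
        3 * (∫ x in Ω, v x ^ 2) * 𝒯.vertSq v := by
      refine le_trans ?_ h1
      gcongr
    refine le_of_mul_le_mul_right (le_trans (le_of_eq ?_) h5) h0
    ring

theorem mass_le (hΩ : IsConvexPolygonalDomain Ω) (hv : v ∈ 𝒯.trialSpace) :
    (refMass₀ - refMass₁) / refArea * l2Inner Ω v (𝒯.interpStar v) ≤ 3 * ∫ x in Ω, v x ^ 2 := by
  have h1 := sq_l2Inner_interpStar_le hΩ hv (integrableOn_of_continuousOn hΩ hv.1)
    (integrableOn_of_continuousOn hΩ (hv.1.pow 2))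
  have h2 := le_mass hΩ hv
  have h3 := 𝒯.vertSq_nonneg v
  have h4 := massConst_pos
  have h5 : 0 ≤ ∫ x in Ω, v x ^ 2 := integral_nonneg fun x => sq_nonneg _
  set m := (refMass₀ - refMass₁) / refArea
  set M := l2Inner Ω v (𝒯.interpStar v)
  have hM : 0 ≤ M := (mul_nonneg h4.le h3).trans h2
  rcases hM.eq_or_lt with h0 | h0
  · rw [← h0, mul_zero]; positivity
  · refine le_of_mul_le_mul_right ?_ h0
    calc m * M * M = m * M ^ 2 := by ring
      _ ≤ m * (3 * (∫ x in Ω, v x ^ 2) * 𝒯.vertSq v) := by gcongr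
      _ = 3 * (∫ x in Ω, v x ^ 2) * (m * 𝒯.vertSq v) := by ring
      _ ≤ _ := by gcongr

/-! ### Consequences of quasi-uniformity -/

theorem diam_le_meshSize (hK : K ∈ 𝒯.triangles) :
    Metric.diam (convexHull ℝ (K : Set Plane)) ≤ 𝒯.meshSize :=
  le_csSup ((𝒯.triangles.finite_toSet.image _).bddAbove) ⟨K, hK, rfl⟩

theorem meshSize_nonneg (𝒯 : TriMesh Ω) : 0 ≤ 𝒯.meshSize := by
  refine Real.sSup_nonneg ?_
  rintro x ⟨K, -, rfl⟩
  exact Metric.diam_nonneg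

/-- The constant in the lower bound for the areas of the triangles. -/
def shapeConst (ρ : ℝ) : ℝ := 4 / (volume.real (Metric.ball (0 : Plane) 1) * ρ ^ 2)

theorem volume_unitBall_pos : 0 < volume.real (Metric.ball (0 : Plane) 1) :=
  ENNReal.toReal_pos (Metric.measure_ball_pos _ _ one_pos).ne' measure_ball_lt_top.ne

theorem shapeConst_pos {ρ : ℝ} (hρ : 0 < ρ) : 0 < shapeConst ρ :=
  div_pos (by norm_num) (mul_pos volume_unitBall_pos (by positivity))

theorem sq_meshSize_le {ρ : ℝ} (hρ : 0 < ρ) (hq : 𝒯.IsQuasiUniform ρ) (hK : K ∈ 𝒯.triangles) :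
    𝒯.meshSize ^ 2 ≤ shapeConst ρ * area K := by
  obtain ⟨c, hc⟩ := hq K hK
  have hh := 𝒯.meshSize_nonneg
  have h1 : volume.real (Metric.ball c (ρ * 𝒯.meshSize / 2)) ≤ area K :=
    measureReal_mono hc (volume_convexHull_ne_top K)
  have h2 : volume.real (Metric.ball c (ρ * 𝒯.meshSize / 2)) =
      (ρ * 𝒯.meshSize / 2) ^ 2 * volume.real (Metric.ball (0 : Plane) 1) := by
    rw [Measure.real, Measure.addHaar_ball _ _ (by positivity), ENNReal.toReal_mul,
      ENNReal.toReal_ofReal (by positivity), finrank_euclideanSpace_fin]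
    rfl
  rw [h2] at h1
  have hb := volume_unitBall_pos
  rw [shapeConst, div_mul_eq_mul_div, le_div_iff₀ (by positivity)]
  nlinarith

/-- Along a segment in the inscribed disc parallel to the gradient, the function changes by the
length of the segment times the norm of the gradient, while its values are controlled by those at
the vertices. -/
theorem sq_norm_elemGrad_le {ρ : ℝ} (hρ : 0 < ρ) (hq : 𝒯.IsQuasiUniform ρ)
    (hv : v ∈ 𝒯.trialSpace) (hK : K ∈ 𝒯.triangles) :
    (ρ * 𝒯.meshSize) ^ 2 * ‖elemGrad K v‖ ^ 2 ≤ 16 * ∑ z ∈ K, v z ^ 2 := by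
  obtain ⟨c, hc⟩ := hq K hK
  obtain ⟨a, b, d, h⟩ := exists_isTriangle hK
  set G := elemGrad K v
  have hs : 0 ≤ ∑ z ∈ K, v z ^ 2 := Finset.sum_nonneg fun z _ => sq_nonneg _
  have hh := 𝒯.meshSize_nonneg
  rcases hh.eq_or_lt with h0 | h0
  · rw [← h0]; simpa using hs
  by_cases hG : G = 0
  · rw [hG]; simpa using hs
  have hG' : 0 < ‖G‖ := norm_pos_iff.2 hG
  -- Half the radius of the disc, so that both points `c + p` and `c - p` lie in the open ball.
  set s := ρ * 𝒯.meshSize / 4 with hsdef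
  have hspos : 0 < s := by positivity
  set p : Plane := (s / ‖G‖) • G with hp
  have hpn : ‖p‖ = s := by
    rw [hp, norm_smul, Real.norm_eq_abs, abs_of_pos (by positivity)]; field_simp
  have hx : c + p ∈ convexHull ℝ (K : Set Plane) := hc (by
    rw [Metric.mem_ball, dist_eq_norm, add_sub_cancel_left, hpn]; linarith)
  have hy : c - p ∈ convexHull ℝ (K : Set Plane) := hc (by
    rw [Metric.mem_ball, dist_eq_norm, sub_sub_cancel_left, norm_neg, hpn]; linarith)
  have hd := (elemAffine hv hK).sub_eq h hx hy
  have e : inner ℝ G (c + p - (c - p)) = 2 * s * ‖G‖ := by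
    have : c + p - (c - p) = (2 * (s / ‖G‖)) • G := by rw [hp]; module
    rw [this, real_inner_smul_right, real_inner_self_eq_norm_sq]
    field_simp
  rw [e] at hd
  have h1 := (elemAffine hv hK).sq_le hx
  have h2 := (elemAffine hv hK).sq_le hy
  have e2 : (ρ * 𝒯.meshSize) ^ 2 * ‖G‖ ^ 2 = 4 * (2 * s * ‖G‖) ^ 2 := by rw [hsdef]; ring
  rw [e2, ← hd]
  nlinarith [sq_nonneg (v (c + p) + v (c - p))]

/-- The inverse inequality. -/
theorem inverse_inequality {ρ : ℝ} (hρ : 0 < ρ) (hq : 𝒯.IsQuasiUniform ρ)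
    (hv : v ∈ 𝒯.trialSpace) : 𝒯.meshSize ^ 2 * 𝒯.gradSq v ≤ 16 / ρ ^ 2 * 𝒯.vertSq v := by
  rw [gradSq, vertSq, Finset.mul_sum, Finset.mul_sum]
  refine Finset.sum_le_sum fun K hK => ?_
  have h1 := mul_le_mul_of_nonneg_left (sq_norm_elemGrad_le hρ hq hv hK) (area_nonneg K)
  rw [div_mul_eq_mul_div, le_div_iff₀ (by positivity)]
  nlinarith

end TriMesh


/-! ### The Poincaré inequality -/

/-- A function that is Lipschitz at every point, with the same constant, is Lipschitz. -/
theorem lipschitzWith_of_eventually {f : Plane → ℝ} {C : NNReal}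
    (hf : ∀ x, ∀ᶠ z in nhds x, |f z - f x| ≤ C * ‖z - x‖) : LipschitzWith C f := by
  have hcont : Continuous f := by
    refine continuous_iff_continuousAt.2 fun x => ?_
    rw [ContinuousAt, tendsto_iff_norm_sub_tendsto_zero]
    refine squeeze_zero' (Filter.Eventually.of_forall fun _ => norm_nonneg _) (hf x) ?_
    have : Continuous fun z : Plane => (C : ℝ) * ‖z - x‖ := by fun_prop
    simpa using this.tendsto x
  refine LipschitzWith.of_dist_le_mul fun y x => ?_
  rw [Real.dist_eq, dist_eq_norm]
  set d := ‖y - x‖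
  set φ : ℝ → ℝ := fun t => f (x + t • (y - x)) - f x with hφ
  have hline : Continuous fun t : ℝ => x + t • (y - x) := by fun_prop
  have hφc : Continuous φ := (hcont.comp hline).sub continuous_const
  have key : ∀ ε : ℝ, 0 < ε → |f y - f x| ≤ C * d + ε := by
    intro ε hε
    -- A mean value argument along the segment. The slack `ε` supplies the strict inequality between
    -- slopes that the comparison requires.
    have := image_norm_le_of_liminf_right_slope_norm_lt_deriv_boundary (a := 0) (b := 1) (f := φ)
      (f' := fun _ => C * d) hφc.continuousOn ?_ (B := fun t => (C * d + ε) * t)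
      (B' := fun _ => C * d + ε) (by simp [hφ]) (by fun_prop)
      (fun t _ => by simpa using ((hasDerivAt_id t).const_mul (C * d + ε)).hasDerivWithinAt)
      (fun t _ _ => by linarith) (right_mem_Icc.2 zero_le_one)
    · simpa [hφ] using this
    intro t _ r hr
    refine Filter.Eventually.frequently ?_
    have h1 := (hline.tendsto t).eventually (hf (x + t • (y - x)))
    filter_upwards [h1.filter_mono nhdsWithin_le_nhds, self_mem_nhdsWithin] with s hs hts
    have hts' : 0 < s - t := sub_pos.2 hts
    have e : x + s • (y - x) - (x + t • (y - x)) = (s - t) • (y - x) := by module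
    rw [e, norm_smul, Real.norm_eq_abs, abs_of_pos hts'] at hs
    refine lt_of_le_of_lt ?_ hr
    rw [slope_def_field, div_le_iff₀ hts']
    have h2 : |φ s| - |φ t| ≤ |φ s - φ t| := abs_sub_abs_le_abs_sub _ _
    have h3 : φ s - φ t = f (x + s • (y - x)) - f (x + t • (y - x)) := by simp [hφ]
    rw [h3] at h2
    simp only [Function.comp, Real.norm_eq_abs]
    linarith
  exact le_of_forall_pos_le_add key

namespace TriMesh

variable {Ω : Set Plane} {𝒯 : TriMesh Ω} {v : Plane → ℝ}

/-- The extension by zero of a trial function is Lipschitz continuous. -/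
theorem exists_lipschitzWith_indicator (hΩ : IsConvexPolygonalDomain Ω) (hv : v ∈ 𝒯.trialSpace) :
    ∃ C, LipschitzWith C ((closure Ω).indicator v) := by
  set C : ℝ := ∑ K ∈ 𝒯.triangles, ‖elemGrad K v‖ with hC
  have hC0 : 0 ≤ C := Finset.sum_nonneg fun _ _ => norm_nonneg _
  have hbd : ∀ x ∈ closure Ω, x ∉ Ω → v x = 0 := fun x hx hn => hv.2.1 x (by
    rw [hΩ.isOpen.frontier_eq]; exact ⟨hx, hn⟩)
  refine ⟨NNReal.mk C hC0, lipschitzWith_of_eventually fun x => ?_⟩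
  rw [NNReal.coe_mk]
  by_cases hx : x ∈ closure Ω
  swap
  · filter_upwards [isClosed_closure.isOpen_compl.mem_nhds hx] with z hz
    rw [indicator_of_notMem hx, indicator_of_notMem hz]
    simp; positivity
  -- The triangles are closed and finite in number, so every triangle that contains a point near `x`
  -- contains `x` itself.
  have h1 : ∀ᶠ z in nhds x, ∀ K ∈ 𝒯.triangles, z ∈ convexHull ℝ (K : Set Plane) →
      x ∈ convexHull ℝ (K : Set Plane) := by
    rw [Filter.eventually_all_finset]
    intro K _
    by_cases hxK : x ∈ convexHull ℝ (K : Set Plane)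
    · exact Filter.Eventually.of_forall fun _ _ => hxK
    · filter_upwards [(isCompact_convexHull K).isClosed.isOpen_compl.mem_nhds hxK] with z hz hz'
      exact absurd hz' hz
  have h2 : ∀ᶠ z in nhds x, z ∈ closure Ω ∨ (z ∉ closure Ω ∧ x ∉ Ω) := by
    by_cases hxΩ : x ∈ Ω
    · filter_upwards [hΩ.isOpen.mem_nhds hxΩ] with z hz using Or.inl (subset_closure hz)
    · exact Filter.Eventually.of_forall fun z => (em (z ∈ closure Ω)).imp_right fun h => ⟨h, hxΩ⟩
  filter_upwards [h1, h2] with z hz1 hz2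
  rw [indicator_of_mem hx]
  rcases hz2 with hz | ⟨hz, hxΩ⟩
  · rw [indicator_of_mem hz]
    have hz' := hz
    rw [← 𝒯.cover] at hz'
    obtain ⟨K, hK, hzK⟩ := mem_iUnion₂.1 hz'
    obtain ⟨a, b, c, h⟩ := exists_isTriangle hK
    rw [(elemAffine hv hK).sub_eq h hzK (hz1 K hK hzK)]
    refine (abs_real_inner_le_norm _ _).trans (mul_le_mul_of_nonneg_right ?_ (norm_nonneg _))
    exact Finset.single_le_sum (f := fun K => ‖elemGrad K v‖) (fun _ _ => norm_nonneg _) hK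
  · rw [indicator_of_notMem hz, hbd x hx hxΩ]
    simp; positivity

theorem ae_hasGradientAt (hΩ : IsConvexPolygonalDomain Ω) (hv : v ∈ 𝒯.trialSpace) :
    ∀ᵐ x ∂volume.restrict Ω, HasGradientAt v (gradient v x) x := by
  have h0 : ∀ᵐ x ∂(volume : Measure Plane), ∀ K ∈ 𝒯.triangles,
      x ∉ frontier (convexHull ℝ (K : Set Plane)) :=
    (ae_ball_iff 𝒯.triangles.countable_toSet).2 fun K _ =>
      compl_mem_ae_iff.2 ((convex_convexHull ℝ (K : Set Plane)).addHaar_frontier volume)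
  rw [ae_restrict_iff' hΩ.isOpen.measurableSet]
  filter_upwards [h0] with x hx hxΩ
  have hx' : x ∈ closure Ω := subset_closure hxΩ
  rw [← 𝒯.cover] at hx'
  obtain ⟨K, hK, hxK⟩ := mem_iUnion₂.1 hx'
  obtain ⟨a, b, c, h⟩ := exists_isTriangle hK
  have hxi : x ∈ interior (convexHull ℝ (K : Set Plane)) := by
    by_contra hn
    refine hx K hK ?_
    rw [frontier, (isCompact_convexHull K).isClosed.closure_eq]
    exact ⟨hxK, hn⟩
  rw [(elemAffine hv hK).gradient_eq h hxi]
  exact (elemAffine hv hK).hasGradientAt h hxi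

/-- Integration by parts of `1 * v ^ 2`, with `1` the derivative of the first coordinate, leaves `2
x₀ v ∂v` up to sign. Young's inequality moves half of `v ^ 2` to the left. The zero extension of `v`
is Lipschitz, so there is no boundary term. -/
theorem poincare_of_bound (hΩ : IsConvexPolygonalDomain Ω) (hv : v ∈ 𝒯.trialSpace) {R : ℝ}
    (hR : ∀ x ∈ Ω, ‖x‖ ≤ R) : ∫ x in Ω, v x ^ 2 ≤ 4 * R ^ 2 * 𝒯.gradSq v := by
  obtain ⟨C, hC⟩ := exists_lipschitzWith_indicator hΩ hv
  set u := (closure Ω).indicator v with hu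
  obtain ⟨B, hB⟩ := hΩ.isCompact_closure.exists_bound_of_continuousOn hv.1
  have hB0 : ∀ x, |u x| ≤ max B 0 := by
    intro x
    by_cases hx : x ∈ closure Ω
    · rw [hu, indicator_of_mem hx]; exact (hB x hx).trans (le_max_left _ _)
    · rw [hu, indicator_of_notMem hx]; simp
  set g : Plane → ℝ := fun x => u x ^ 2 with hg
  have hgL : LipschitzWith (2 * (max B 0).toNNReal * C) g := by
    refine LipschitzWith.of_dist_le_mul fun x y => ?_
    have h1 := hC.dist_le_mul x y
    rw [Real.dist_eq] at h1 ⊢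
    have e : g x - g y = (u x + u y) * (u x - u y) := by simp only [hg]; ring
    have h2 : |u x + u y| ≤ 2 * max B 0 :=
      (abs_add_le _ _).trans (by linarith [hB0 x, hB0 y])
    rw [e, abs_mul, NNReal.coe_mul, NNReal.coe_mul, Real.coe_toNNReal _ (le_max_right _ _), mul_assoc _ (C : ℝ)]
    exact mul_le_mul h2 h1 (abs_nonneg _) (by positivity)
  have hgc : HasCompactSupport g := by
    refine HasCompactSupport.intro hΩ.isCompact_closure fun x hx => ?_
    simp [hg, hu, indicator_of_notMem hx]
  have hfL : LipschitzWith 1 (fun x : Plane => x 0) := by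
    refine LipschitzWith.of_dist_le_mul fun x y => ?_
    rw [NNReal.coe_one, one_mul, Real.dist_eq, dist_eq_norm]
    exact PiLp.norm_apply_le (x - y) 0
  set e : Plane := EuclideanSpace.single 0 1 with he
  have hen : ‖e‖ = 1 := by simp [he]
  have hibp := hfL.integral_lineDeriv_mul_eq (μ := volume) hgL hgc e
  have hf1 : ∀ x, lineDeriv ℝ (fun x : Plane => x 0) x e = 1 := by
    intro x
    have := ((EuclideanSpace.proj (𝕜 := ℝ) (0 : Fin 2)).hasFDerivAt (x := x)).hasLineDerivAt e
    simpa [he] using this.lineDeriv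
  have hL : ∫ x, lineDeriv ℝ (fun x : Plane => x 0) x e * g x = ∫ x in Ω, v x ^ 2 := by
    simp only [hf1, one_mul]
    rw [setIntegral_congr_set hΩ.ae_eq_closure,
      ← setIntegral_eq_integral_of_forall_compl_eq_zero (s := closure Ω)]
    · refine setIntegral_congr_fun isClosed_closure.measurableSet fun x hx => ?_
      simp [hg, hu, indicator_of_mem hx]
    · intro x hx
      simp [hg, hu, indicator_of_notMem hx]
  have hRs : ∫ x, lineDeriv ℝ g x (-e) * x 0 = ∫ x in Ω, lineDeriv ℝ g x (-e) * x 0 := by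
    rw [setIntegral_congr_set hΩ.ae_eq_closure,
      setIntegral_eq_integral_of_forall_compl_eq_zero]
    intro x hx
    have : g =ᶠ[nhds x] fun _ => 0 := by
      filter_upwards [isClosed_closure.isOpen_compl.mem_nhds hx] with z hz
      simp [hg, hu, indicator_of_notMem hz]
    rw [this.lineDeriv_eq]
    simp [lineDeriv]
  have hi1 : IntegrableOn (fun x => v x ^ 2) Ω := integrableOn_of_continuousOn hΩ (hv.1.pow 2)
  have hi2 : IntegrableOn (fun x => ‖gradient v x‖ ^ 2) Ω :=
    (integrableOn_gradient_sq hv).mono_set subset_closure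
  have hpt : ∀ᵐ x ∂volume.restrict Ω, |lineDeriv ℝ g x (-e) * x 0| ≤
      1 / 2 * v x ^ 2 + 2 * R ^ 2 * ‖gradient v x‖ ^ 2 := by
    filter_upwards [ae_hasGradientAt hΩ hv, ae_restrict_mem hΩ.isOpen.measurableSet] with x hx hxΩ
    have huv : u =ᶠ[nhds x] v := by
      filter_upwards [hΩ.isOpen.mem_nhds hxΩ] with z hz
      rw [hu, indicator_of_mem (subset_closure hz)]
    have h1 := ((hx.hasFDerivAt.congr_of_eventuallyEq huv).pow 2).hasLineDerivAt (-e)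
    have h2 : lineDeriv ℝ g x (-e) = 2 * v x * inner ℝ (gradient v x) (-e) := by
      rw [hg, h1.lineDeriv, huv.eq_of_nhds]
      simp
    have h3 : |inner ℝ (gradient v x) (-e)| ≤ ‖gradient v x‖ := by
      refine (abs_real_inner_le_norm _ _).trans ?_
      rw [norm_neg, hen, mul_one]
    have h4 : |x 0| ≤ R := (PiLp.norm_apply_le x 0).trans (hR x hxΩ)
    rw [h2, abs_mul, abs_mul, abs_mul, abs_two]
    have h5 : |inner ℝ (gradient v x) (-e)| * |x 0| ≤ ‖gradient v x‖ * R :=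
      mul_le_mul h3 h4 (abs_nonneg _) (norm_nonneg _)
    have h6 := mul_le_mul_of_nonneg_left h5 (abs_nonneg (v x))
    have h7 := sq_abs (v x)
    nlinarith [sq_nonneg (|v x| - 2 * (‖gradient v x‖ * R))]
  have hfin : ∫ x in Ω, v x ^ 2 ≤
      ∫ x in Ω, (1 / 2 * v x ^ 2 + 2 * R ^ 2 * ‖gradient v x‖ ^ 2) := by
    rw [← hL, hibp, hRs]
    refine (le_abs_self _).trans (abs_integral_le_integral_abs.trans ?_)
    exact integral_mono_of_nonneg (Filter.Eventually.of_forall fun x => abs_nonneg _)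
      ((hi1.const_mul _).add (hi2.const_mul _)) hpt
  rw [integral_add (hi1.const_mul _) (hi2.const_mul _), integral_const_mul, integral_const_mul,
    integral_gradient_sq hΩ hv] at hfin
  linarith

/-- The Poincaré inequality, with a constant that depends on the domain only. -/
theorem exists_poincare (hΩ : IsConvexPolygonalDomain Ω) : ∃ P : ℝ, 0 ≤ P ∧
    ∀ 𝒯 : TriMesh Ω, ∀ v ∈ 𝒯.trialSpace, ∫ x in Ω, v x ^ 2 ≤ P * 𝒯.gradSq v := by
  obtain ⟨R, hR⟩ := hΩ.isCompact_closure.isBounded.exists_norm_le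
  exact ⟨4 * R ^ 2, by positivity, fun 𝒯 v hv =>
    poincare_of_bound hΩ hv fun x hx => hR x (subset_closure hx)⟩

end TriMesh


/-! ### Bounds for the bilinear forms -/

theorem LipBound.mono {S T : Set Plane} {A : Plane → Matrix (Fin 2) (Fin 2) ℝ} {L B : ℝ}
    (h : LipBound T A L B) (hST : S ⊆ T) : LipBound S A L B :=
  ⟨fun x hx y hy => h.lip x (hST hx) y (hST hy), fun x hx => h.bdd x (hST hx), h.nonneg,
    h.bnonneg⟩

theorem IsDiffusionCoeff.exists_lipBound {Ω : Set Plane} (hΩ : IsConvexPolygonalDomain Ω)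
    {A : Plane → Matrix (Fin 2) (Fin 2) ℝ} (hA : IsDiffusionCoeff Ω A) :
    ∃ L B, LipBound (closure Ω) A L B := by
  choose l hl using hA.lipschitz
  have hb : ∀ i j, ∃ b, ∀ x ∈ closure Ω, ‖A x i j‖ ≤ b := fun i j =>
    hΩ.isCompact_closure.exists_bound_of_continuousOn (hl i j).continuousOn
  choose b hb using hb
  have hle : ∀ (f : Fin 2 → Fin 2 → ℝ) (i j), f i j ≤ ∑ i, ∑ j, |f i j| := fun f i j =>
    (le_abs_self _).trans ((Finset.single_le_sum (f := fun j => |f i j|)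
      (fun _ _ => abs_nonneg _) (Finset.mem_univ j)).trans
      (Finset.single_le_sum (f := fun i => ∑ j, |f i j|)
        (fun _ _ => Finset.sum_nonneg fun _ _ => abs_nonneg _) (Finset.mem_univ i)))
  refine ⟨∑ i, ∑ j, |(l i j : ℝ)|, ∑ i, ∑ j, |b i j|, ?_, ?_, ?_, ?_⟩
  · intro x hx y hy i j
    have h1 := (hl i j).dist_le_mul x hx y hy
    rw [Real.dist_eq, dist_eq_norm] at h1
    exact h1.trans (mul_le_mul_of_nonneg_right (hle (fun i j => (l i j : ℝ)) i j) (norm_nonneg _))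
  · intro x hx i j
    exact (hb i j x hx).trans (hle b i j)
  · exact Finset.sum_nonneg fun _ _ => Finset.sum_nonneg fun _ _ => abs_nonneg _
  · exact Finset.sum_nonneg fun _ _ => Finset.sum_nonneg fun _ _ => abs_nonneg _

namespace TriMesh

variable {Ω : Set Plane} {𝒯 : TriMesh Ω} {K : Finset Plane} {v w : Plane → ℝ}
  {A : Plane → Matrix (Fin 2) (Fin 2) ℝ} {q : Plane → ℝ} {L B ρ β : ℝ}

theorem barycenter_mem (hK : K ∈ 𝒯.triangles) : barycenter K ∈ closure Ω := by
  obtain ⟨a, b, c, h⟩ := exists_isTriangle hK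
  exact convexHull_subset hK (interior_subset h.barycenter_mem_interior)

theorem form_eq_sum (hΩ : IsConvexPolygonalDomain Ω) (hw : w ∈ 𝒯.trialSpace)
    (A : Plane → Matrix (Fin 2) (Fin 2) ℝ) (v : Plane → ℝ) :
    𝒯.form A v (𝒯.interpStar w) = ∑ K ∈ 𝒯.triangles, elemForm A K v w := by
  classical
  rw [form_eq hΩ hw, ← Finset.sum_neg_distrib]
  rfl

/-- The finite element form, with the coefficient frozen at the barycenters. -/
def frozenForm (𝒯 : TriMesh Ω) (A : Plane → Matrix (Fin 2) (Fin 2) ℝ) (v w : Plane → ℝ) : ℝ :=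
  ∑ K ∈ 𝒯.triangles, area K / (2 * refArea) *
    ((elemGrad K w).ofLp ⬝ᵥ (A (barycenter K) *ᵥ (elemGrad K v).ofLp))

theorem sum_area_mul_le (𝒯 : TriMesh Ω) (v w : Plane → ℝ) :
    ∑ K ∈ 𝒯.triangles, area K * (‖elemGrad K v‖ * ‖elemGrad K w‖) ≤
      Real.sqrt (𝒯.gradSq v) * Real.sqrt (𝒯.gradSq w) := by
  have := Real.sum_mul_le_sqrt_mul_sqrt 𝒯.triangles
    (fun K => Real.sqrt (area K) * ‖elemGrad K v‖) (fun K => Real.sqrt (area K) * ‖elemGrad K w‖)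
  simp only [mul_pow, Real.sq_sqrt (area_nonneg _)] at this
  refine le_trans (le_of_eq (Finset.sum_congr rfl fun K _ => ?_)) this
  rw [mul_mul_mul_comm, Real.mul_self_sqrt (area_nonneg _)]

/-- Of the three powers of `h` in the elementwise error, two are paid for the area of the triangle
by quasi-uniformity; one is left. -/
theorem abs_form_sub_frozenForm_le (hΩ : IsConvexPolygonalDomain Ω) (hρ : 0 < ρ)
    (hA : LipBound (closure Ω) A L B) (hq : 𝒯.IsQuasiUniform ρ)
    (hv : v ∈ 𝒯.trialSpace) (hw : w ∈ 𝒯.trialSpace) :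
    |𝒯.form A v (𝒯.interpStar w) - 𝒯.frozenForm A v w| ≤
      12 * L * shapeConst ρ * 𝒯.meshSize *
        (Real.sqrt (𝒯.gradSq v) * Real.sqrt (𝒯.gradSq w)) := by
  have hL := hA.nonneg
  have hh := 𝒯.meshSize_nonneg
  have hs := (shapeConst_pos hρ).le
  rw [form_eq_sum hΩ hw, frozenForm, ← Finset.sum_sub_distrib]
  refine (Finset.abs_sum_le_sum_abs _ _).trans (le_trans ?_
    (mul_le_mul_of_nonneg_left (𝒯.sum_area_mul_le v w) (by positivity)))
  rw [Finset.mul_sum]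
  refine Finset.sum_le_sum fun K hK => ?_
  obtain ⟨a, b, c, h⟩ := exists_isTriangle hK
  refine (abs_elemForm_sub_le h (hA.mono (convexHull_subset hK)) (elemAffine hv hK)
    (elemAffine hw hK) (diam_le_meshSize hK)).trans ?_
  have h2 := mul_le_mul_of_nonneg_left (sq_meshSize_le hρ hq hK)
    (by positivity : 0 ≤ 12 * L * 𝒯.meshSize * (‖elemGrad K v‖ * ‖elemGrad K w‖))
  calc 12 * L * 𝒯.meshSize ^ 3 * ‖elemGrad K v‖ * ‖elemGrad K w‖
      = 12 * L * 𝒯.meshSize * (‖elemGrad K v‖ * ‖elemGrad K w‖) * 𝒯.meshSize ^ 2 := by ring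
    _ ≤ _ := h2
    _ = _ := by ring

theorem frozenForm_comm (hA : IsDiffusionCoeff Ω A) : 𝒯.frozenForm A v w = 𝒯.frozenForm A w v := by
  refine Finset.sum_congr rfl fun K hK => ?_
  have h := hA.symm _ (barycenter_mem hK)
  congr 1
  rw [dotProduct_comm, ← Matrix.vecMul_transpose, h.eq, Matrix.dotProduct_mulVec]

/-- Both forms are compared with the same symmetric frozen form, which doubles the constant. -/
theorem abs_form_sub_form_le (hΩ : IsConvexPolygonalDomain Ω) (hρ : 0 < ρ)
    (hA' : IsDiffusionCoeff Ω A) (hA : LipBound (closure Ω) A L B) (hq : 𝒯.IsQuasiUniform ρ)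
    (hv : v ∈ 𝒯.trialSpace) (hw : w ∈ 𝒯.trialSpace) :
    |𝒯.form A v (𝒯.interpStar w) - 𝒯.form A w (𝒯.interpStar v)| ≤
      24 * L * shapeConst ρ * 𝒯.meshSize *
        (Real.sqrt (𝒯.gradSq v) * Real.sqrt (𝒯.gradSq w)) := by
  have h1 := abs_le.1 (abs_form_sub_frozenForm_le hΩ hρ hA hq hv hw)
  have h2 := abs_le.1 (abs_form_sub_frozenForm_le hΩ hρ hA hq hw hv)
  rw [frozenForm_comm hA', mul_comm (Real.sqrt (𝒯.gradSq w))] at h2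
  rw [abs_le]
  constructor <;> linarith [h1.1, h1.2, h2.1, h2.2]

theorem le_frozenForm (hβ : ∀ x ∈ closure Ω, ∀ ξ : Fin 2 → ℝ, β * (ξ ⬝ᵥ ξ) ≤ ξ ⬝ᵥ (A x *ᵥ ξ)) :
    β / (2 * refArea) * 𝒯.gradSq v ≤ 𝒯.frozenForm A v v := by
  rw [gradSq, frozenForm, Finset.mul_sum]
  refine Finset.sum_le_sum fun K hK => ?_
  have h1 := hβ _ (barycenter_mem hK) (elemGrad K v).ofLp
  have h2 : (elemGrad K v).ofLp ⬝ᵥ (elemGrad K v).ofLp = ‖elemGrad K v‖ ^ 2 := by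
    rw [EuclideanSpace.norm_sq_eq, dotProduct]
    simp [pow_two]
  rw [h2] at h1
  have h3 : 0 ≤ area K / (2 * refArea) := div_nonneg (area_nonneg K) (by linarith [refArea_pos])
  calc _ = area K / (2 * refArea) * (β * ‖elemGrad K v‖ ^ 2) := by ring
    _ ≤ _ := mul_le_mul_of_nonneg_left h1 h3

theorem frozenForm_le (hA : LipBound (closure Ω) A L B) :
    𝒯.frozenForm A v v ≤ 2 * B / refArea * 𝒯.gradSq v := by
  rw [gradSq, frozenForm, Finset.mul_sum]
  refine Finset.sum_le_sum fun K hK => ?_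
  have h1 := (le_abs_self _).trans (abs_dotProduct_mulVec_le (hA.bdd _ (barycenter_mem hK))
    (elemGrad K v) (elemGrad K v))
  have h3 : 0 ≤ area K / (2 * refArea) := div_nonneg (area_nonneg K) (by linarith [refArea_pos])
  refine (mul_le_mul_of_nonneg_left h1 h3).trans (le_of_eq ?_)
  have := refArea_pos.ne'
  field_simp
  ring

theorem le_form (hΩ : IsConvexPolygonalDomain Ω) (hρ : 0 < ρ)
    (hA : LipBound (closure Ω) A L B)
    (hβ : ∀ x ∈ closure Ω, ∀ ξ : Fin 2 → ℝ, β * (ξ ⬝ᵥ ξ) ≤ ξ ⬝ᵥ (A x *ᵥ ξ))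
    (hq : 𝒯.IsQuasiUniform ρ) (hv : v ∈ 𝒯.trialSpace) :
    (β / (2 * refArea) - 12 * L * shapeConst ρ * 𝒯.meshSize) * 𝒯.gradSq v ≤
      𝒯.form A v (𝒯.interpStar v) := by
  have h1 := abs_le.1 (abs_form_sub_frozenForm_le hΩ hρ hA hq hv hv)
  rw [Real.mul_self_sqrt (𝒯.gradSq_nonneg v)] at h1
  have h2 := le_frozenForm (𝒯 := 𝒯) (v := v) hβ
  linarith [h1.1]

theorem form_le (hΩ : IsConvexPolygonalDomain Ω) (hρ : 0 < ρ)
    (hA : LipBound (closure Ω) A L B)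
    (hq : 𝒯.IsQuasiUniform ρ) (hv : v ∈ 𝒯.trialSpace) :
    𝒯.form A v (𝒯.interpStar v) ≤
      (2 * B / refArea + 12 * L * shapeConst ρ * 𝒯.meshSize) * 𝒯.gradSq v := by
  have h1 := abs_le.1 (abs_form_sub_frozenForm_le hΩ hρ hA hq hv hv)
  rw [Real.mul_self_sqrt (𝒯.gradSq_nonneg v)] at h1
  have h2 := frozenForm_le (𝒯 := 𝒯) (v := v) hA
  linarith [h1.2]

/-- The reaction form is nonnegative up to a perturbation of the order of the mesh size. -/
theorem le_reaction (hΩ : IsConvexPolygonalDomain Ω) (hq0 : ∀ x ∈ closure Ω, 0 ≤ q x)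
    {L : NNReal} (hqL : LipschitzOnWith L q (closure Ω)) (hv : v ∈ 𝒯.trialSpace) :
    -(3 * L * 𝒯.meshSize * 𝒯.vertSq v) ≤ l2Inner Ω (fun x => q x * v x) (𝒯.interpStar v) := by
  have hqv : IntegrableOn (fun x => q x * v x) Ω :=
    integrableOn_of_continuousOn hΩ (hqL.continuousOn.mul hv.1)
  have hvi : IntegrableOn v Ω := integrableOn_of_continuousOn hΩ hv.1
  have hh := 𝒯.meshSize_nonneg
  rw [integral_mul_interpStar hΩ hv hqv, vertSq, Finset.mul_sum, ← Finset.sum_neg_distrib]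
  refine Finset.sum_le_sum fun K hK => ?_
  set s := ∑ z ∈ K, v z ^ 2 with hs
  have hs0 : 0 ≤ s := Finset.sum_nonneg fun z _ => sq_nonneg _
  set k := q (barycenter K)
  have hk : 0 ≤ k := hq0 _ (barycenter_mem hK)
  -- With `q` replaced by its value `k ≥ 0` at the barycenter, the local form is `k` times a
  -- nonnegative mass form. The Lipschitz error follows in `herr`.
  have hmain : 0 ≤ ∑ z ∈ K, v z * ∫ x in dualCell K z, v x := by
    have e : ∀ z ∈ K, v z * ∫ x in dualCell K z, v x = area K *
        ((refMass₀ - refMass₁) / refArea * v z ^ 2 + refMass₁ / refArea * (∑ z ∈ K, v z) * v z) := by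
      intro z hz
      obtain ⟨b, c, h⟩ := exists_isTriangle_of_mem hK hz
      rw [setIntegral_dualCell_eq h (elemAffine hv hK)]
      ring
    rw [Finset.sum_congr rfl e, ← Finset.mul_sum, Finset.sum_add_distrib, ← Finset.mul_sum,
      ← Finset.mul_sum]
    have h1 : 0 ≤ refMass₁ / refArea := div_nonneg refMass₁_nonneg refArea_pos.le
    have h2 := mul_nonneg h1 (mul_self_nonneg (∑ z ∈ K, v z))
    have h3 := mul_nonneg massConst_pos.le hs0
    exact mul_nonneg (area_nonneg K) (by linarith)
  have herr : ∀ z ∈ K, k * (v z * ∫ x in dualCell K z, v x) - L * 𝒯.meshSize * s * area K ≤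
      v z * ∫ x in dualCell K z, q x * v x := by
    intro z hz
    obtain ⟨b, c, h⟩ := exists_isTriangle_of_mem hK hz
    have hsub := dualCell_subset hK hz
    have i1 : IntegrableOn v (dualCell K z) := (integrableOn_convexHull hΩ hK hvi).mono_set hsub
    have i2 : IntegrableOn (fun x => q x * v x) (dualCell K z) :=
      (integrableOn_convexHull hΩ hK hqv).mono_set hsub
    have e : v z * (∫ x in dualCell K z, q x * v x) - k * (v z * ∫ x in dualCell K z, v x) =
        ∫ x in dualCell K z, v z * ((q x - k) * v x) := by
      rw [integral_const_mul]
      simp only [sub_mul]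
      rw [integral_sub i2 (i1.const_mul k), integral_const_mul]
      ring
    have hvol : volume (dualCell K z) < ⊤ :=
      (measure_mono hsub).trans_lt (isCompact_convexHull K).measure_lt_top
    have hb := norm_setIntegral_le_of_norm_le_const (f := fun x => v z * ((q x - k) * v x))
      (C := L * 𝒯.meshSize * s) hvol (fun x hx => by
        have hxK := hsub hx
        have hbK := interior_subset h.barycenter_mem_interior
        have h1 : |q x - k| ≤ L * 𝒯.meshSize := by
          have := hqL.dist_le_mul x (convexHull_subset hK hxK) _ (barycenter_mem hK)
          rw [Real.dist_eq] at this
          refine this.trans (mul_le_mul_of_nonneg_left ?_ L.coe_nonneg)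
          exact (Metric.dist_le_diam_of_mem (isCompact_convexHull K).isBounded hxK hbK).trans
            (diam_le_meshSize hK)
        have h2 : |v z * v x| ≤ s := by
          have hx2 := (elemAffine hv hK).sq_le hxK
          have hz2 := Finset.single_le_sum (f := fun z => v z ^ 2) (fun z _ => sq_nonneg _) hz
          rw [abs_le]
          constructor <;> nlinarith [sq_nonneg (v z + v x), sq_nonneg (v z - v x)]
        rw [Real.norm_eq_abs]
        calc |v z * ((q x - k) * v x)| = |q x - k| * |v z * v x| := by
              rw [← abs_mul]; congr 1; ring
          _ ≤ _ := mul_le_mul h1 h2 (abs_nonneg _) (by positivity))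
    rw [← e, Real.norm_eq_abs] at hb
    have h3 : volume.real (dualCell K z) ≤ area K := measureReal_dualCell_le h
    have h4 := mul_le_mul_of_nonneg_left h3 (by positivity : 0 ≤ L * 𝒯.meshSize * s)
    linarith [(abs_le.1 hb).1]
  have h5 := Finset.sum_le_sum herr
  rw [Finset.sum_sub_distrib, ← Finset.mul_sum, Finset.sum_const, 𝒯.card_eq_three K hK,
    nsmul_eq_mul] at h5
  have h6 := mul_nonneg hk hmain
  push_cast at h5
  linarith

/-! ### The energy norm -/

theorem h1Norm_nonneg (Ω : Set Plane) (v : Plane → ℝ) : 0 ≤ h1Norm Ω v := Real.sqrt_nonneg _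

theorem sq_l2Norm (Ω : Set Plane) (v : Plane → ℝ) : l2Norm Ω v ^ 2 = ∫ x in Ω, v x ^ 2 :=
  Real.sq_sqrt (integral_nonneg fun _ => sq_nonneg _)

theorem sq_h1Norm (hΩ : IsConvexPolygonalDomain Ω) (hv : v ∈ 𝒯.trialSpace) :
    h1Norm Ω v ^ 2 = (∫ x in Ω, v x ^ 2) + 𝒯.gradSq v := by
  rw [h1Norm, integral_gradient_sq hΩ hv]
  exact Real.sq_sqrt (add_nonneg (integral_nonneg fun _ => sq_nonneg _) (𝒯.gradSq_nonneg v))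

theorem integral_sq_nonneg (Ω : Set Plane) (v : Plane → ℝ) : 0 ≤ ∫ x in Ω, v x ^ 2 :=
  integral_nonneg fun _ => sq_nonneg _

theorem sqrt_gradSq_le (hΩ : IsConvexPolygonalDomain Ω) (hv : v ∈ 𝒯.trialSpace) :
    Real.sqrt (𝒯.gradSq v) ≤ h1Norm Ω v := by
  rw [h1Norm, integral_gradient_sq hΩ hv]
  exact Real.sqrt_le_sqrt (le_add_of_nonneg_left (integral_sq_nonneg Ω v))

/-- The inverse inequality for the energy norm. -/
theorem sq_meshSize_mul_sq_h1Norm_le (hΩ : IsConvexPolygonalDomain Ω) (hρ : 0 < ρ)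
    (hq : 𝒯.IsQuasiUniform ρ) (h1 : 𝒯.meshSize ≤ 1) (hv : v ∈ 𝒯.trialSpace) :
    𝒯.meshSize ^ 2 * h1Norm Ω v ^ 2 ≤ (1 + 16 / ρ ^ 2) * 𝒯.vertSq v := by
  have h2 := inverse_inequality hρ hq hv
  have h3 := integral_sq_le hΩ hv
  have hh := 𝒯.meshSize_nonneg
  have h4 : 𝒯.meshSize ^ 2 * ∫ x in Ω, v x ^ 2 ≤ 1 * 𝒯.vertSq v :=
    mul_le_mul (by nlinarith) h3 (integral_sq_nonneg Ω v) zero_le_one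
  rw [sq_h1Norm hΩ hv]
  linarith

end TriMesh


/-! ### The L1 formula -/

/-- Consecutive slopes of the concave function `x ↦ x ^ (1 - α)` decrease. -/
theorem l1b_succ_le {α : ℝ} (h0 : 0 < α) (h1 : α < 1) (k : ℕ) : l1b α (k + 1) ≤ l1b α k := by
  have hc := Real.concaveOn_rpow (p := 1 - α) (by linarith) (by linarith)
  have hk : (0 : ℝ) ≤ k := Nat.cast_nonneg k
  have := hc.slope_anti_adjacent (x := (k : ℝ)) (y := k + 1) (z := k + 2)
    (by simp) (by simp; linarith) (by linarith) (by linarith)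
  simp only [l1b]
  push_cast
  have e1 : (k : ℝ) + 2 - (k + 1) = 1 := by ring
  have e2 : (k : ℝ) + 1 - k = 1 := by ring
  have e3 : (k : ℝ) + 1 + 1 = k + 2 := by ring
  rw [e1, e2, div_one, div_one] at this
  rw [e3]; exact this

theorem l1Coeff_nonpos {α : ℝ} (h0 : 0 < α) (h1 : α < 1) {n k : ℕ} (hk : k < n) :
    l1Coeff α n k ≤ 0 := by
  rw [l1Coeff, if_neg hk.ne]
  split_ifs with hk0
  · have hn : (1 : ℝ) ≤ n := by exact_mod_cast (by omega : 1 ≤ n)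
    have := Real.rpow_le_rpow (by linarith : (0 : ℝ) ≤ n - 1) (by linarith : (n : ℝ) - 1 ≤ n)
      (by linarith : 0 ≤ 1 - α)
    linarith
  · obtain ⟨m, hm⟩ : ∃ m, n - k = m + 1 := ⟨n - k - 1, by omega⟩
    rw [hm, Nat.add_sub_cancel]
    linarith [l1b_succ_le h0 h1 m]

/-- The terms with `k ≥ 1` telescope to `l1b α 0 - l1b α (n - 1)`, the term `k = 0` is `l1b α (n -
1)`, and `l1b α 0 = 1`. With the sign of the coefficients, the history term is a convex combination.
-/
theorem sum_neg_l1Coeff {α : ℝ} (h1 : α < 1) {n : ℕ} (hn : 1 ≤ n) :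
    ∑ k ∈ Finset.range n, -l1Coeff α n k = 1 := by
  obtain ⟨m, rfl⟩ := Nat.exists_eq_add_of_le' hn
  rw [Finset.sum_range_succ']
  have e : ∀ k ∈ Finset.range m, -l1Coeff α (m + 1) (k + 1) =
      l1b α (m - (k + 1)) - l1b α (m - k) := by
    intro k hk
    have hk' := Finset.mem_range.1 hk
    rw [l1Coeff, if_neg (by omega), if_neg (by omega)]
    have e1 : m + 1 - (k + 1) = m - k := by omega
    have e2 : m - k - 1 = m - (k + 1) := by omega
    rw [e1, e2]; ring
  rw [Finset.sum_congr rfl e, Finset.sum_range_sub (fun k => l1b α (m - k))]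
  rw [l1Coeff, if_neg (by omega), if_pos rfl]
  simp only [l1b, Nat.sub_self, Nat.sub_zero]
  push_cast
  rw [zero_add, Real.one_rpow, Real.zero_rpow (by linarith)]
  have e3 : (m : ℝ) + 1 - 1 = m := by ring
  rw [e3]; ring

/-- The discrete maximum principle of the L1 formula. -/
theorem le_max_of_l1_inequality {α : ℝ} (h0 : 0 < α) (h1 : α < 1) {E : ℕ → ℝ} {σ B : ℝ}
    (hσ : 0 ≤ σ) {N : ℕ}
    (h : ∀ n, 1 ≤ n → n ≤ N →
      E n + σ * E n ≤ ∑ k ∈ Finset.range n, -l1Coeff α n k * E k + σ * B) :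
    ∀ n ≤ N, E n ≤ max (E 0) B := by
  intro n
  induction n using Nat.strong_induction_on with
  | _ n ih =>
    intro hn
    rcases Nat.eq_zero_or_pos n with rfl | hpos
    · exact le_max_left _ _
    have h2 : ∑ k ∈ Finset.range n, -l1Coeff α n k * E k ≤
        ∑ k ∈ Finset.range n, -l1Coeff α n k * max (E 0) B := by
      refine Finset.sum_le_sum fun k hk => ?_
      have hk' := Finset.mem_range.1 hk
      exact mul_le_mul_of_nonneg_left (ih k hk' (by omega))
        (neg_nonneg.2 (l1Coeff_nonpos h0 h1 hk'))
    rw [← Finset.sum_mul, sum_neg_l1Coeff h1 hpos, one_mul] at h2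
    have h3 := h n hpos hn
    have h4 := mul_le_mul_of_nonneg_left (le_max_right (E 0) B) hσ
    by_contra hlt
    have h5 := mul_le_mul_of_nonneg_left (not_le.1 hlt).le hσ
    linarith [not_le.1 hlt]

/-! ### Abstract stability of L1 schemes -/

section Abstract

variable {W : Type*} [AddCommGroup W] [Module ℝ W]

/-- The energy inequality of the L1 formula. -/
theorem l1_energy {α : ℝ} (h0 : 0 < α) (h1 : α < 1) (S : W →ₗ[ℝ] W →ₗ[ℝ] ℝ)
    (hsymm : ∀ v w, S v w = S w v) (hpos : ∀ v, 0 ≤ S v v) (u : ℕ → W) {n : ℕ} (hn : 1 ≤ n) :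
    S (u n) (u n) - ∑ k ∈ Finset.range n, -l1Coeff α n k * S (u k) (u k) ≤
      2 * S (u n) (∑ k ∈ Finset.range (n + 1), l1Coeff α n k • u k) := by
  have hnn : l1Coeff α n n = 1 := by simp [l1Coeff]
  rw [Finset.sum_range_succ, hnn, one_smul, map_add, map_sum]
  have h2 : ∀ k ∈ Finset.range n, -l1Coeff α n k * (-S (u n) (u n) - S (u k) (u k)) ≤
      2 * S (u n) (l1Coeff α n k • u k) := by
    intro k hk
    -- Nonnegativity at `u n - u k` gives `2 S(u n, u k) ≤ S(u n, u n) + S(u k, u k)`. Weighted with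
    -- `-l1Coeff α n k` and summed, the terms in `u n` add up to one copy, since the weights have
    -- sum one.
    have h3 := hpos (u n - u k)
    simp only [map_sub, LinearMap.sub_apply] at h3
    rw [hsymm (u k) (u n)] at h3
    have h4 := mul_nonneg (neg_nonneg.2 (l1Coeff_nonpos h0 h1 (Finset.mem_range.1 hk))) h3
    rw [map_smul, smul_eq_mul]
    nlinarith
  have h5 := Finset.sum_le_sum h2
  rw [← Finset.mul_sum] at h5
  simp only [mul_sub, mul_neg, Finset.sum_sub_distrib, Finset.sum_neg_distrib] at h5
  rw [← Finset.sum_mul] at h5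
  have h6 := sum_neg_l1Coeff (α := α) h1 hn
  rw [Finset.sum_neg_distrib] at h6
  have h7 : ∑ k ∈ Finset.range n, l1Coeff α n k = -1 := by linarith
  simp only [neg_mul, Finset.sum_neg_distrib] at h5 ⊢
  rw [h7] at h5
  linarith

theorem two_mul_le_of_sq_le {x p q ε : ℝ} (hp : 0 ≤ p) (hq : 0 ≤ q) (hε : 0 < ε)
    (h : x ^ 2 ≤ p * q) : 2 * |x| ≤ ε * p + q / ε := by
  have h1 : 0 ≤ ε * p + q / ε := by positivity
  have h2 : (2 * |x|) ^ 2 ≤ (ε * p + q / ε) ^ 2 := by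
    have e : (ε * p + q / ε) ^ 2 = (ε * p - q / ε) ^ 2 + 4 * (p * q) := by
      field_simp; ring
    rw [e, mul_pow, sq_abs]
    nlinarith [sq_nonneg (ε * p - q / ε)]
  exact abs_le_of_sq_le_sq' h2 h1 |>.2

/-- The forms and constants of a finite volume element method with the L1 formula in time.
`M`, `a`, `Q` stand for the mass, diffusion and reaction forms and `H` for the squared energy
norm. -/
structure StableForms (M a Q : W →ₗ[ℝ] W →ₗ[ℝ] ℝ) (H : W → ℝ) (γ μ Cm Ca Ce Cq : ℝ) : Prop where
  γ_pos : 0 < γ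
  μ_pos : 0 < μ
  Cm_pos : 0 < Cm
  Ca_nonneg : 0 ≤ Ca
  Ce_nonneg : 0 ≤ Ce
  Cq_nonneg : 0 ≤ Cq
  H_nonneg : ∀ v, 0 ≤ H v
  M_symm : ∀ v w, M v w = M w v
  M_nonneg : ∀ v, 0 ≤ M v v
  M_le : ∀ v, M v v ≤ Cm * H v
  coercive : ∀ v, γ * H v ≤ a v v + Q v v
  le_a : ∀ v, μ * H v ≤ a v v
  a_le : ∀ v, a v v ≤ Ca * H v
  asymm : ∀ v w, (a v w - a w v) ^ 2 ≤ Ce * H v * M w w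
  Q_le : ∀ v w, Q v w ^ 2 ≤ Cq * H v * M w w

namespace StableForms

variable {M a Q : W →ₗ[ℝ] W →ₗ[ℝ] ℝ} {H : W → ℝ} {γ μ Cm Ca Ce Cq α c R : ℝ} {N : ℕ}
  {u : ℕ → W} {ℓ : ℕ → W → ℝ}

/-- Testing with the solution. -/
theorem energy_mass (h : StableForms M a Q H γ μ Cm Ca Ce Cq) (h0 : 0 < α) (h1 : α < 1)
    (hc : 0 < c) (hR : 0 ≤ R) {n : ℕ} (hn : 1 ≤ n)
    (hℓ : ∀ w, ℓ n w ^ 2 ≤ R * M w w)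
    (hs : ∀ w, M (c • ∑ k ∈ Finset.range (n + 1), l1Coeff α n k • u k) w + a (u n) w + Q (u n) w =
      ℓ n w) :
    c * (M (u n) (u n) - ∑ k ∈ Finset.range n, -l1Coeff α n k * M (u k) (u k)) + γ * H (u n) ≤
      R * Cm / γ := by
  have e1 := l1_energy h0 h1 M h.M_symm h.M_nonneg u hn
  have e2 := hs (u n)
  rw [h.M_symm, map_smul, smul_eq_mul] at e2
  have hγ := h.γ_pos
  have hCm := h.Cm_pos
  have e3 : ℓ n (u n) ^ 2 ≤ H (u n) * (R * Cm) := by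
    refine (hℓ (u n)).trans ?_
    have := mul_le_mul_of_nonneg_left (h.M_le (u n)) hR
    linarith
  have e4 := two_mul_le_of_sq_le (h.H_nonneg _) (mul_nonneg hR hCm.le) hγ e3
  have e5 := le_abs_self (ℓ n (u n))
  have e6 := h.coercive (u n)
  have e7 := mul_le_mul_of_nonneg_left e1 hc.le
  linarith

/-- Testing with the discrete fractional derivative of the solution. -/
theorem energy_diffusion (h : StableForms M a Q H γ μ Cm Ca Ce Cq) (h0 : 0 < α) (h1 : α < 1)
    (hc : 0 < c) (hR : 0 ≤ R) {n : ℕ} (hn : 1 ≤ n)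
    (hℓ : ∀ w, ℓ n w ^ 2 ≤ R * M w w)
    (hs : ∀ w, M (c • ∑ k ∈ Finset.range (n + 1), l1Coeff α n k • u k) w + a (u n) w + Q (u n) w =
      ℓ n w) :
    c * (a (u n) (u n) - ∑ k ∈ Finset.range n, -l1Coeff α n k * a (u k) (u k)) ≤
      (Ce / 2 + 2 * Cq) * H (u n) + 2 * R := by
  -- The L1 energy inequality needs symmetry, so it is applied to the symmetric part of `a`, which
  -- has the same diagonal.
  set S : W →ₗ[ℝ] W →ₗ[ℝ] ℝ := (1 / 2 : ℝ) • (a + a.flip) with hS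
  have hSapp : ∀ v w, S v w = (a v w + a w v) / 2 := by
    intro v w; simp [hS]; ring
  have hSd : ∀ v, S v v = a v v := by intro v; rw [hSapp]; ring
  have e1 := l1_energy h0 h1 S (fun v w => by rw [hSapp, hSapp]; ring)
    (fun v => by
      rw [hSd]; exact (mul_nonneg h.μ_pos.le (h.H_nonneg v)).trans (h.le_a v)) u hn
  simp only [hSd] at e1
  have e2 := mul_le_mul_of_nonneg_left e1 hc.le
  set D := ∑ k ∈ Finset.range (n + 1), l1Coeff α n k • u k
  set w := c • D with hw
  have e3 : c * (2 * S (u n) D) = a (u n) w + a w (u n) := by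
    have : S (u n) w = c * S (u n) D := by rw [hw, map_smul, smul_eq_mul]
    rw [← mul_assoc, mul_comm c, mul_assoc, ← this, hSapp]; ring
  have e4 := hs w
  have hH := h.H_nonneg (u n)
  have hM := h.M_nonneg w
  -- The tested scheme supplies `-2 M w w`. Asymmetry, reaction and source each cost `M w w / 2`
  -- with these weights, so the sum stays nonpositive.
  have y1 := two_mul_le_of_sq_le (mul_nonneg h.Ce_nonneg hH) hM (ε := 1) one_pos (h.asymm (u n) w)
  have y2 := two_mul_le_of_sq_le (mul_nonneg h.Cq_nonneg hH) hM (ε := 2) two_pos (h.Q_le (u n) w)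
  have y3 := two_mul_le_of_sq_le hR hM (ε := 2) two_pos (hℓ w)
  have z1 := neg_abs_le (a (u n) w - a w (u n))
  have z2 := neg_abs_le (Q (u n) w)
  have z3 := le_abs_self (ℓ n w)
  rw [div_one] at y1
  linarith

/-- Since `H` dominates `M / Cm`, the coercive term in `energy_mass` becomes the damping of the
maximum principle; `B` is the level at which damping balances the source. -/
theorem mass_stability (h : StableForms M a Q H γ μ Cm Ca Ce Cq) (h0 : 0 < α) (h1 : α < 1)
    (hc : 0 < c) (hR : 0 ≤ R)
    (hℓ : ∀ n, 1 ≤ n → n ≤ N → ∀ w, ℓ n w ^ 2 ≤ R * M w w)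
    (hs : ∀ n, 1 ≤ n → n ≤ N → ∀ w,
      M (c • ∑ k ∈ Finset.range (n + 1), l1Coeff α n k • u k) w + a (u n) w + Q (u n) w = ℓ n w)
    {n : ℕ} (hn : n ≤ N) :
    M (u n) (u n) ≤ M (u 0) (u 0) + R * Cm ^ 2 / γ ^ 2 := by
  have hγ := h.γ_pos
  have hCm := h.Cm_pos
  have key := le_max_of_l1_inequality h0 h1 (E := fun k => M (u k) (u k)) (σ := γ / (c * Cm))
    (B := R * Cm ^ 2 / γ ^ 2) (by positivity) (N := N) (fun n hn1 hnN => by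
      have e1 := h.energy_mass h0 h1 hc hR hn1 (hℓ n hn1 hnN) (hs n hn1 hnN)
      have e2 : γ / Cm * M (u n) (u n) ≤ γ * H (u n) := by
        rw [div_mul_eq_mul_div, div_le_iff₀ hCm]
        nlinarith [mul_le_mul_of_nonneg_left (h.M_le (u n)) hγ.le]
      refine le_of_mul_le_mul_left ?_ hc
      have e3 : c * (M (u n) (u n) + γ / (c * Cm) * M (u n) (u n)) =
          c * M (u n) (u n) + γ / Cm * M (u n) (u n) := by field_simp
      have e4 : c * (∑ k ∈ Finset.range n, -l1Coeff α n k * M (u k) (u k) +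
          γ / (c * Cm) * (R * Cm ^ 2 / γ ^ 2)) =
          c * ∑ k ∈ Finset.range n, -l1Coeff α n k * M (u k) (u k) + R * Cm / γ := by field_simp
      rw [e3, e4]
      linarith) n hn
  refine key.trans (max_le ?_ ?_)
  · linarith [(by positivity : 0 ≤ R * Cm ^ 2 / γ ^ 2)]
  · linarith [h.M_nonneg (u 0)]

/-- `Λ` is chosen so that `Λ γ H` from the mass estimate covers the growth term of the diffusion
estimate and leaves `γ H` over. That remainder damps the combined energy `Λ M + a`, which is at most
`Y H`. -/
theorem energy_stability (h : StableForms M a Q H γ μ Cm Ca Ce Cq) (h0 : 0 < α) (h1 : α < 1)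
    (hc : 0 < c) (hR : 0 ≤ R)
    (hℓ : ∀ n, 1 ≤ n → n ≤ N → ∀ w, ℓ n w ^ 2 ≤ R * M w w)
    (hs : ∀ n, 1 ≤ n → n ≤ N → ∀ w,
      M (c • ∑ k ∈ Finset.range (n + 1), l1Coeff α n k • u k) w + a (u n) w + Q (u n) w = ℓ n w)
    {Λ : ℝ} (hΛ : Λ = (Ce / 2 + 2 * Cq + γ) / γ) {n : ℕ} (hn : n ≤ N) :
    μ * H (u n) ≤ (Λ * Cm + Ca) * H (u 0) + R * ((Λ * Cm / γ + 2) * (Λ * Cm + Ca) / γ) := by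
  have hγ := h.γ_pos
  have hCm := h.Cm_pos
  have hCa := h.Ca_nonneg
  have hCe := h.Ce_nonneg
  have hCq := h.Cq_nonneg
  have hΛ0 : 0 < Λ := by rw [hΛ]; positivity
  have hΛγ : Λ * γ = Ce / 2 + 2 * Cq + γ := by rw [hΛ]; field_simp
  set Y := Λ * Cm + Ca with hY
  have hY0 : 0 < Y := by positivity
  have ha0 : ∀ v, 0 ≤ a v v := fun v =>
    (mul_nonneg h.μ_pos.le (h.H_nonneg v)).trans (h.le_a v)
  have hE : ∀ v, Λ * M v v + a v v ≤ Y * H v := fun v => by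
    have := mul_le_mul_of_nonneg_left (h.M_le v) hΛ0.le
    have := h.a_le v
    rw [hY]; linarith
  have key := le_max_of_l1_inequality h0 h1 (E := fun k => Λ * M (u k) (u k) + a (u k) (u k))
    (σ := γ / (c * Y)) (B := R * ((Λ * Cm / γ + 2) * Y / γ)) (by positivity) (N := N)
    (fun n hn1 hnN => by
      have e1 := h.energy_mass h0 h1 hc hR hn1 (hℓ n hn1 hnN) (hs n hn1 hnN)
      have e2 := h.energy_diffusion h0 h1 hc hR hn1 (hℓ n hn1 hnN) (hs n hn1 hnN)
      have e3 : γ / Y * (Λ * M (u n) (u n) + a (u n) (u n)) ≤ γ * H (u n) := by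
        rw [div_mul_eq_mul_div, div_le_iff₀ hY0]
        nlinarith [mul_le_mul_of_nonneg_left (hE (u n)) hγ.le]
      refine le_of_mul_le_mul_left ?_ hc
      have e4 : c * ((Λ * M (u n) (u n) + a (u n) (u n)) +
          γ / (c * Y) * (Λ * M (u n) (u n) + a (u n) (u n))) =
          c * (Λ * M (u n) (u n) + a (u n) (u n)) +
          γ / Y * (Λ * M (u n) (u n) + a (u n) (u n)) := by field_simp
      have e5 : ∑ k ∈ Finset.range n, -l1Coeff α n k * (Λ * M (u k) (u k) + a (u k) (u k)) =
          Λ * ∑ k ∈ Finset.range n, -l1Coeff α n k * M (u k) (u k) +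
            ∑ k ∈ Finset.range n, -l1Coeff α n k * a (u k) (u k) := by
        rw [Finset.mul_sum, ← Finset.sum_add_distrib]
        exact Finset.sum_congr rfl fun k _ => by ring
      have e6 : c * (γ / (c * Y) * (R * ((Λ * Cm / γ + 2) * Y / γ))) =
          Λ * (R * Cm / γ) + 2 * R := by field_simp
      rw [e4, e5, mul_add c _ (γ / (c * Y) * _), e6]
      have e7 := mul_le_mul_of_nonneg_left e1 hΛ0.le
      have e8 : Λ * (γ * H (u n)) = (Ce / 2 + 2 * Cq + γ) * H (u n) := by rw [← hΛγ]; ring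
      linarith) n hn
  -- The combined energy controls `H` through its part `a` alone.
  have h2 := (h.le_a (u n)).trans (le_add_of_nonneg_left (mul_nonneg hΛ0.le (h.M_nonneg (u n))))
  refine h2.trans (key.trans (max_le ?_ ?_))
  · have := hE (u 0)
    linarith [(by positivity : 0 ≤ R * ((Λ * Cm / γ + 2) * Y / γ))]
  · linarith [mul_nonneg hY0.le (h.H_nonneg (u 0))]

end StableForms

end Abstract


namespace TriMesh

variable {Ω : Set Plane} {𝒯 : TriMesh Ω} {v w F G : Plane → ℝ}

/-! ### The forms of the method as bilinear maps on the trial space -/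

/-- The trial space as a vector space. -/
def trialSubmodule (𝒯 : TriMesh Ω) : Submodule ℝ (Plane → ℝ) where
  carrier := 𝒯.trialSpace
  add_mem' := fun {v w} hv hw => ⟨hv.1.add hw.1, fun x hx => by simp [hv.2.1 x hx, hw.2.1 x hx],
    fun K hK => ElemAffine.add (elemAffine hv hK) (elemAffine hw hK)⟩
  zero_mem' := ⟨continuousOn_const, fun _ _ => rfl, fun _ _ => ⟨0, fun _ _ => rfl⟩⟩
  smul_mem' := fun r v hv => ⟨hv.1.const_smul r, fun x hx => by simp [hv.2.1 x hx],
    fun K hK => ElemAffine.smul (elemAffine hv hK) r⟩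

theorem coe_mem (v : 𝒯.trialSubmodule) : (v : Plane → ℝ) ∈ 𝒯.trialSpace := v.2

theorem l2Inner_add_left (hΩ : IsConvexPolygonalDomain Ω) (hw : w ∈ 𝒯.trialSpace)
    (hF : IntegrableOn F Ω) (hG : IntegrableOn G Ω) :
    l2Inner Ω (fun x => F x + G x) (𝒯.interpStar w) =
      l2Inner Ω F (𝒯.interpStar w) + l2Inner Ω G (𝒯.interpStar w) := by
  rw [integral_mul_interpStar (F := fun x => F x + G x) hΩ hw (hF.add hG), integral_mul_interpStar hΩ hw hF,
    integral_mul_interpStar hΩ hw hG, ← Finset.sum_add_distrib]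
  refine Finset.sum_congr rfl fun K hK => ?_
  rw [← Finset.sum_add_distrib]
  refine Finset.sum_congr rfl fun z hz => ?_
  rw [integral_add ((integrableOn_convexHull hΩ hK hF).mono_set (dualCell_subset hK hz))
    ((integrableOn_convexHull hΩ hK hG).mono_set (dualCell_subset hK hz)), mul_add]

theorem l2Inner_const_mul_left (r : ℝ) (φ : Plane → ℝ) :
    l2Inner Ω (fun x => r * F x) φ = r * l2Inner Ω F φ := by
  simp only [l2Inner, mul_assoc]
  rw [integral_const_mul]

theorem l2Inner_interpStar_add (hΩ : IsConvexPolygonalDomain Ω) (hF : IntegrableOn F Ω)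
    (v w : 𝒯.trialSubmodule) :
    l2Inner Ω F (𝒯.interpStar (v + w : 𝒯.trialSubmodule)) =
      l2Inner Ω F (𝒯.interpStar v) + l2Inner Ω F (𝒯.interpStar w) := by
  rw [integral_mul_interpStar hΩ (coe_mem (v + w)) hF, integral_mul_interpStar hΩ (coe_mem v) hF,
    integral_mul_interpStar hΩ (coe_mem w) hF, ← Finset.sum_add_distrib]
  refine Finset.sum_congr rfl fun K _ => ?_
  rw [← Finset.sum_add_distrib]
  exact Finset.sum_congr rfl fun z _ => by simp [add_mul]

theorem l2Inner_interpStar_smul (hΩ : IsConvexPolygonalDomain Ω) (hF : IntegrableOn F Ω)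
    (r : ℝ) (v : 𝒯.trialSubmodule) :
    l2Inner Ω F (𝒯.interpStar (r • v : 𝒯.trialSubmodule)) =
      r * l2Inner Ω F (𝒯.interpStar v) := by
  rw [integral_mul_interpStar hΩ (coe_mem (r • v)) hF, integral_mul_interpStar hΩ (coe_mem v) hF,
    Finset.mul_sum]
  refine Finset.sum_congr rfl fun K _ => ?_
  rw [Finset.mul_sum]
  exact Finset.sum_congr rfl fun z _ => by simp [mul_assoc]

/-- The form `(p v, I* w)` with a weight `p`. -/
def weightedMass (hΩ : IsConvexPolygonalDomain Ω) (𝒯 : TriMesh Ω) {p : Plane → ℝ}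
    (hp : ContinuousOn p (closure Ω)) : 𝒯.trialSubmodule →ₗ[ℝ] 𝒯.trialSubmodule →ₗ[ℝ] ℝ :=
  have hi : ∀ v : 𝒯.trialSubmodule, IntegrableOn (fun x => p x * (v : Plane → ℝ) x) Ω := fun v =>
    integrableOn_of_continuousOn hΩ (hp.mul (coe_mem v).1)
  LinearMap.mk₂ ℝ (fun v w => l2Inner Ω (fun x => p x * (v : Plane → ℝ) x) (𝒯.interpStar w))
    (fun v v' w => by
      rw [← l2Inner_add_left hΩ (coe_mem w) (hi v) (hi v')]
      simp [mul_add])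
    (fun r v w => by
      rw [smul_eq_mul, ← l2Inner_const_mul_left]
      simp [mul_left_comm])
    (fun v w w' => l2Inner_interpStar_add hΩ (hi v) w w')
    (fun r v w => l2Inner_interpStar_smul hΩ (hi v) r w)

theorem weightedMass_apply (hΩ : IsConvexPolygonalDomain Ω) {p : Plane → ℝ}
    (hp : ContinuousOn p (closure Ω)) (v w : 𝒯.trialSubmodule) :
    weightedMass hΩ 𝒯 hp v w =
      l2Inner Ω (fun x => p x * (v : Plane → ℝ) x) (𝒯.interpStar w) := rfl

/-- The form `(v, I* w)`. -/
def massMap (hΩ : IsConvexPolygonalDomain Ω) (𝒯 : TriMesh Ω) :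
    𝒯.trialSubmodule →ₗ[ℝ] 𝒯.trialSubmodule →ₗ[ℝ] ℝ :=
  weightedMass hΩ 𝒯 (p := fun _ => 1) continuousOn_const

theorem massMap_apply (hΩ : IsConvexPolygonalDomain Ω) (v w : 𝒯.trialSubmodule) :
    massMap hΩ 𝒯 v w = l2Inner Ω v (𝒯.interpStar w) := by
  rw [massMap, weightedMass_apply]
  simp only [one_mul]

/-- The form `a(v, I* w)`. -/
def diffusionMap (hΩ : IsConvexPolygonalDomain Ω) (𝒯 : TriMesh Ω)
    {A : Plane → Matrix (Fin 2) (Fin 2) ℝ} {L B : ℝ} (hA : LipBound (closure Ω) A L B) :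
    𝒯.trialSubmodule →ₗ[ℝ] 𝒯.trialSubmodule →ₗ[ℝ] ℝ :=
  LinearMap.mk₂ ℝ (fun v w => 𝒯.form A v (𝒯.interpStar w))
    (fun v v' w => by
      rw [form_eq_sum hΩ (coe_mem w), form_eq_sum hΩ (coe_mem w), form_eq_sum hΩ (coe_mem w),
        ← Finset.sum_add_distrib]
      refine Finset.sum_congr rfl fun K hK => ?_
      obtain ⟨a, b, c, h⟩ := exists_isTriangle hK
      exact elemForm_add_left h (hA.mono (convexHull_subset hK)) (elemAffine (coe_mem v) hK)
        (elemAffine (coe_mem v') hK))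
    (fun r v w => by
      rw [form_eq_sum hΩ (coe_mem w), form_eq_sum hΩ (coe_mem w), smul_eq_mul, Finset.mul_sum]
      refine Finset.sum_congr rfl fun K hK => ?_
      obtain ⟨a, b, c, h⟩ := exists_isTriangle hK
      exact elemForm_smul_left h (elemAffine (coe_mem v) hK) r)
    (fun v w w' => by
      rw [form_eq_sum hΩ (coe_mem w), form_eq_sum hΩ (coe_mem w'),
        form_eq_sum hΩ (coe_mem (w + w')), ← Finset.sum_add_distrib]
      exact Finset.sum_congr rfl fun K _ => elemForm_add_right _ _ _)
    (fun r v w => by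
      rw [form_eq_sum hΩ (coe_mem w), form_eq_sum hΩ (coe_mem (r • w)), smul_eq_mul,
        Finset.mul_sum]
      exact Finset.sum_congr rfl fun K _ => elemForm_smul_right _ _ _)

theorem diffusionMap_apply (hΩ : IsConvexPolygonalDomain Ω)
    {A : Plane → Matrix (Fin 2) (Fin 2) ℝ} {L B : ℝ} (hA : LipBound (closure Ω) A L B)
    (v w : 𝒯.trialSubmodule) :
    diffusionMap hΩ 𝒯 hA v w = 𝒯.form A v (𝒯.interpStar w) := rfl

theorem vertSq_le_massMap (hΩ : IsConvexPolygonalDomain Ω) (v : 𝒯.trialSubmodule) :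
    𝒯.vertSq v ≤ massMap hΩ 𝒯 v v / ((refMass₀ - refMass₁) / refArea) := by
  rw [le_div_iff₀ massConst_pos, massMap_apply, mul_comm]
  exact le_mass hΩ (coe_mem v)

end TriMesh

/-! ### Structural estimates, uniform in the mesh -/

open TriMesh

/-- The structural estimates hold on all sufficiently fine quasi-uniform meshes, with constants
that do not depend on the mesh. -/
theorem exists_stableForms {Ω : Set Plane} (hΩ : IsConvexPolygonalDomain Ω)
    {A : Plane → Matrix (Fin 2) (Fin 2) ℝ} (hA : IsDiffusionCoeff Ω A) {L B : ℝ}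
    (hLB : LipBound (closure Ω) A L B)
    {q : Plane → ℝ} (hq : IsReactionCoeff Ω q) (hqc : ContinuousOn q (closure Ω))
    {ρ : ℝ} (hρ : 0 < ρ) :
    ∃ h₀ μ₅ μ₆ γ Cm Ca Ce Cq : ℝ, 0 < h₀ ∧ 0 < μ₅ ∧ 0 < μ₆ ∧ AsymmetryBound Ω A ρ μ₅ ∧
      CoercivityBound Ω A ρ h₀ μ₆ ∧
      ∀ 𝒯 : TriMesh Ω, 𝒯.IsQuasiUniform ρ → 𝒯.meshSize ≤ h₀ →
        StableForms (massMap hΩ 𝒯) (diffusionMap hΩ 𝒯 hLB) (weightedMass hΩ 𝒯 hqc)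
          (fun v => h1Norm Ω v ^ 2) γ μ₆ Cm Ca Ce Cq := by
  obtain ⟨β, hβ0, hβ⟩ := hA.posDef
  obtain ⟨P, hP0, hP⟩ := exists_poincare hΩ
  obtain ⟨Lq, hLq⟩ := hq.lipschitz
  obtain ⟨Bq, hBq⟩ := hΩ.isCompact_closure.exists_bound_of_continuousOn hqc
  have hL := hLB.nonneg
  have hB := hLB.bnonneg
  have hs := shapeConst_pos hρ
  have hr := refArea_pos
  set m := (refMass₀ - refMass₁) / refArea with hm
  have hm0 : 0 < m := massConst_pos
  set κ := β / (2 * refArea) with hκ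
  have hκ0 : 0 < κ := by positivity
  set D := 12 * L * shapeConst ρ with hD
  have hD0 : 0 ≤ D := by positivity
  -- Half of the frozen coercivity `κ` survives the freezing error; the Poincaré constant spreads it
  -- over the full norm.
  set μ := κ / (2 * (P + 1)) with hμ
  have hμ0 : 0 < μ := by positivity
  -- The three bounds serve, in turn, the inverse inequality and the upper bound of `a`, the
  -- coercivity of `a`, and the absorption of the reaction error into half of `μ`. The added ones
  -- keep the denominators positive when a Lipschitz constant is zero.
  set h₀ := min 1 (min (κ / (2 * (D + 1))) (μ * m ^ 2 / (18 * (Lq + 1)))) with hh₀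
  have hh1 : h₀ ≤ 1 := min_le_left _ _
  have hh2 : h₀ ≤ κ / (2 * (D + 1)) := (min_le_right _ _).trans (min_le_left _ _)
  have hh3 : h₀ ≤ μ * m ^ 2 / (18 * (Lq + 1)) := (min_le_right _ _).trans (min_le_right _ _)
  have hh0 : 0 < h₀ := by
    refine lt_min one_pos (lt_min (by positivity) (by positivity))
  set μ₅ := 2 * D + 1 with hμ₅
  have hμ₅0 : 0 < μ₅ := by positivity
  have hasym : AsymmetryBound Ω A ρ μ₅ := by
    intro 𝒯 hqu v hv w hw
    have hh := 𝒯.meshSize_nonneg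
    refine (abs_form_sub_form_le hΩ hρ hA hLB hqu hv hw).trans ?_
    have h1 : Real.sqrt (𝒯.gradSq v) * Real.sqrt (𝒯.gradSq w) ≤ h1Norm Ω v * h1Norm Ω w :=
      mul_le_mul (sqrt_gradSq_le hΩ hv) (sqrt_gradSq_le hΩ hw) (Real.sqrt_nonneg _)
        (h1Norm_nonneg Ω v)
    have h2 : 24 * L * shapeConst ρ * 𝒯.meshSize ≤ μ₅ * 𝒯.meshSize :=
      mul_le_mul_of_nonneg_right (by rw [hμ₅, hD]; linarith) hh
    rw [mul_assoc (μ₅ * 𝒯.meshSize)]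
    exact mul_le_mul h2 h1 (by positivity) (by positivity)
  have hcoer : CoercivityBound Ω A ρ h₀ μ := by
    intro 𝒯 hqu hh v hv
    have hg := 𝒯.gradSq_nonneg v
    refine le_trans ?_ (le_form hΩ hρ hLB hβ hqu hv)
    have h1 : D * 𝒯.meshSize ≤ κ / 2 := by
      have h2 := hh.trans hh2
      rw [le_div_iff₀ (by positivity)] at h2
      nlinarith [𝒯.meshSize_nonneg]
    have h3 := hP 𝒯 v hv
    have h4 : μ * (P + 1) = κ / 2 := by rw [hμ]; field_simp
    rw [sq_h1Norm hΩ hv]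
    calc μ * ((∫ x in Ω, v x ^ 2) + 𝒯.gradSq v) ≤ μ * (P * 𝒯.gradSq v + 𝒯.gradSq v) := by gcongr
      _ = κ / 2 * 𝒯.gradSq v := by rw [← h4]; ring
      _ ≤ _ := mul_le_mul_of_nonneg_right (by linarith) hg
  refine ⟨h₀, μ₅, μ, μ / 2, 3 / m, 2 * B / refArea + D, μ₅ ^ 2 * ((1 + 16 / ρ ^ 2) / m),
    3 * Bq ^ 2 / m, hh0, hμ₅0, hμ0, hasym, hcoer, fun 𝒯 hqu hh => ?_⟩
  have hmesh := 𝒯.meshSize_nonneg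
  have hint : ∀ v : 𝒯.trialSubmodule, ∫ x in Ω, (v : Plane → ℝ) x ^ 2 ≤ h1Norm Ω v ^ 2 := by
    intro v
    rw [sq_h1Norm hΩ (coe_mem v)]
    exact le_add_of_nonneg_right (𝒯.gradSq_nonneg _)
  have hMnn : ∀ v : 𝒯.trialSubmodule, 0 ≤ massMap hΩ 𝒯 v v := fun v => by
    rw [massMap_apply]
    exact (mul_nonneg hm0.le (𝒯.vertSq_nonneg _)).trans (le_mass hΩ (coe_mem v))
  refine ⟨by positivity, hμ0, by positivity, by positivity, by positivity, by positivity,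
    fun v => sq_nonneg _, fun v w => ?_, hMnn, fun v => ?_, fun v => ?_, fun v => ?_, fun v => ?_,
    fun v w => ?_, fun v w => ?_⟩
  · rw [massMap_apply, massMap_apply, mass_comm hΩ (coe_mem v) (coe_mem w)]
  · have h1 := mass_le hΩ (coe_mem v)
    rw [massMap_apply, div_mul_eq_mul_div, le_div_iff₀ hm0, mul_comm]
    exact h1.trans (mul_le_mul_of_nonneg_left (hint v) (by norm_num))
  · have h1 := hcoer 𝒯 hqu hh v (coe_mem v)
    have h2 := le_reaction hΩ hq.nonneg hLq (coe_mem v)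
    have h3 := vertSq_le hΩ (coe_mem v)
    rw [← hm] at h3
    have h4 : 18 * Lq * 𝒯.meshSize ≤ μ * m ^ 2 := by
      have h5 := hh.trans hh3
      rw [le_div_iff₀ (by positivity)] at h5
      nlinarith
    have h6 : 3 * Lq * 𝒯.meshSize * 𝒯.vertSq v ≤ μ / 2 * h1Norm Ω v ^ 2 := by
      have h7 := mul_le_mul_of_nonneg_right h4 (𝒯.vertSq_nonneg v)
      have h8 := mul_le_mul_of_nonneg_left (h3.trans (mul_le_mul_of_nonneg_left (hint v)
        (by norm_num : (0 : ℝ) ≤ 3))) hμ0.le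
      linarith
    rw [diffusionMap_apply, weightedMass_apply]
    linarith
  · exact hcoer 𝒯 hqu hh v (coe_mem v)
  · refine (form_le hΩ hρ hLB hqu (coe_mem v)).trans ?_
    have h1 : 𝒯.gradSq v ≤ h1Norm Ω v ^ 2 := by
      rw [sq_h1Norm hΩ (coe_mem v)]
      exact le_add_of_nonneg_left (integral_sq_nonneg Ω _)
    have h2 : D * 𝒯.meshSize ≤ D := mul_le_of_le_one_right hD0 (hh.trans hh1)
    exact mul_le_mul (by linarith) h1 (𝒯.gradSq_nonneg _) (by positivity)
  -- The factor `h` of the asymmetry is spent on the inverse inequality for `w`, which replaces the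
  -- energy norm of `w` by its mass norm.
  · have h1 := hasym 𝒯 hqu v (coe_mem v) w (coe_mem w)
    have h2 := sq_meshSize_mul_sq_h1Norm_le hΩ hρ hqu (hh.trans hh1) (coe_mem w)
    have h3 := vertSq_le_massMap hΩ w
    rw [diffusionMap_apply, diffusionMap_apply, ← sq_abs]
    calc _ ≤ (μ₅ * 𝒯.meshSize * h1Norm Ω v * h1Norm Ω w) ^ 2 := by gcongr
      _ = μ₅ ^ 2 * h1Norm Ω v ^ 2 * (𝒯.meshSize ^ 2 * h1Norm Ω w ^ 2) := by ring
      _ ≤ μ₅ ^ 2 * h1Norm Ω v ^ 2 * ((1 + 16 / ρ ^ 2) * (massMap hΩ 𝒯 w w / m)) := by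
        refine mul_le_mul_of_nonneg_left (h2.trans ?_) (by positivity)
        gcongr
      _ = _ := by ring
  · have hqv : ContinuousOn (fun x => q x * (v : Plane → ℝ) x) (closure Ω) :=
      hqc.mul (coe_mem v).1
    have h1 := sq_l2Inner_interpStar_le hΩ (coe_mem w) (integrableOn_of_continuousOn hΩ hqv)
      (integrableOn_of_continuousOn hΩ (hqv.pow 2))
    have h2 : ∫ x in Ω, (q x * (v : Plane → ℝ) x) ^ 2 ≤ Bq ^ 2 * h1Norm Ω v ^ 2 := by
      refine le_trans ?_ (mul_le_mul_of_nonneg_left (hint v) (sq_nonneg Bq))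
      rw [← integral_const_mul]
      refine setIntegral_mono_on (integrableOn_of_continuousOn hΩ (hqv.pow 2))
        ((integrableOn_of_continuousOn hΩ ((coe_mem v).1.pow 2)).const_mul _)
        hΩ.isOpen.measurableSet fun x hx => ?_
      rw [mul_pow]
      have h3 := hBq x (subset_closure hx)
      rw [Real.norm_eq_abs] at h3
      have h4 : q x ^ 2 ≤ Bq ^ 2 := by rw [← sq_abs]; gcongr
      gcongr
    have h3 := vertSq_le_massMap hΩ w
    rw [weightedMass_apply]
    calc _ ≤ _ := h1
      _ ≤ 3 * (Bq ^ 2 * h1Norm Ω v ^ 2) * (massMap hΩ 𝒯 w w / m) := by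
        have := 𝒯.vertSq_nonneg (w : Plane → ℝ)
        gcongr
      _ = _ := by ring

/-! ### Solutions of the scheme -/

section Scheme

variable {Ω : Set Plane} {𝒯 : TriMesh Ω} {A : Plane → Matrix (Fin 2) (Fin 2) ℝ} {q : Plane → ℝ}
  {α T : ℝ} {N : ℕ} {f : ℝ → Plane → ℝ} {u : ℕ → Plane → ℝ}

theorem l2Norm_nonneg (Ω : Set Plane) (v : Plane → ℝ) : 0 ≤ l2Norm Ω v := Real.sqrt_nonneg _

theorem supNorm_nonneg : 0 ≤ supNorm Ω T f := Real.iSup_nonneg fun _ => l2Norm_nonneg Ω _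

open Classical in
/-- The solution of the scheme as a sequence in the trial space. -/
def IsFVESolution.toTrial (h : IsFVESolution 𝒯 A q α T N f u) (n : ℕ) : 𝒯.trialSubmodule :=
  if hn : n ≤ N then ⟨u n, h.mem n hn⟩ else 0

theorem IsFVESolution.coe_toTrial (h : IsFVESolution 𝒯 A q α T N f u) {n : ℕ} (hn : n ≤ N) :
    (h.toTrial n : Plane → ℝ) = u n := by
  rw [toTrial, dif_pos hn]

theorem IsFVESolution.coe_l1Deriv (h : IsFVESolution 𝒯 A q α T N f u) (τ : ℝ) {n : ℕ}
    (hn : n ≤ N) :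
    (((τ ^ (-α) / Real.Gamma (2 - α)) • ∑ k ∈ Finset.range (n + 1),
      l1Coeff α n k • h.toTrial k : 𝒯.trialSubmodule) : Plane → ℝ) = l1Deriv α τ u n := by
  funext x
  rw [l1Deriv, Submodule.coe_smul, Submodule.coe_sum, Pi.smul_apply, Finset.sum_apply, smul_eq_mul]
  congr 1
  refine Finset.sum_congr rfl fun k hk => ?_
  have hk' : k ≤ N := by have := Finset.mem_range.1 hk; omega
  rw [Submodule.coe_smul, h.coe_toTrial hk', Pi.smul_apply, smul_eq_mul]

theorem IsFVESolution.scheme_map (h : IsFVESolution 𝒯 A q α T N f u)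
    (hΩ : IsConvexPolygonalDomain Ω) {L B : ℝ} (hLB : LipBound (closure Ω) A L B)
    (hqc : ContinuousOn q (closure Ω)) {n : ℕ} (hn1 : 1 ≤ n) (hn : n ≤ N)
    (w : 𝒯.trialSubmodule) :
    massMap hΩ 𝒯 (((T / N) ^ (-α) / Real.Gamma (2 - α)) • ∑ k ∈ Finset.range (n + 1),
        l1Coeff α n k • h.toTrial k) w + diffusionMap hΩ 𝒯 hLB (h.toTrial n) w +
      weightedMass hΩ 𝒯 hqc (h.toTrial n) w = l2Inner Ω (f (n * (T / N))) (𝒯.interpStar w) := by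
  rw [massMap_apply, h.coe_l1Deriv _ hn, diffusionMap_apply, weightedMass_apply, h.coe_toTrial hn]
  exact h.scheme n hn1 hn w (coe_mem w)

/-- Provides the dual bound on the load that the abstract estimates require, with a constant uniform
in time and mesh. -/
theorem IsSource.sq_l2Inner_le (hf : IsSource Ω T f) (hΩ : IsConvexPolygonalDomain Ω) {t : ℝ}
    (ht : t ∈ Icc (0 : ℝ) T) (w : 𝒯.trialSubmodule) :
    l2Inner Ω (f t) (𝒯.interpStar w) ^ 2 ≤
      3 * supNorm Ω T f ^ 2 / ((refMass₀ - refMass₁) / refArea) * massMap hΩ 𝒯 w w := by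
  have hvol : volume Ω ≠ ⊤ :=
    ((measure_mono subset_closure).trans_lt hΩ.isCompact_closure.measure_lt_top).ne
  have : IsFiniteMeasure (volume.restrict Ω) := isFiniteMeasure_restrict.2 hvol
  have h1 := sq_l2Inner_interpStar_le hΩ (coe_mem w) ((hf.memLp t ht).integrable one_le_two)
    (hf.memLp t ht).integrable_sq
  have h2 : ∫ x in Ω, f t x ^ 2 ≤ supNorm Ω T f ^ 2 := by
    rw [← sq_l2Norm]
    have h3 : l2Norm Ω (f t) ≤ supNorm Ω T f := le_ciSup hf.bdd (⟨t, ht⟩ : Icc (0 : ℝ) T)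
    have := l2Norm_nonneg Ω (f t)
    gcongr
  calc _ ≤ _ := h1
    _ ≤ 3 * supNorm Ω T f ^ 2 * (massMap hΩ 𝒯 w w / ((refMass₀ - refMass₁) / refArea)) := by
      have h4 := 𝒯.vertSq_nonneg (w : Plane → ℝ)
      have h5 := vertSq_le_massMap hΩ w
      gcongr
    _ = _ := by ring

theorem step_mem_Icc (hT : 0 < T) {n : ℕ} (hn1 : 1 ≤ n) (hn : n ≤ N) :
    (n : ℝ) * (T / N) ∈ Icc (0 : ℝ) T := by
  have hN : (0 : ℝ) < N := by exact_mod_cast (by omega : 0 < N)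
  have hn' : (n : ℝ) ≤ N := by exact_mod_cast hn
  refine ⟨by positivity, ?_⟩
  rw [mul_div_assoc', div_le_iff₀ hN]
  nlinarith

theorem l1_factor_pos (h0 : α < 1) (hT : 0 < T) (hN : 1 ≤ N) :
    0 < (T / N) ^ (-α) / Real.Gamma (2 - α) := by
  have hN' : (0 : ℝ) < N := by exact_mod_cast hN
  exact div_pos (Real.rpow_pos_of_pos (by positivity) _) (Real.Gamma_pos_of_pos (by linarith))

theorem le_mul_add_of_sq_le {x y z C : ℝ} (hy : 0 ≤ y) (hz : 0 ≤ z) (hC : 0 ≤ C)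
    (h : x ^ 2 ≤ C * (y ^ 2 + z ^ 2)) : x ≤ Real.sqrt C * (y + z) := by
  have h1 : 0 ≤ Real.sqrt C * (y + z) := by positivity
  refine abs_le_of_sq_le_sq' ?_ h1 |>.2
  rw [mul_pow, Real.sq_sqrt hC]
  refine h.trans (mul_le_mul_of_nonneg_left ?_ hC)
  nlinarith [mul_nonneg hy hz]

end Scheme

end FVE

end

/-! ### The theorem -/

open FVE FVE.TriMesh in
theorem theorem4p2 (Ω : Set FVE.Plane) (hΩ : FVE.IsConvexPolygonalDomain Ω)
    (A : FVE.Plane → Matrix (Fin 2) (Fin 2) ℝ) (hA : FVE.IsDiffusionCoeff Ω A)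
    (q : FVE.Plane → ℝ) (hq : FVE.IsReactionCoeff Ω q) (ρ : ℝ) (hρ : 0 < ρ) :
    ∃ h₀ : ℝ, 0 < h₀ ∧
      (∃ μ₅ μ₆ : ℝ, 0 < μ₅ ∧ 0 < μ₆ ∧
        FVE.AsymmetryBound Ω A ρ μ₅ ∧ FVE.CoercivityBound Ω A ρ h₀ μ₆) ∧
      ∀ α T : ℝ, 0 < α → α < 1 → 0 < T →
        (∃ C : ℝ, 0 < C ∧
          ∀ 𝒯 : FVE.TriMesh Ω, 𝒯.IsQuasiUniform ρ → 𝒯.meshSize ≤ h₀ →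
          ∀ N : ℕ, 1 ≤ N →
          ∀ f : ℝ → FVE.Plane → ℝ, FVE.IsSource Ω T f →
          ∀ u : ℕ → FVE.Plane → ℝ, FVE.IsFVESolution 𝒯 A q α T N f u →
          ∀ n : ℕ, 1 ≤ n → n ≤ N →
            FVE.l2Norm Ω (u n) ≤ C * (FVE.l2Norm Ω (u 0) + FVE.supNorm Ω T f)) ∧
        (∀ μ₅ μ₆ : ℝ, 0 < μ₅ → 0 < μ₆ →
          FVE.AsymmetryBound Ω A ρ μ₅ → FVE.CoercivityBound Ω A ρ h₀ μ₆ →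
          ∃ C : ℝ, 0 < C ∧ ∀ c₀ : ℝ, 0 < c₀ → ∃ τ₀ : ℝ, 0 < τ₀ ∧ τ₀ < 1 ∧
            ∀ 𝒯 : FVE.TriMesh Ω, 𝒯.IsQuasiUniform ρ → 𝒯.meshSize ≤ h₀ →
            ∀ N : ℕ, 1 ≤ N →
            𝒯.meshSize ≤ c₀ * (T / N) → c₀ * (T / N) ≤ c₀ * τ₀ →
            𝒯.meshSize ≤ min (μ₆ / μ₅) 1 →
            ∀ f : ℝ → FVE.Plane → ℝ, FVE.IsSource Ω T f →
            ∀ u : ℕ → FVE.Plane → ℝ, FVE.IsFVESolution 𝒯 A q α T N f u →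
            ∀ n : ℕ, 1 ≤ n → n ≤ N →
              FVE.h1Norm Ω (u n) ≤ C * Real.exp (c₀ * T * μ₅ / (2 * μ₆)) *
                (FVE.h1Norm Ω (u 0) + FVE.supNorm Ω T f)) := by
  obtain ⟨L, B, hLB⟩ := hA.exists_lipBound hΩ
  have hqc : ContinuousOn q (closure Ω) := by
    obtain ⟨l, hl⟩ := hq.lipschitz
    exact hl.continuousOn
  obtain ⟨h₀, ν₅, ν₆, γ, Cm, Ca, Ce, Cq, hh₀, hν₅, hν₆, hasym, hcoer, hstab⟩ :=
    exists_stableForms hΩ hA hLB hq hqc hρ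
  refine ⟨h₀, hh₀, ⟨ν₅, ν₆, hν₅, hν₆, hasym, hcoer⟩, fun α T h0 h1 hT => ⟨?_, ?_⟩⟩
  · set m := (refMass₀ - refMass₁) / refArea with hm
    have hm0 : 0 < m := massConst_pos
    -- The constant is fixed before any mesh is given, whereas the signs of `Cm` and `γ` come with
    -- `StableForms` on a mesh; the absolute value makes `X` positive without them.
    set X := 3 / m ^ 2 * (1 + |Cm ^ 2 / γ ^ 2|) with hX
    have hX0 : 0 < X := by positivity
    refine ⟨Real.sqrt X, Real.sqrt_pos.2 hX0, fun 𝒯 hqu hh N hN f hf u hu n hn1 hn => ?_⟩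
    refine le_mul_add_of_sq_le (l2Norm_nonneg Ω _) supNorm_nonneg hX0.le ?_
    have key := (hstab 𝒯 hqu hh).mass_stability (u := hu.toTrial)
      (ℓ := fun n w => l2Inner Ω (f (n * (T / N))) (𝒯.interpStar w))
      (R := 3 * supNorm Ω T f ^ 2 / m) h0 h1 (l1_factor_pos h1 hT hN) (by positivity)
      (fun n hn1 hn w => hf.sq_l2Inner_le hΩ (step_mem_Icc hT hn1 hn) w)
      (fun n hn1 hn w => hu.scheme_map hΩ hLB hqc hn1 hn w) hn
    have e1 := integral_sq_le hΩ (hu.mem n hn)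
    have e2 := le_mass hΩ (hu.mem n hn)
    have e3 := mass_le hΩ (hu.mem 0 (Nat.zero_le N))
    rw [massMap_apply, massMap_apply, hu.coe_toTrial hn, hu.coe_toTrial (Nat.zero_le N)] at key
    rw [← hm] at e2 e3
    rw [← sq_l2Norm] at e1 e3
    -- The stability of the mass form is carried over to the `L²` norm: from `u n` through `vertSq`
    -- to the mass form, and at the initial time back to the `L²` norm.
    have e4 : m ^ 2 * l2Norm Ω (u n) ^ 2 ≤
        3 * l2Norm Ω (u 0) ^ 2 + 3 * supNorm Ω T f ^ 2 * (Cm ^ 2 / γ ^ 2) := by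
      calc m ^ 2 * l2Norm Ω (u n) ^ 2 ≤ m * (m * 𝒯.vertSq (u n)) := by
            rw [pow_two, mul_assoc]; gcongr
        _ ≤ m * (l2Inner Ω (u 0) (𝒯.interpStar (u 0)) +
            3 * supNorm Ω T f ^ 2 / m * Cm ^ 2 / γ ^ 2) := by
            gcongr; exact e2.trans key
        _ = m * l2Inner Ω (u 0) (𝒯.interpStar (u 0)) +
            3 * supNorm Ω T f ^ 2 * (Cm ^ 2 / γ ^ 2) := by field_simp
        _ ≤ _ := by linarith
    have e5 : l2Norm Ω (u n) ^ 2 ≤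
        (3 * l2Norm Ω (u 0) ^ 2 + 3 * supNorm Ω T f ^ 2 * (Cm ^ 2 / γ ^ 2)) / m ^ 2 := by
      rw [le_div_iff₀ (by positivity), mul_comm]; exact e4
    refine e5.trans ?_
    rw [hX, div_mul_eq_mul_div, div_mul_eq_mul_div]
    refine div_le_div_of_nonneg_right ?_ (by positivity)
    have h2 := le_abs_self (Cm ^ 2 / γ ^ 2)
    have h3 := mul_le_mul_of_nonneg_left h2 (sq_nonneg (supNorm Ω T f))
    have h4 := mul_nonneg (abs_nonneg (Cm ^ 2 / γ ^ 2)) (sq_nonneg (l2Norm Ω (u 0)))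
    nlinarith [sq_nonneg (supNorm Ω T f)]
  · intro μ₅ μ₆ hμ₅ hμ₆ _ _
    set m := (refMass₀ - refMass₁) / refArea with hm
    have hm0 : 0 < m := massConst_pos
    set Λ := (Ce / 2 + 2 * Cq + γ) / γ with hΛ
    set Y := Λ * Cm + Ca with hY
    set Z := 3 / m * ((Λ * Cm / γ + 2) * Y / γ) with hZ
    -- Built from the constants of `exists_stableForms` only, hence independent of `c₀`; `Y` and `Z`
    -- are the factors of the initial energy and of the squared source norm.
    set X := (1 + |Y| + |Z|) / ν₆ with hX
    have hX0 : 0 < X := by positivity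
    -- Any number in `(0, 1)` serves as `τ₀`, since `hfin` holds for every time step.
    refine ⟨Real.sqrt X, Real.sqrt_pos.2 hX0, fun c₀ hc₀ => ⟨1 / 2, by norm_num, by norm_num,
      fun 𝒯 hqu hh N hN _ _ _ f hf u hu n hn1 hn => ?_⟩⟩
    have key := (hstab 𝒯 hqu hh).energy_stability (u := hu.toTrial)
      (ℓ := fun n w => l2Inner Ω (f (n * (T / N))) (𝒯.interpStar w))
      (R := 3 * supNorm Ω T f ^ 2 / m) h0 h1 (l1_factor_pos h1 hT hN) (by positivity)
      (fun n hn1 hn w => hf.sq_l2Inner_le hΩ (step_mem_Icc hT hn1 hn) w)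
      (fun n hn1 hn w => hu.scheme_map hΩ hLB hqc hn1 hn w) hΛ hn
    simp only [hu.coe_toTrial hn, hu.coe_toTrial (Nat.zero_le N)] at key
    have hfin : h1Norm Ω (u n) ≤ Real.sqrt X * (h1Norm Ω (u 0) + supNorm Ω T f) := by
      refine le_mul_add_of_sq_le (h1Norm_nonneg Ω _) supNorm_nonneg hX0.le ?_
      have e1 : 3 * supNorm Ω T f ^ 2 / m * ((Λ * Cm / γ + 2) * Y / γ) =
          Z * supNorm Ω T f ^ 2 := by rw [hZ]; ring
      rw [← hY, e1] at key
      rw [hX, div_mul_eq_mul_div, le_div_iff₀ hν₆]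
      have h2 := mul_le_mul_of_nonneg_right (le_abs_self Y) (sq_nonneg (h1Norm Ω (u 0)))
      have h3 := mul_le_mul_of_nonneg_right (le_abs_self Z) (sq_nonneg (supNorm Ω T f))
      have h4 := mul_nonneg (abs_nonneg Z) (sq_nonneg (h1Norm Ω (u 0)))
      have h5 := mul_nonneg (abs_nonneg Y) (sq_nonneg (supNorm Ω T f))
      linarith [sq_nonneg (h1Norm Ω (u 0)), sq_nonneg (supNorm Ω T f)]
    refine hfin.trans ?_
    have hexp : 1 ≤ Real.exp (c₀ * T * μ₅ / (2 * μ₆)) := Real.one_le_exp (by positivity)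
    have hnn : 0 ≤ h1Norm Ω (u 0) + supNorm Ω T f :=
      add_nonneg (h1Norm_nonneg Ω _) supNorm_nonneg
    exact mul_le_mul_of_nonneg_right (le_mul_of_one_le_right (Real.sqrt_nonneg _) hexp) hnn
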